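/- **Setting.** Let $X$ be a finite set. A *model* over $X$ is a prior $\mathcal P$, a probability measure on the simplex $\Delta(X)$ of probability distributions on $X$. In the *Bayesian adaptive data analysis game* with $n$ samples and $N$ queries, a distribution $p$ is drawn from $\mathcal P$ (hidden from both players), and the curator receives $n$ independent samples from $p$. In each of $N$ rounds the analyst, who knows $\mathcal P$ and all previous answers, asks a query $f:X\to[0,1]$ and the curator replies with some $a\in\mathbb R$. The answer is *$\varepsilon$-accurate* if $|\mathbb E_{x\sim p}f(x)-a|<\varepsilon$. Write $f(\mathcal P)$ for the law of $\mathbb E_{x\sim p}f(x)$ under $p\sim\mathcal P$, write $\mathcal P'$ for the Bayes posterior of $\mathcal P$ given the $n$ samples, and write $\mathbb E[f(\mathcal P')]=\int\mathbb E_{x\sim p}f(x)\,d\mathcal P'(p)$ for the posterior mean. A *posterior-mean-based* curator is given by an arbitrary function $g$ from pairs (probability measure on $\mathbb R$, real number) to probability distributions on $\mathbb R$: he answers each query $f$ by drawing $a$, with fresh randomness, from $g\big(f(\mathcal P),\mathbb E[f(\mathcal P')]\big)$. **Models.** $\mathcal M_1\otimes\mathcal M_2$ draws $p_1,p_2$ independently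 from the two priors and uses the product distribution $p_1\times p_2$; $\mathcal M^{\otimes r}$ is the $r$-fold tensor product of $\mathcal M$ with itself; $\mathcal M^r$ draws one $p$ from the prior and uses $p\times\dots\times p$ ($r$ factors). $U_2$ is the model over $\{0,1\}$ of a coin whose bias is uniform on $[0,1]$. For a linear code $\mathcal C\subseteq\mathbb F_2^m$, the model $\mathcal M_{\mathcal C}$ over $[m]\times\mathbb F_2$ draws a uniformly random codeword $c\in\mathcal C$ and uses the uniform distribution on $\{(i,c_i): i\in[m]\}$. For $t\ge1$, let $F$ be the field with $2^t$ elements, with $F\cong\mathbb F_2^t$ through a fixed $\mathbb F_2$-basis. The *Justesen code* of length $m=2t(2^t-1)$ consists of the words $\big(f(x),\,x f(x)\big)_{x\in F\setminus\{0\}}$, written in bits, where $f$ ranges over the polynomials over $F$ of degree $<2^{t-1}$; its rate is at least $1/4$. Let $J_m$ be its model $\mathcal M_{\mathcal C}$. **Theorem.** There are constants $\varepsilon,\delta,c_1,c_2,K>0$ such that for every sufficiently large length $m=2t(2^t-1)$ (and every choice of the basis) there are a number of samples $n$ with $c_1m\le n\le c_2m$ and an integer $q\ge1$ with $mq\le K\,n^4\log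 n$, such that the following holds for every integer $k\ge q$. In the game with $n$ samples on the model $$\big(J_m\otimes(U_2^8)^{\otimes(k-1)}\big)^{\otimes m}$$ there is an adaptive (deterministic) analyst strategy with $mq=O(n^4\log n)$ queries such that, against every posterior-mean-based curator $g$, with probability at least $\delta$ at least one of the answers is not $\varepsilon$-accurate. -/

import Mathlib

open MeasureTheory

noncomputable section

namespace BayesianADA

/-! ### Distributions on a finite universe -/

section Distributions

variable {X Y ι : Type*} [Fintype X] [Fintype Y] [Fintype ι]

/-- The product distribution `p × q` on `X × Y`. -/
def prodDistr (p : stdSimplex ℝ X) (q : stdSimplex ℝ Y) : stdSimplex ℝ (X × Y) :=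
  ⟨fun z => (p : X → ℝ) z.1 * (q : Y → ℝ) z.2,
    fun z => mul_nonneg (p.2.1 z.1) (q.2.1 z.2), by
      rw [Fintype.sum_prod_type, ← Finset.sum_mul_sum, stdSimplex.sum_eq_one p,
        stdSimplex.sum_eq_one q, one_mul]⟩

/-- The product distribution `∏ i, p i` on `ι → X`. -/
def piDistr [DecidableEq ι] (p : ι → stdSimplex ℝ X) : stdSimplex ℝ (ι → X) :=
  ⟨fun x => ∏ i, (p i : X → ℝ) (x i),
    fun x => Finset.prod_nonneg fun i _ => (p i).2.1 (x i), by
      rw [← Fintype.piFinset_univ, Finset.sum_prod_piFinset Finset.univ fun i => (p i : X → ℝ)]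
      exact Finset.prod_eq_one fun i _ => (p i).2.2⟩

/-- The true answer `𝔼_{x ∼ p} f x` of the query `f : X → [0,1]` on the distribution `p`. -/
def expect (p : stdSimplex ℝ X) (f : X → unitInterval) : ℝ :=
  ∑ x, (p : X → ℝ) x * (f x : ℝ)

/-- The probability that `n` independent samples from `p` are `xs 0, …, xs (n - 1)`. -/
def likelihood {n : ℕ} (p : stdSimplex ℝ X) (xs : Fin n → X) : ℝ :=
  ∏ i, (p : X → ℝ) (xs i)

end Distributions

/-! ### Models

A model over the finite universe `X` is a prior, that is, a probability measure on the simplex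
`stdSimplex ℝ X` of all distributions on `X`. -/

section Models

variable {X Y : Type*} [Fintype X] [Fintype Y]

/-- The tensor product of two models: the hypotheses are drawn independently from the two priors,
and the pair `(p₁, p₂)` stands for the product distribution `p₁ × p₂`. -/
def tensor (P₁ : Measure (stdSimplex ℝ X)) (P₂ : Measure (stdSimplex ℝ Y)) :
    Measure (stdSimplex ℝ (X × Y)) :=
  (P₁.prod P₂).map fun p => prodDistr p.1 p.2

/-- The `r`-th tensor power of a model: `r` hypotheses are drawn independently from the prior, and
a sample is an `r`-tuple with one sample from each of them. -/
def tensorPower (r : ℕ) (P : Measure (stdSimplex ℝ X)) : Measure (stdSimplex ℝ (Fin r → X)) :=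
  (Measure.pi fun _ : Fin r => P).map piDistr

/-- The `r`-th power of a model: a sample is an `r`-tuple of independent samples from one and the
same hypothesis, which is drawn from the prior. -/
def power (r : ℕ) (P : Measure (stdSimplex ℝ X)) : Measure (stdSimplex ℝ (Fin r → X)) :=
  P.map fun p => piDistr fun _ => p

/-- The biased coin on `{0, 1}` that shows `1` with probability `s`. -/
def coin (s : unitInterval) : stdSimplex ℝ (Fin 2) :=
  ⟨![1 - (s : ℝ), (s : ℝ)], by
    constructor
    · intro i
      fin_cases i
      · simpa using s.2.2
      · simpa using s.2.1
    · simp⟩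

/-- The uniform model on the universe `{0, 1}`: the uniform distribution on the segment
`stdSimplex ℝ (Fin 2)`, that is, a coin whose bias is uniform on `[0, 1]`. -/
def uniformModel : Measure (stdSimplex ℝ (Fin 2)) :=
  (volume : Measure unitInterval).map coin

variable {ι : Type*} [Fintype ι] [Nonempty ι]

/-- The hypothesis of the codeword `c`: it has weight `1 / m` on each of the points `(i, c i)`,
where `m` is the number of coordinates. -/
def graphDistr (c : ι → ZMod 2) : stdSimplex ℝ (ι × ZMod 2) :=
  ⟨fun z => if z.2 = c z.1 then 1 / (Fintype.card ι : ℝ) else 0,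
    fun z => by positivity, by
      rw [Fintype.sum_prod_type]
      simp⟩

/-- The model of a binary linear code `C`: a uniformly random codeword. -/
def codeModel (C : Submodule (ZMod 2) (ι → ZMod 2)) : Measure (stdSimplex ℝ (ι × ZMod 2)) :=
  (Nat.card C : ENNReal)⁻¹ • Measure.sum fun c : C => Measure.dirac (graphDistr (c : ι → ZMod 2))

end Models

/-! ### Justesen codes -/

section Justesen

variable {t : ℕ} {F : Type*} [Field F] [Algebra (ZMod 2) F]

/-- The coordinates of the Justesen code over the field `F` with `2 ^ t` elements. There are
`2 * t * (2 ^ t - 1)` of them: one block for each nonzero `x : F`, with two halves of `t` bits. -/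
abbrev JustesenIndex (F : Type*) [Field F] (t : ℕ) : Type _ := Fˣ × Fin 2 × Fin t

/-- The encoding map of the Justesen code. The polynomial `f` is first evaluated at all nonzero
`x : F` (Reed-Solomon code), and then the value `f x` is replaced by the pair `(f x, x * f x)`,
with the two entries written in bits with respect to the basis `b` of `F` over `𝔽₂`. -/
def justesenEncode (b : Module.Basis (Fin t) (ZMod 2) F) :
    Polynomial F →ₗ[ZMod 2] (JustesenIndex F t → ZMod 2) where
  toFun f z := b.repr ((z.1 : F) ^ (z.2.1 : ℕ) * f.eval (z.1 : F)) z.2.2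
  map_add' f g := by
    funext z
    simp [mul_add]
  map_smul' a f := by
    funext z
    simp [Polynomial.eval_smul]

/-- The Justesen code of rate about `1 / 4`: the outer code is the Reed-Solomon code of length
`2 ^ t - 1` and dimension `2 ^ (t - 1)`, and the inner codes have rate `1 / 2`. -/
def justesenCode (b : Module.Basis (Fin t) (ZMod 2) F) :
    Submodule (ZMod 2) (JustesenIndex F t → ZMod 2) :=
  ((Polynomial.degreeLT F (2 ^ (t - 1))).restrictScalars (ZMod 2)).map (justesenEncode b)

end Justesen

/-! ### Bayesian adaptive data analysis -/

section Game

variable {X : Type*} [Fintype X]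

/-- The distribution `f(P)` of the true answer to the query `f` under the prior `P`. -/
def queryPrior (P : Measure (stdSimplex ℝ X)) (f : X → unitInterval) : Measure ℝ :=
  P.map fun p => expect p f

/-- The posterior after the samples `xs`, by Bayes' rule. -/
def posterior {n : ℕ} (P : Measure (stdSimplex ℝ X)) (xs : Fin n → X) :
    Measure (stdSimplex ℝ X) :=
  (∫⁻ p, ENNReal.ofReal (likelihood p xs) ∂P)⁻¹ •
    P.withDensity fun p => ENNReal.ofReal (likelihood p xs)

/-- The posterior mean of the query `f` after the samples `xs`. -/
def posteriorMean {n : ℕ} (P : Measure (stdSimplex ℝ X)) (xs : Fin n → X)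
    (f : X → unitInterval) : ℝ :=
  ∫ p, expect p f ∂(posterior P xs)

/-- A (deterministic) adaptive strategy of the analyst: in round `t` the query is chosen as a
function of the answers to the queries in the rounds `0, …, t - 1`. The measurability condition
makes every event of the game measurable, whatever the curator does. -/
structure Strategy (X : Type*) where
  query : (t : ℕ) → (Fin t → ℝ) → (X → unitInterval)
  measurableSet_query : ∀ (t : ℕ) (A : Set (X → unitInterval)), MeasurableSet (query t ⁻¹' A)

/-- A curator who answers each query by a fixed randomized function of the prior distribution on
the query and of the posterior mean of the query: the answer is drawn, with fresh randomness, from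
the distribution `g (f(P)) (𝔼[f(P')])` on `ℝ`. No measurability in the two arguments is assumed. -/
abbrev MeanCurator : Type := Measure ℝ → ℝ → ProbabilityMeasure ℝ

/-- The joint distribution of the first `N` answers of the curator `g`, who has received the
samples `xs`, to the analyst's strategy `S`. -/
def transcript {n : ℕ} (P : Measure (stdSimplex ℝ X)) (g : MeanCurator) (S : Strategy X)
    (xs : Fin n → X) : (N : ℕ) → Measure (Fin N → ℝ)
  | 0 => Measure.dirac Fin.elim0
  | N + 1 => (transcript P g S xs N).bind fun h =>
      (g (queryPrior P (S.query N h)) (posteriorMean P xs (S.query N h)) : Measure ℝ).map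
        fun a => (Fin.snoc h a : Fin (N + 1) → ℝ)

/-- The transcripts `a` of `N` answers such that, under the true distribution `p`, at least one of
the answers is not `ε`-accurate. -/
def inaccurate (S : Strategy X) (p : stdSimplex ℝ X) (N : ℕ) (ε : ℝ) : Set (Fin N → ℝ) :=
  {a | ∃ i : Fin N, ¬ |expect p (S.query i fun j => a (j.castLE i.2.le)) - a i| < ε}

/-- The probability that at least one of the answers to the `N` queries of the strategy `S` is not
`ε`-accurate, when the true distribution `p` is drawn from the prior `P`, and the curator `g`
receives `n` independent samples from `p`. -/
def failureProb (P : Measure (stdSimplex ℝ X)) (n : ℕ) (g : MeanCurator) (S : Strategy X)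
    (N : ℕ) (ε : ℝ) : ENNReal :=
  ∫⁻ p, ∑ xs : Fin n → X,
    ENNReal.ofReal (likelihood p xs) * transcript P g S xs N (inaccurate S p N ε) ∂P

end Game

/-! ### The model -/

section Challenge

variable {ι : Type*} [Fintype ι] [Nonempty ι]

/-- The universe of the model `(J ⊗ (U₂ ^ 8) ^ ⊗(q - 1)) ^ ⊗m`, where `J` is the model of a code
with coordinates in `ι`. -/
abbrev ChallengeUniverse (ι : Type*) (q m : ℕ) : Type _ :=
  Fin m → (ι × ZMod 2) × (Fin (q - 1) → Fin 8 → Fin 2)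

/-- The model `(J ⊗ (U₂ ^ 8) ^ ⊗(q - 1)) ^ ⊗m`, where `J` is the model of the code `C`. -/
def challengeModel (C : Submodule (ZMod 2) (ι → ZMod 2)) (q m : ℕ) :
    Measure (stdSimplex ℝ (ChallengeUniverse ι q m)) :=
  tensorPower m (tensor (codeModel C) (tensorPower (q - 1) (power 8 uniformModel)))

end Challenge

end BayesianADA

end

set_option linter.unusedSectionVars false

noncomputable section

namespace BayesianADA

/-! ### Codewords that vanish at given coordinates -/

section Vanishing

variable {ι : Type*} [Fintype ι]

/-! Consider one block, and suppose that exactly two codewords, c and c + d, are consistent with its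
samples. Both give the curator the same samples, hence the same law of the transcript, yet they
differ in at least m/128 coordinates. If the analyst can name one of the two, the query for
agreement with it has the true answers 1 and at most 1 - 1/128 in the two cases, and no answer is
1/256-accurate for both (`mem_inaccurate_or`). On average over the codewords the curator then fails
with constant probability.

To learn a codeword, the analyst adds `signal` times the indicator of the point (i, e) to a third of
a toss of a fresh coin. The number of ones among the 8n tosses is uniform on {0, ..., 8n}, and
`signal` is tuned so that in the posterior mean the point counts as two further ones if it is known
to be present, as none if it is known to be absent, and as one if c and c + d disagree at i
(`indexLaw_eq`). The prior of the query depends neither on e nor on the coin, so the curator sees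
only the shifted count. Let x(N) be the chance that he answers the count N by more than 1/6.
Averaged over the coin, the shifts 2 and 0 differ by the telescoped term (x(8n+1) + x(8n+2) - x(0) -
x(1)) / (8n+1), whereas at a coordinate where c and c + d disagree both values of e give the shift 1
and no difference.

If the boundary values of x are on the right side, order n² log n repetitions reveal, by Hoeffding's
inequality, all bits at which c and c + d agree. These include the sampled ones, so any codeword
that matches the clear bits is c or c + d (`le_measure_pi_guess`). If they are on the wrong side,
the curator misjudges coins whose bias is probably extreme, and some repetition is already answered
inaccurately (`le_inaccuracy_of_misplaced`).

It remains to see that two codewords are left often enough. One more coordinate at most halves the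
space of codewords vanishing at the sampled ones, so its size cannot reach 1 without passing through
2. It exceeds 1 without samples, and by the distance of the Justesen code it is 1 with probability
at least 1/2 after 256m samples. Hence some n ≤ 256m leaves exactly two codewords with probability
at least 1/(512m) (`exists_card_critical_ge`), and m independent blocks raise this to a constant
(`one_sub_exp_le`). The rate of the code forces m ≤ 8n. -/

open Classical in
/-- The Hamming weight of a word. -/
def wt (c : ι → ZMod 2) : ℕ := (Finset.univ.filter fun i => c i ≠ 0).card

theorem wt_zero : wt (0 : ι → ZMod 2) = 0 := by simp [wt]

theorem wt_neg (d : ι → ZMod 2) : wt (-d) = wt d := by simp [wt]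

open Classical in
/-- The words of the code `C` that vanish at all the coordinates `I 0, …, I (n - 1)`. -/
def vanishing (C : Submodule (ZMod 2) (ι → ZMod 2)) {n : ℕ} (I : Fin n → ι) :
    Finset (ι → ZMod 2) :=
  Finset.univ.filter fun c => c ∈ C ∧ ∀ r, c (I r) = 0

variable {C : Submodule (ZMod 2) (ι → ZMod 2)} {n : ℕ} {I : Fin n → ι}

theorem mem_vanishing {c : ι → ZMod 2} : c ∈ vanishing C I ↔ c ∈ C ∧ ∀ r, c (I r) = 0 := by
  simp [vanishing]

theorem zero_mem_vanishing : (0 : ι → ZMod 2) ∈ vanishing C I :=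
  mem_vanishing.2 ⟨C.zero_mem, fun _ => rfl⟩

theorem card_vanishing_pos : 0 < (vanishing C I).card :=
  Finset.card_pos.2 ⟨0, zero_mem_vanishing⟩

theorem zmod_two_eq (a : ZMod 2) : a = 0 ∨ a = 1 := by
  revert a; decide

open Classical in
-- One more coordinate is one more linear equation over the field with two elements: translation by
-- a vanishing word that is nonzero at `x` injects the words with value 1 at `x` into those with
-- value 0.
theorem card_vanishing_le_cons (x : ι) :
    (vanishing C I).card ≤
      2 * (vanishing C (Fin.cons x I : Fin (n + 1) → ι)).card := by
  have h1 : (vanishing C I).filter (fun c => c x = 0) =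
      vanishing C (Fin.cons x I : Fin (n + 1) → ι) := by
    ext c
    simp only [Finset.mem_filter, mem_vanishing, Fin.forall_fin_succ, Fin.cons_zero, Fin.cons_succ]
    tauto
  have h2 : ((vanishing C I).filter (fun c => ¬ c x = 0)).card ≤
      ((vanishing C I).filter (fun c => c x = 0)).card := by
    by_cases hne : ((vanishing C I).filter (fun c => ¬ c x = 0)).Nonempty
    · obtain ⟨e, he⟩ := hne
      rw [Finset.mem_filter, mem_vanishing] at he
      refine Finset.card_le_card_of_injOn (fun c => c + e) ?_ fun a _ b _ h => by simpa using h
      intro c hc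
      simp only [Finset.coe_filter, Set.mem_ofPred_eq, mem_vanishing] at hc ⊢
      refine ⟨⟨C.add_mem hc.1.1 he.1.1, fun r => ?_⟩, ?_⟩
      · simp [hc.1.2 r, he.1.2 r]
      · have := (zmod_two_eq (c x)).resolve_left hc.2
        have h' := (zmod_two_eq (e x)).resolve_left he.2
        rw [Pi.add_apply, this, h']
        decide
    · rw [Finset.not_nonempty_iff_eq_empty.1 hne]
      simp
  have h3 := Finset.card_filter_add_card_filter_not (s := vanishing C I) (fun c => c x = 0)
  rw [← h1]
  omega

/-- For critical coordinates this gives `Nat.card C ≤ 2 ^ (n + 1)`, the source of the lower bound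
for `n`. -/
theorem card_le_two_pow_mul_card_vanishing :
    ∀ {n : ℕ} (I : Fin n → ι), Nat.card C ≤ 2 ^ n * (vanishing C I).card
  | 0, I => by
    classical
    rw [pow_zero, one_mul, Nat.card_eq_fintype_card, Fintype.card_subtype]
    refine Finset.card_le_card fun c hc => ?_
    rw [mem_vanishing]
    exact ⟨by simpa using hc, fun r => r.elim0⟩
  | n + 1, I => by
    have h := card_vanishing_le_cons (C := C) (I := fun i => I i.succ) (I 0)
    have h' := card_le_two_pow_mul_card_vanishing (fun i => I i.succ)
    have e : (Fin.cons (I 0) (fun i => I i.succ) : Fin (n + 1) → ι) = I := Fin.cons_self_tail I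
    rw [e] at h
    calc Nat.card C ≤ 2 ^ n * (vanishing C fun i => I i.succ).card := h'
      _ ≤ 2 ^ n * (2 * (vanishing C I).card) := by gcongr
      _ = _ := by ring

variable (C) in
open Classical in
/-- The choices of `n` coordinates at which more than the zero codeword vanishes. -/
def ambiguous (n : ℕ) : Finset (Fin n → ι) := Finset.univ.filter fun I => (vanishing C I).card ≠ 1

variable (C) in
open Classical in
/-- The choices of `n` coordinates at which exactly one nonzero codeword vanishes. -/
def critical (n : ℕ) : Finset (Fin n → ι) := Finset.univ.filter fun I => (vanishing C I).card = 2

open Classical in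
-- By halving, a further coordinate can resolve an ambiguity only if exactly two words were left,
-- that is, only from a critical choice.
theorem card_ambiguous_mul_le (n : ℕ) :
    (ambiguous C n).card * Fintype.card ι ≤
      (ambiguous C (n + 1)).card + (critical C n).card * Fintype.card ι := by
  have h : (ambiguous C n ×ˢ (Finset.univ : Finset ι)) ⊆
      ((ambiguous C n ×ˢ (Finset.univ : Finset ι)).filter fun z =>
        (Fin.cons z.2 z.1 : Fin (n + 1) → ι) ∈ ambiguous C (n + 1)) ∪
      (critical C n ×ˢ (Finset.univ : Finset ι)) := by
    rintro ⟨I, x⟩ hz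
    simp only [Finset.mem_union, Finset.mem_filter, Finset.mem_product, Finset.mem_univ, and_true,
      ambiguous, critical, true_and] at hz ⊢
    have h1 := card_vanishing_le_cons (C := C) (I := I) x
    have h2 := card_vanishing_pos (C := C) (I := I)
    by_cases h3 : (vanishing C (Fin.cons x I : Fin (n + 1) → ι)).card = 1
    · right; omega
    · exact Or.inl ⟨hz, h3⟩
  have h' := (Finset.card_le_card h).trans (Finset.card_union_le _ _)
  rw [Finset.card_product, Finset.card_product, Finset.card_univ] at h'
  refine h'.trans (Nat.add_le_add_right ?_ _)
  refine Finset.card_le_card_of_injOn (fun z => (Fin.cons z.2 z.1 : Fin (n + 1) → ι)) ?_ ?_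
  · intro z hz
    exact (Finset.mem_filter.1 hz).2
  · rintro ⟨I, x⟩ _ ⟨J, y⟩ _ hzz
    have := Fin.cons_inj.1 hzz
    exact Prod.ext this.2 this.1

open Classical in
-- Union bound over the nonzero codewords: all `n` coordinates must be among the zeros of one of
-- them.
theorem card_ambiguous_le (n : ℕ) :
    (ambiguous C n).card ≤
      ∑ c ∈ (Finset.univ.filter fun c => c ∈ C ∧ c ≠ 0), (Fintype.card ι - wt c) ^ n := by
  have h : ambiguous C n ⊆ (Finset.univ.filter fun c => c ∈ C ∧ c ≠ 0).biUnion
      fun c => Fintype.piFinset fun _ : Fin n => Finset.univ.filter fun i => c i = 0 := by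
    intro I hI
    have h2 := card_vanishing_pos (C := C) (I := I)
    have h3 : 1 < (vanishing C I).card := by
      have := (Finset.mem_filter.1 hI).2
      omega
    obtain ⟨c, hc, hc0⟩ := Finset.exists_mem_ne h3 0
    rw [mem_vanishing] at hc
    rw [Finset.mem_biUnion]
    refine ⟨c, by simp [hc.1, hc0], ?_⟩
    simpa using hc.2
  refine (Finset.card_le_card h).trans (Finset.card_biUnion_le.trans (Finset.sum_le_sum ?_))
  intro c _
  rw [Fintype.card_piFinset, Finset.prod_const, Finset.card_univ, Fintype.card_fin]
  have := Finset.card_filter_add_card_filter_not (s := Finset.univ) (fun i : ι => c i = 0)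
  rw [Finset.card_univ] at this
  have e : (Finset.univ.filter fun i : ι => c i = 0).card = Fintype.card ι - wt c := by
    rw [wt]; simp only [ne_eq]; omega
  rw [e]

open Classical in
-- With relative distance 1/128, the factor (127/128)^256 ≤ 1/4 per coordinate of the code beats the
-- number of codewords, which is at most 2^m.
theorem two_mul_card_ambiguous_le [Nonempty ι]
    (hd : ∀ c ∈ C, c ≠ 0 → Fintype.card ι ≤ 128 * wt c) :
    2 * ((ambiguous C (256 * Fintype.card ι)).card : ℝ) ≤
      (Fintype.card ι : ℝ) ^ (256 * Fintype.card ι) := by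
  set m := Fintype.card ι with hm
  have hm0 : 0 < m := Fintype.card_pos
  have h1 : ((ambiguous C (256 * m)).card : ℝ) ≤
      ∑ c ∈ (Finset.univ.filter fun c => c ∈ C ∧ c ≠ 0),
        ((127 / 128 : ℝ) * m) ^ (256 * m) := by
    refine (Nat.cast_le.2 (card_ambiguous_le (C := C) (256 * m))).trans ?_
    push_cast
    refine Finset.sum_le_sum fun c hc => ?_
    have hc' := (Finset.mem_filter.1 hc).2
    have h := hd c hc'.1 hc'.2
    have hw : wt c ≤ m := by
      rw [hm, ← Finset.card_univ]; exact Finset.card_filter_le _ _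
    gcongr
    rw [Nat.cast_sub hw]
    have : (m : ℝ) ≤ 128 * wt c := by exact_mod_cast h
    linarith
  have h2 : ((Finset.univ.filter fun c => c ∈ C ∧ c ≠ 0).card : ℝ) ≤ 2 ^ m := by
    have : (Finset.univ.filter fun c : ι → ZMod 2 => c ∈ C ∧ c ≠ 0).card ≤ 2 ^ m := by
      refine (Finset.card_filter_le _ _).trans ?_
      simp [ZMod.card, hm]
    exact_mod_cast this
  rw [Finset.sum_const, nsmul_eq_mul, mul_pow] at h1
  have h3 : (127 / 128 : ℝ) ^ (256 * m) ≤ (1 / 4) ^ m := by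
    rw [pow_mul]
    gcongr
    norm_num
  have h4 : (2 : ℝ) ^ m * (1 / 4) ^ m ≤ 1 / 2 := by
    rw [← mul_pow]
    calc ((2 : ℝ) * (1 / 4)) ^ m ≤ (2 * (1 / 4)) ^ 1 :=
          pow_le_pow_of_le_one (by norm_num) (by norm_num) hm0
      _ = 1 / 2 := by norm_num
  calc 2 * ((ambiguous C (256 * m)).card : ℝ)
      ≤ 2 * (2 ^ m * ((1 / 4) ^ m * (m : ℝ) ^ (256 * m))) := by
        refine mul_le_mul_of_nonneg_left (h1.trans ?_) (by norm_num)
        gcongr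
    _ = 2 * (2 ^ m * (1 / 4) ^ m) * (m : ℝ) ^ (256 * m) := by ring
    _ ≤ 2 * (1 / 2) * (m : ℝ) ^ (256 * m) := by gcongr
    _ = _ := by ring

/-- For a suitable number `n` of random coordinates, it happens with probability at least of the
order of `1 / m` that exactly one nonzero codeword vanishes at all of them. -/
theorem exists_card_critical_ge [Nonempty ι] (hC : 1 < Nat.card C)
    (hd : ∀ c ∈ C, c ≠ 0 → Fintype.card ι ≤ 128 * wt c) :
    ∃ n ≤ 256 * Fintype.card ι, Nat.card C ≤ 2 ^ (n + 1) ∧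
      (Fintype.card ι : ℝ) ^ n ≤ 512 * Fintype.card ι * (critical C n).card := by
  classical
  set m := Fintype.card ι with hm
  have hm0 : 0 < m := Fintype.card_pos
  have hmR : (0 : ℝ) < m := by exact_mod_cast hm0
  -- `τ n` and `a n` are the probabilities that `n` random coordinates are ambiguous and critical;
  -- from `n` to `n + 1`, `τ` drops by at most `a n`.
  set τ : ℕ → ℝ := fun n => (ambiguous C n).card / (m : ℝ) ^ n with hτ
  set a : ℕ → ℝ := fun n => (critical C n).card / (m : ℝ) ^ n with ha
  have step : ∀ n, τ n ≤ τ (n + 1) + a n := by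
    intro n
    have h : ((ambiguous C n).card : ℝ) * m ≤
        (ambiguous C (n + 1)).card + (critical C n).card * m := by
      exact_mod_cast card_ambiguous_mul_le (C := C) n
    simp only [hτ, ha]
    rw [← sub_nonneg]
    have : ((ambiguous C (n + 1)).card : ℝ) / (m : ℝ) ^ (n + 1) +
        (critical C n).card / (m : ℝ) ^ n - (ambiguous C n).card / (m : ℝ) ^ n =
        ((ambiguous C (n + 1)).card + (critical C n).card * m - (ambiguous C n).card * m) /
          (m : ℝ) ^ (n + 1) := by
      field_simp
      ring
    rw [this]
    exact div_nonneg (by linarith) (by positivity)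
  have total : ∀ N, τ 0 ≤ τ N + ∑ n ∈ Finset.range N, a n := by
    intro N
    induction N with
    | zero => simp
    | succ N ih =>
      rw [Finset.sum_range_succ]
      linarith [step N]
  have h0 : τ 0 = 1 := by
    have : ambiguous C 0 = Finset.univ := by
      refine Finset.eq_univ_of_forall fun I => ?_
      simp only [ambiguous, Finset.mem_filter, Finset.mem_univ, true_and]
      have := card_le_two_pow_mul_card_vanishing (C := C) I
      simp only [pow_zero, one_mul] at this
      omega
    simp [hτ, this]
  have hN : τ (256 * m) ≤ 1 / 2 := by
    have h := two_mul_card_ambiguous_le hd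
    simp only [hτ]
    rw [div_le_iff₀ (by positivity)]
    linarith
  have hsum : (1 : ℝ) / 2 ≤ ∑ n ∈ Finset.range (256 * m), a n := by
    have := total (256 * m)
    linarith
  -- Pigeonhole: 256m critical probabilities sum to at least 1/2.
  have hex : ∃ n ∈ Finset.range (256 * m), 1 / (512 * (m : ℝ)) ≤ a n := by
    refine Finset.exists_le_of_sum_le (f := fun _ => 1 / (512 * (m : ℝ))) ?_ ?_
    · simpa using hm0.ne'
    · refine le_trans (le_of_eq ?_) hsum
      rw [Finset.sum_const, Finset.card_range, nsmul_eq_mul]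
      push_cast
      field_simp
      norm_num
  obtain ⟨n, hn, hna⟩ := hex
  have hcrit : (m : ℝ) ^ n ≤ 512 * m * (critical C n).card := by
    simp only [ha] at hna
    rw [div_le_div_iff₀ (by positivity) (by positivity)] at hna
    linarith
  refine ⟨n, (Finset.mem_range.1 hn).le, ?_, hcrit⟩
  have hne : (critical C n).Nonempty := by
    rw [← Finset.card_pos]
    by_contra h
    have : (critical C n).card = 0 := by omega
    rw [this] at hcrit
    have : (0 : ℝ) < (m : ℝ) ^ n := by positivity
    simp at hcrit
    linarith
  obtain ⟨I, hI⟩ := hne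
  have h := card_le_two_pow_mul_card_vanishing (C := C) I
  rw [(Finset.mem_filter.1 hI).2] at h
  rwa [pow_succ]

end Vanishing

/-! ### The distance of the Justesen code -/

section JustesenDistance

theorem sum_pow_wt {κ : Type*} [Fintype κ] [DecidableEq κ] (x : ℝ) :
    ∑ v : κ → ZMod 2, x ^ wt v = (1 + x) ^ Fintype.card κ := by
  have h : ∀ v : κ → ZMod 2, x ^ wt v = ∏ i, if v i = 0 then 1 else x := by
    intro v
    rw [Finset.prod_ite, Finset.prod_const_one, one_mul, Finset.prod_const, wt]
  simp_rw [h]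
  rw [← Fintype.piFinset_univ,
    Finset.sum_prod_piFinset Finset.univ fun _ : κ => fun a : ZMod 2 => if a = 0 then (1 : ℝ) else x]
  rw [Finset.prod_const, Finset.card_univ]
  congr 1
  rw [show (Finset.univ : Finset (ZMod 2)) = {0, 1} by decide,
    Finset.sum_pair (by decide)]
  simp

/-- Words of length `2 * t` and of weight at most `t / 16` are rare. -/
theorem card_wt_le {κ : Type*} [Fintype κ] [DecidableEq κ] {t : ℕ} (ht : 4 ≤ t)
    (hκ : Fintype.card κ = 2 * t) :
    (Finset.univ.filter fun v : κ → ZMod 2 => 16 * wt v ≤ t).card ≤ 2 ^ (t - 2) := by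
  set K := (Finset.univ.filter fun v : κ → ZMod 2 => 16 * wt v ≤ t).card with hK
  set w := t / 16 with hw
  -- Chernoff's method: each word `v` is given the weight (1/16)^(wt v), and the sum is extended to
  -- all words.
  have h1 : (K : ℝ) * (1 / 16) ^ w ≤ (17 / 16) ^ (2 * t) := by
    calc (K : ℝ) * (1 / 16) ^ w
        = ∑ v ∈ (Finset.univ.filter fun v : κ → ZMod 2 => 16 * wt v ≤ t), (1 / 16 : ℝ) ^ w := by
          rw [Finset.sum_const, nsmul_eq_mul]
      _ ≤ ∑ v ∈ (Finset.univ.filter fun v : κ → ZMod 2 => 16 * wt v ≤ t),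
            (1 / 16 : ℝ) ^ wt v := by
          refine Finset.sum_le_sum fun v hv => ?_
          have := (Finset.mem_filter.1 hv).2
          exact pow_le_pow_of_le_one (by norm_num) (by norm_num) (by omega)
      _ ≤ ∑ v : κ → ZMod 2, (1 / 16 : ℝ) ^ wt v :=
          Finset.sum_le_sum_of_subset_of_nonneg (Finset.subset_univ _) fun _ _ _ => by positivity
      _ = (17 / 16) ^ (2 * t) := by rw [sum_pow_wt, hκ]; norm_num
  have h2 : (K : ℝ) ≤ (17 / 16) ^ (2 * t) * 16 ^ w := by
    rw [one_div, inv_pow, ← div_eq_mul_inv, div_le_iff₀ (by positivity)] at h1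
    exact h1
  -- Fourth powers keep the exponents integral: (17/16)^8 ≤ 2 and 16 * (t / 16) ≤ t, and then 2t ≤
  -- 4(t - 2) because t ≥ 4.
  have h3 : (K : ℝ) ^ 4 ≤ (2 ^ (t - 2)) ^ 4 := by
    calc (K : ℝ) ^ 4 ≤ ((17 / 16) ^ (2 * t) * 16 ^ w) ^ 4 := by gcongr
      _ = ((17 / 16) ^ 8) ^ t * 2 ^ (16 * w) := by
          rw [mul_pow, ← pow_mul, ← pow_mul, ← pow_mul,
            show (16 : ℝ) = 2 ^ 4 by norm_num, ← pow_mul]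
          ring_nf
      _ ≤ 2 ^ t * 2 ^ t := by
          gcongr
          · norm_num
          · norm_num
          · omega
      _ = 2 ^ (2 * t) := by rw [← pow_add]; ring_nf
      _ ≤ 2 ^ ((t - 2) * 4) := pow_le_pow_right₀ (by norm_num) (by omega)
      _ = _ := by rw [pow_mul]
  have h4 := le_of_pow_le_pow_left₀ (by norm_num) (by positivity) h3
  exact_mod_cast h4

variable {t : ℕ} {F : Type} [Field F] [Algebra (ZMod 2) F]

theorem card_field [Fintype F] (b : Module.Basis (Fin t) (ZMod 2) F) : Fintype.card F = 2 ^ t := by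
  rw [Module.card_fintype b, ZMod.card, Fintype.card_fin]

theorem card_justesenIndex [Fintype F] [DecidableEq F]
    (b : Module.Basis (Fin t) (ZMod 2) F) :
    Fintype.card (JustesenIndex F t) = (2 ^ t - 1) * (2 * t) := by
  simp [JustesenIndex, Fintype.card_units, card_field b]

/-- There are 2^t - 1 nonzero points, and at most 2^(t-1) - 1 of them are roots. -/
theorem card_eval_ne_zero [Fintype F] [DecidableEq F] [NeZero t]
    (b : Module.Basis (Fin t) (ZMod 2) F) {f : Polynomial F}
    (hf : f ∈ Polynomial.degreeLT F (2 ^ (t - 1))) (h0 : f ≠ 0) :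
    2 ^ (t - 1) ≤ (Finset.univ.filter fun x : Fˣ => f.eval (x : F) ≠ 0).card := by
  have h1 : (Finset.univ.filter fun x : Fˣ => f.eval (x : F) = 0).card ≤ f.natDegree := by
    refine le_trans ?_ (Polynomial.card_roots' f)
    refine le_trans ?_ (Multiset.toFinset_card_le _)
    refine Finset.card_le_card_of_injOn (fun x => (x : F)) ?_ fun x _ y _ h => Units.ext h
    intro x hx
    simpa [h0] using hx
  have h2 : f.natDegree < 2 ^ (t - 1) := by
    rw [Polynomial.mem_degreeLT] at hf
    exact (Polynomial.natDegree_lt_iff_degree_lt h0).2 hf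
  have h3 := Finset.card_filter_add_card_filter_not (s := Finset.univ)
    (fun x : Fˣ => f.eval (x : F) = 0)
  rw [Finset.card_univ, Fintype.card_units, card_field b] at h3
  have h4 : 2 ^ t = 2 * 2 ^ (t - 1) := by
    rw [← pow_succ']; congr 1; have := NeZero.pos t; omega
  simp only [ne_eq]
  omega

variable (b : Module.Basis (Fin t) (ZMod 2) F)

theorem mem_justesenCode {c : JustesenIndex F t → ZMod 2} :
    c ∈ justesenCode b ↔ ∃ f ∈ Polynomial.degreeLT F (2 ^ (t - 1)), justesenEncode b f = c := by
  simp [justesenCode, Submodule.mem_map]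

/-- The ratio of the two halves of a nonzero block is `x`. Nonzero blocks are thus distinct, so only
few of them can be light. -/
theorem justesenEncode_block_injOn (f : Polynomial F) :
    Set.InjOn (fun (x : Fˣ) (p : Fin 2 × Fin t) => justesenEncode b f (x, p))
      {x | f.eval (x : F) ≠ 0} := by
  intro x hx y hy hxy
  have key : ∀ e : Fin 2, (x : F) ^ (e : ℕ) * f.eval (x : F) = (y : F) ^ (e : ℕ) * f.eval (y : F) := by
    intro e
    apply b.repr.injective
    ext l
    exact congrFun hxy (e, l)
  have h0 := key 0
  have h1 := key 1
  simp only [Fin.val_zero, Fin.val_one, pow_zero, pow_one, one_mul] at h0 h1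
  rw [← h0] at h1
  exact Units.ext (mul_right_cancel₀ hx h1)

/-- No coordinate of the Justesen code is constant. -/
theorem exists_mem_justesenCode_eq_one [NeZero t] (z : JustesenIndex F t) :
    ∃ c ∈ justesenCode b, c z = 1 := by
  have hx : (z.1 : F) ^ (z.2.1 : ℕ) ≠ 0 := pow_ne_zero _ z.1.ne_zero
  -- A constant polynomial suffices, scaled to cancel the power of `x` in the half of the block that
  -- contains the coordinate.
  refine ⟨justesenEncode b (Polynomial.C (((z.1 : F) ^ (z.2.1 : ℕ))⁻¹ * b z.2.2)),
    (mem_justesenCode b).2 ⟨_, ?_, rfl⟩, ?_⟩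
  · rw [Polynomial.mem_degreeLT]
    refine lt_of_le_of_lt Polynomial.degree_C_le ?_
    exact_mod_cast Nat.pos_of_ne_zero (by positivity)
  · simp [justesenEncode]

variable [Fintype F] [DecidableEq F]

/-- At least 2^(t-1) blocks are nonzero, they are pairwise distinct, and at most 2^(t-2) words of
the block length have weight at most t/16. So 2^(t-2) blocks are heavier than that, out of a total
length below 2^t * 2t. -/
theorem le_wt_justesen [NeZero t] (ht : 4 ≤ t) {c : JustesenIndex F t → ZMod 2}
    (hc : c ∈ justesenCode b) (h0 : c ≠ 0) :
    Fintype.card (JustesenIndex F t) ≤ 128 * wt c := by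
  classical
  obtain ⟨f, hf, rfl⟩ := (mem_justesenCode b).1 hc
  have hf0 : f ≠ 0 := by rintro rfl; exact h0 (map_zero _)
  set v : Fˣ → (Fin 2 × Fin t → ZMod 2) := fun x p => justesenEncode b f (x, p) with hv
  set S := Finset.univ.filter fun x : Fˣ => f.eval (x : F) ≠ 0 with hS
  have hS1 : 2 ^ (t - 1) ≤ S.card := card_eval_ne_zero b hf hf0
  have hlow : (S.filter fun x => 16 * wt (v x) ≤ t).card ≤ 2 ^ (t - 2) := by
    refine le_trans ?_ (card_wt_le (κ := Fin 2 × Fin t) ht (by simp))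
    refine Finset.card_le_card_of_injOn v ?_ ?_
    · intro x hx
      simpa using (Finset.mem_filter.1 hx).2
    · intro x hx y hy h
      refine justesenEncode_block_injOn b f ?_ ?_ h
      · simpa [hS] using (Finset.mem_filter.1 hx).1
      · simpa [hS] using (Finset.mem_filter.1 hy).1
  have hsplit := Finset.card_filter_add_card_filter_not (s := S) (fun x => 16 * wt (v x) ≤ t)
  have h4 : 2 ^ (t - 1) = 2 * 2 ^ (t - 2) := by
    rw [← pow_succ']; congr 1; omega
  have h5 : 2 ^ t = 4 * 2 ^ (t - 2) := by
    rw [show (4 : ℕ) = 2 ^ 2 by norm_num, ← pow_add]; congr 1; omega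
  have hhigh : 2 ^ (t - 2) ≤ (S.filter fun x => ¬ 16 * wt (v x) ≤ t).card := by omega
  have hwt : wt (justesenEncode b f) = ∑ x : Fˣ, wt (v x) := by
    simp only [wt, Finset.card_filter, hv]
    rw [Fintype.sum_prod_type]
  have h6 : 2 ^ (t - 2) * t ≤ 16 * wt (justesenEncode b f) := by
    rw [hwt]
    calc 2 ^ (t - 2) * t ≤ ∑ x ∈ S.filter fun x => ¬ 16 * wt (v x) ≤ t, t := by
          rw [Finset.sum_const, smul_eq_mul]; gcongr
      _ ≤ ∑ x ∈ S.filter fun x => ¬ 16 * wt (v x) ≤ t, 16 * wt (v x) :=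
          Finset.sum_le_sum fun x hx => by
            have := (Finset.mem_filter.1 hx).2
            omega
      _ ≤ ∑ x, 16 * wt (v x) :=
          Finset.sum_le_sum_of_subset (Finset.subset_univ _)
      _ = _ := by rw [Finset.mul_sum]
  rw [card_justesenIndex b]
  calc (2 ^ t - 1) * (2 * t) ≤ 2 ^ t * (2 * t) := Nat.mul_le_mul_right _ (Nat.sub_le _ _)
    _ = 8 * (2 ^ (t - 2) * t) := by rw [h5]; ring
    _ ≤ 8 * (16 * wt (justesenEncode b f)) := by gcongr
    _ = _ := by ring

/-- The encoding is injective, since a nonzero polynomial of low degree has a nonzero value, visible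
in the first half of a block. -/
theorem card_justesenCode [NeZero t] :
    2 ^ (t * 2 ^ (t - 1)) = Nat.card (justesenCode b) := by
  classical
  have hinj : Function.Injective (fun f : Polynomial.degreeLT F (2 ^ (t - 1)) =>
      (⟨justesenEncode b f.1, (mem_justesenCode b).2 ⟨f.1, f.2, rfl⟩⟩ : justesenCode b)) := by
    intro f g hfg
    have h : justesenEncode b (f.1 - g.1) = 0 := by
      rw [map_sub, sub_eq_zero]
      exact congrArg Subtype.val hfg
    by_contra hne
    have hne' : f.1 - g.1 ≠ 0 := fun h' => hne (Subtype.ext (sub_eq_zero.1 h'))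
    have hcard := card_eval_ne_zero b (Submodule.sub_mem _ f.2 g.2) hne'
    have hpos : 0 < (Finset.univ.filter fun x : Fˣ => (f.1 - g.1).eval (x : F) ≠ 0).card :=
      lt_of_lt_of_le (by positivity) hcard
    obtain ⟨x, hx⟩ := Finset.card_pos.1 hpos
    have hx := (Finset.mem_filter.1 hx).2
    apply hx
    apply b.repr.injective
    ext l
    have := congrFun h (x, 0, l)
    simpa [justesenEncode] using this
  have hsurj : Function.Surjective (fun f : Polynomial.degreeLT F (2 ^ (t - 1)) =>
      (⟨justesenEncode b f.1, (mem_justesenCode b).2 ⟨f.1, f.2, rfl⟩⟩ : justesenCode b)) := by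
    rintro ⟨c, hc⟩
    obtain ⟨f, hf, rfl⟩ := (mem_justesenCode b).1 hc
    exact ⟨⟨f, hf⟩, rfl⟩
  rw [← Nat.card_congr (Equiv.ofBijective _ ⟨hinj, hsurj⟩),
    Nat.card_congr (Polynomial.degreeLTEquiv F (2 ^ (t - 1))).toEquiv]
  simp [Nat.card_eq_fintype_card, card_field b, pow_mul]

end JustesenDistance

/-! ### Values of the distributions at points. -/

section Apply

variable {X Y ι : Type*} [Fintype X] [Fintype Y] [Fintype ι]

theorem prodDistr_apply (p : stdSimplex ℝ X) (q : stdSimplex ℝ Y) (z : X × Y) :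
    (prodDistr p q : X × Y → ℝ) z = (p : X → ℝ) z.1 * (q : Y → ℝ) z.2 := rfl

theorem piDistr_apply [DecidableEq ι] (p : ι → stdSimplex ℝ X) (x : ι → X) :
    (piDistr p : (ι → X) → ℝ) x = ∏ i, (p i : X → ℝ) (x i) := rfl

theorem coin_apply (s : unitInterval) (v : Fin 2) :
    (coin s : Fin 2 → ℝ) v = ![1 - (s : ℝ), (s : ℝ)] v := rfl

theorem graphDistr_apply [Nonempty ι] (c : ι → ZMod 2) (z : ι × ZMod 2) :
    (graphDistr c : ι × ZMod 2 → ℝ) z = if z.2 = c z.1 then 1 / (Fintype.card ι : ℝ) else 0 := rfl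

end Apply

/-! ### Coins with a uniformly random bias -/

section Coins

theorem integral_unitInterval_eq (f : ℝ → ℝ) :
    ∫ s : unitInterval, f s = ∫ x in (0 : ℝ)..1, f x := by
  rw [intervalIntegral.integral_of_le zero_le_one, ← integral_Icc_eq_integral_Ioc]
  exact integral_subtype_comap measurableSet_Icc f

theorem integral_pow_mul_one_sub_pow (a b : ℕ) :
    ∫ s : unitInterval, (s : ℝ) ^ a * (1 - (s : ℝ)) ^ b =
      (a.factorial * b.factorial : ℝ) / (a + b + 1).factorial := by
  rw [integral_unitInterval_eq fun x => x ^ a * (1 - x) ^ b]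
  have h := Complex.betaIntegral_eq_Gamma_mul_div (a + 1) (b + 1) (by simp; positivity)
    (by simp; positivity)
  rw [Complex.Gamma_nat_eq_factorial, Complex.Gamma_nat_eq_factorial,
    show ((a : ℂ) + 1 + (b + 1)) = ((a + b + 1 : ℕ) : ℂ) + 1 by push_cast; ring,
    Complex.Gamma_nat_eq_factorial, Complex.betaIntegral] at h
  simp only [add_sub_cancel_right, Complex.cpow_natCast] at h
  have h' : ((∫ x in (0 : ℝ)..1, x ^ a * (1 - x) ^ b : ℝ) : ℂ) =
      (((a.factorial * b.factorial : ℝ) / (a + b + 1).factorial : ℝ) : ℂ) := by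
    rw [← intervalIntegral.integral_ofReal]
    push_cast
    exact h
  exact_mod_cast h'

variable {n : ℕ}

/-- The number of ones among the tosses of a coin. -/
def ones (y : Fin n → Fin 8 → Fin 2) : ℕ := ∑ i, ∑ r, (y i r : ℕ)

/-- The probability of the tosses `y` of a coin of bias `s`. -/
def coinLik (s : unitInterval) (y : Fin n → Fin 8 → Fin 2) : ℝ :=
  likelihood (piDistr fun _ : Fin 8 => coin s) y

theorem ones_le (y : Fin n → Fin 8 → Fin 2) : ones y ≤ 8 * n := by
  calc ones y ≤ ∑ _i : Fin n, ∑ _r : Fin 8, 1 :=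
        Finset.sum_le_sum fun i _ => Finset.sum_le_sum fun r _ => by omega
    _ = 8 * n := by simp [mul_comm]

theorem coinLik_eq (s : unitInterval) (y : Fin n → Fin 8 → Fin 2) :
    coinLik s y = (s : ℝ) ^ ones y * (1 - (s : ℝ)) ^ (8 * n - ones y) := by
  have h1 : ∀ v : Fin 2, (coin s : Fin 2 → ℝ) v = (s : ℝ) ^ (v : ℕ) * (1 - (s : ℝ)) ^ (1 - (v : ℕ)) := by
    intro v
    fin_cases v <;> simp [coin_apply]
  have h2 : ∑ i, ∑ r, (1 - (y i r : ℕ)) = 8 * n - ones y := by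
    have : ∑ i, ∑ r, (1 - (y i r : ℕ)) + ones y = 8 * n := by
      rw [ones, ← Finset.sum_add_distrib]
      simp_rw [← Finset.sum_add_distrib]
      calc _ = ∑ _i : Fin n, ∑ _r : Fin 8, 1 :=
            Finset.sum_congr rfl fun i _ => Finset.sum_congr rfl fun r _ => by omega
        _ = 8 * n := by simp [mul_comm]
    omega
  rw [← h2, ones, coinLik, likelihood]
  simp only [piDistr_apply, h1, Finset.prod_mul_distrib, Finset.prod_pow_eq_pow_sum]

theorem coinLik_nonneg (s : unitInterval) (y : Fin n → Fin 8 → Fin 2) : 0 ≤ coinLik s y := by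
  rw [coinLik_eq]
  exact mul_nonneg (pow_nonneg s.2.1 _) (pow_nonneg (by linarith [s.2.2]) _)

theorem continuous_coinLik (y : Fin n → Fin 8 → Fin 2) : Continuous fun s => coinLik s y := by
  simp_rw [coinLik_eq]
  fun_prop

theorem card_filter_ones (N : ℕ) :
    (Finset.univ.filter fun y : Fin n → Fin 8 → Fin 2 => ones y = N).card = (8 * n).choose N := by
  have h : ∑ y : Fin n → Fin 8 → Fin 2, (Polynomial.X : Polynomial ℕ) ^ ones y =
      (1 + Polynomial.X) ^ (8 * n) := by
    simp_rw [ones, ← Finset.prod_pow_eq_pow_sum]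
    have h8 : ∑ z : Fin 8 → Fin 2, ∏ r, (Polynomial.X : Polynomial ℕ) ^ (z r : ℕ) =
        (1 + Polynomial.X) ^ 8 := by
      rw [← Fintype.piFinset_univ, Finset.sum_prod_piFinset Finset.univ
        fun (_ : Fin 8) (v : Fin 2) => (Polynomial.X : Polynomial ℕ) ^ (v : ℕ)]
      simp
    rw [← Fintype.piFinset_univ, Finset.sum_prod_piFinset Finset.univ
      fun (_ : Fin n) (z : Fin 8 → Fin 2) => ∏ r, (Polynomial.X : Polynomial ℕ) ^ (z r : ℕ)]
    rw [h8, Finset.prod_const, Finset.card_univ, Fintype.card_fin, ← pow_mul]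
  have h' := congrArg (fun p => Polynomial.coeff p N) h
  simp only [Polynomial.finsetSum_coeff, Polynomial.coeff_X_pow] at h'
  rw [Polynomial.coeff_one_add_X_pow] at h'
  rw [Finset.card_filter]
  simp only [eq_comm (a := N)] at h'
  exact_mod_cast h'

theorem integral_coinLik (y : Fin n → Fin 8 → Fin 2) :
    ∫ s, coinLik s y = 1 / ((8 * n + 1) * (8 * n).choose (ones y) : ℝ) := by
  simp_rw [coinLik_eq]
  have hle := ones_le y
  rw [integral_pow_mul_one_sub_pow, Nat.add_sub_of_le hle, Nat.cast_choose ℝ hle,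
    Nat.factorial_succ]
  have h1 : ((ones y).factorial : ℝ) ≠ 0 := by positivity
  have h2 : ((8 * n - ones y).factorial : ℝ) ≠ 0 := by positivity
  have h3 : ((8 * n).factorial : ℝ) ≠ 0 := by positivity
  push_cast
  field_simp

theorem integral_coinLik_pos (y : Fin n → Fin 8 → Fin 2) : 0 < ∫ s, coinLik s y := by
  rw [integral_coinLik]
  have := Nat.choose_pos (ones_le y)
  positivity

/-- Laplace's rule of succession for the posterior mean of the bias. -/
theorem integral_mul_coinLik (y : Fin n → Fin 8 → Fin 2) :
    ∫ s : unitInterval, (s : ℝ) * coinLik s y =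
      (ones y + 1) / (8 * n + 2) * ∫ s, coinLik s y := by
  simp_rw [coinLik_eq, ← mul_assoc, ← pow_succ']
  have hle := ones_le y
  rw [integral_pow_mul_one_sub_pow, integral_pow_mul_one_sub_pow, Nat.add_sub_of_le hle,
    show ones y + 1 + (8 * n - ones y) + 1 = 8 * n + 1 + 1 by omega, Nat.factorial_succ (ones y),
    Nat.factorial_succ (8 * n + 1)]
  have h3 : ((8 * n + 1).factorial : ℝ) ≠ 0 := by positivity
  push_cast
  field_simp
  ring

theorem integrable_mul_coinLik (y : Fin n → Fin 8 → Fin 2) {f : unitInterval → ℝ}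
    (hf : Continuous f) : Integrable fun s => f s * coinLik s y :=
  (hf.mul (continuous_coinLik y)).integrable_of_hasCompactSupport
    (HasCompactSupport.of_compactSpace _)

theorem integrable_coinLik (y : Fin n → Fin 8 → Fin 2) : Integrable fun s => coinLik s y := by
  simpa using integrable_mul_coinLik y (f := fun _ => 1) continuous_const

/-- The number of ones among the tosses of a coin with uniform bias is uniform. -/
theorem sum_integral_coinLik_mul (φ : ℕ → ENNReal) :
    ∑ y : Fin n → Fin 8 → Fin 2, ENNReal.ofReal (∫ s, coinLik s y) * φ (ones y) =
      ENNReal.ofReal (1 / (8 * n + 1)) * ∑ N ∈ Finset.range (8 * n + 1), φ N := by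
  rw [← Finset.sum_fiberwise_of_maps_to (s := Finset.univ) (t := Finset.range (8 * n + 1))
    (g := ones) fun y _ => Finset.mem_range.2 (Nat.lt_succ_of_le (ones_le y)), Finset.mul_sum]
  refine Finset.sum_congr rfl fun N hN => ?_
  have hN' : N ≤ 8 * n := Nat.lt_succ_iff.1 (Finset.mem_range.1 hN)
  -- The binomial coefficient in the probability of a single outcome cancels the number of outcomes
  -- with `N` ones.
  rw [Finset.sum_congr rfl (g := fun _ =>
    ENNReal.ofReal (1 / ((8 * n + 1) * (8 * n).choose N : ℝ)) * φ N), Finset.sum_const,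
    card_filter_ones, nsmul_eq_mul, ← mul_assoc, ← ENNReal.ofReal_natCast,
    ← ENNReal.ofReal_mul (by positivity)]
  · congr 2
    have := Nat.choose_pos hN'
    field_simp
  · intro y hy
    rw [integral_coinLik, (Finset.mem_filter.1 hy).2]

/-- Markov's inequality under the posterior of the bias: the indicator of s ≤ 1/4 is at least 1 -
4s, and the mean of s is given by the rule of succession. -/
theorem le_lintegral_indicator_low (y : Fin n → Fin 8 → Fin 2) :
    ENNReal.ofReal (∫ s, coinLik s y) * ENNReal.ofReal (1 - 4 * ((ones y + 1) / (8 * n + 2))) ≤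
      ∫⁻ s in {s : unitInterval | (s : ℝ) ≤ 1 / 4}, ENNReal.ofReal (coinLik s y) := by
  have hm : MeasurableSet {s : unitInterval | (s : ℝ) ≤ 1 / 4} :=
    measurableSet_le measurable_subtype_coe measurable_const
  rw [← ofReal_integral_eq_lintegral_ofReal (integrable_coinLik y).integrableOn
    (ae_of_all _ fun s => coinLik_nonneg s y), ← ENNReal.ofReal_mul (integral_coinLik_pos y).le]
  refine ENNReal.ofReal_le_ofReal ?_
  have h : (∫ s, coinLik s y) * (1 - 4 * ((ones y + 1) / (8 * n + 2))) =
      ∫ s : unitInterval, (1 - 4 * (s : ℝ)) * coinLik s y := by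
    have e : ∀ s : unitInterval, (1 - 4 * (s : ℝ)) * coinLik s y =
        coinLik s y - 4 * ((s : ℝ) * coinLik s y) := fun s => by ring
    simp_rw [e]
    rw [integral_sub (integrable_coinLik y)
      ((integrable_mul_coinLik y continuous_subtype_val).const_mul 4), integral_const_mul,
      integral_mul_coinLik]
    ring
  rw [h, ← integral_indicator hm]
  refine integral_mono (integrable_mul_coinLik y (by fun_prop))
    ((integrable_coinLik y).indicator hm) fun s => ?_
  by_cases hs : (s : ℝ) ≤ 1 / 4
  · rw [Set.indicator_of_mem (by exact hs)]
    have := coinLik_nonneg s y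
    nlinarith [s.2.1]
  · rw [Set.indicator_of_notMem (by exact hs)]
    have := coinLik_nonneg s y
    push Not at hs
    exact mul_nonpos_of_nonpos_of_nonneg (by linarith) this

/-- Markov's inequality for 1 - s. -/
theorem le_lintegral_indicator_high (y : Fin n → Fin 8 → Fin 2) :
    ENNReal.ofReal (∫ s, coinLik s y) *
        ENNReal.ofReal (1 - 4 * ((8 * n - ones y + 1) / (8 * n + 2))) ≤
      ∫⁻ s in {s : unitInterval | 3 / 4 ≤ (s : ℝ)}, ENNReal.ofReal (coinLik s y) := by
  have hm : MeasurableSet {s : unitInterval | 3 / 4 ≤ (s : ℝ)} :=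
    measurableSet_le measurable_const measurable_subtype_coe
  rw [← ofReal_integral_eq_lintegral_ofReal (integrable_coinLik y).integrableOn
    (ae_of_all _ fun s => coinLik_nonneg s y), ← ENNReal.ofReal_mul (integral_coinLik_pos y).le]
  refine ENNReal.ofReal_le_ofReal ?_
  have h : (∫ s, coinLik s y) * (1 - 4 * ((8 * n - ones y + 1) / (8 * n + 2))) =
      ∫ s : unitInterval, (4 * (s : ℝ) - 3) * coinLik s y := by
    have e : ∀ s : unitInterval, (4 * (s : ℝ) - 3) * coinLik s y =
        4 * ((s : ℝ) * coinLik s y) - 3 * coinLik s y := fun s => by ring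
    simp_rw [e]
    rw [integral_sub ((integrable_mul_coinLik y continuous_subtype_val).const_mul 4)
      ((integrable_coinLik y).const_mul 3), integral_const_mul, integral_const_mul,
      integral_mul_coinLik]
    field_simp
    ring
  rw [h, ← integral_indicator hm]
  refine integral_mono (integrable_mul_coinLik y (by fun_prop))
    ((integrable_coinLik y).indicator hm) fun s => ?_
  by_cases hs : 3 / 4 ≤ (s : ℝ)
  · rw [Set.indicator_of_mem (by exact hs)]
    have := coinLik_nonneg s y
    nlinarith [s.2.2]
  · rw [Set.indicator_of_notMem (by exact hs)]
    have := coinLik_nonneg s y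
    push Not at hs
    exact mul_nonpos_of_nonpos_of_nonneg (by linarith) this

end Coins

/-! ### The transcript of the game -/

section Transcript

/-- The strong measurability condition on strategies makes every function of the query measurable in
the answers, however irregular the curator is. -/
theorem measurable_comp_query {X : Type*} (S : Strategy X) {β : Type*} [MeasurableSpace β] (N : ℕ)
    (φ : (X → unitInterval) → β) : Measurable fun h => φ (S.query N h) :=
  fun A _ => S.measurableSet_query N (φ ⁻¹' A)

variable {X : Type*} [Fintype X] {n : ℕ} (P : Measure (stdSimplex ℝ X)) (g : MeanCurator)
  (S : Strategy X) (xs : Fin n → X)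

theorem measurable_snoc (N : ℕ) :
    Measurable fun z : (Fin N → ℝ) × ℝ => (Fin.snoc z.1 z.2 : Fin (N + 1) → ℝ) := by
  refine measurable_pi_iff.2 fun i => ?_
  refine Fin.lastCases ?_ (fun i => ?_) i
  · simpa using measurable_snd
  · simp only [Fin.snoc_castSucc]
    exact (measurable_pi_apply i).comp measurable_fst

theorem measurable_snoc_left {N : ℕ} (h : Fin N → ℝ) :
    Measurable fun a => (Fin.snoc h a : Fin (N + 1) → ℝ) :=
  (measurable_snoc N).comp measurable_prodMk_left

/-- The distribution of the answer to the query `f`. -/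
def answerLaw (f : X → unitInterval) : Measure ℝ := g (queryPrior P f) (posteriorMean P xs f)

instance (f : X → unitInterval) : IsProbabilityMeasure (answerLaw P g xs f) := by
  unfold answerLaw; infer_instance

theorem measurable_map_snoc (N : ℕ) :
    Measurable fun h : Fin N → ℝ =>
      (answerLaw P g xs (S.query N h)).map fun a => (Fin.snoc h a : Fin (N + 1) → ℝ) := by
  refine Measure.measurable_of_measurable_coe _ fun A hA => ?_
  let κ : ProbabilityTheory.Kernel (Fin N → ℝ) ℝ :=
    ⟨fun h => answerLaw P g xs (S.query N h), measurable_comp_query S N _⟩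
  have : ProbabilityTheory.IsMarkovKernel κ :=
    ⟨fun h => by simp only [κ, ProbabilityTheory.Kernel.coe_mk]; infer_instance⟩
  have h := ProbabilityTheory.Kernel.measurable_kernel_prodMk_left (κ := κ) (measurable_snoc N hA)
  convert h using 2 with h
  exact Measure.map_apply (measurable_snoc_left h) hA

theorem transcript_succ_apply (N : ℕ) {A : Set (Fin (N + 1) → ℝ)} (hA : MeasurableSet A) :
    transcript P g S xs (N + 1) A = ∫⁻ h, answerLaw P g xs (S.query N h)
      ((fun a => (Fin.snoc h a : Fin (N + 1) → ℝ)) ⁻¹' A) ∂(transcript P g S xs N) := by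
  have h := Measure.bind_apply (m := transcript P g S xs N) hA
    (measurable_map_snoc P g S xs N).aemeasurable
  refine h.trans (lintegral_congr fun h => ?_)
  exact Measure.map_apply (measurable_snoc_left h) hA

instance isProbabilityMeasure_transcript : ∀ N, IsProbabilityMeasure (transcript P g S xs N)
  | 0 => by unfold transcript; infer_instance
  | N + 1 => by
    have := isProbabilityMeasure_transcript N
    refine ⟨?_⟩
    rw [transcript_succ_apply P g S xs N MeasurableSet.univ]
    simp

/-- Later rounds only append answers, so events about the first `N` answers keep their probability.
-/
theorem transcript_castLE {N N' : ℕ} (hN : N ≤ N') {A : Set (Fin N → ℝ)} (hA : MeasurableSet A) :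
    transcript P g S xs N' {a | (fun i : Fin N => a (i.castLE hN)) ∈ A} =
      transcript P g S xs N A := by
  induction N', hN using Nat.le_induction with
  | base => rfl
  | succ N' hN ih =>
    have hm : ∀ M (h : N ≤ M), MeasurableSet {a : Fin M → ℝ | (fun i : Fin N => a (i.castLE h)) ∈ A} :=
      fun M h => (measurable_pi_lambda _ fun i => measurable_pi_apply (i.castLE h)) hA
    rw [transcript_succ_apply P g S xs N' (hm _ _), ← ih, ← lintegral_indicator_one (hm _ _)]
    refine lintegral_congr fun h => ?_
    have e : (fun a => (Fin.snoc h a : Fin (N' + 1) → ℝ)) ⁻¹'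
        {a | (fun i : Fin N => a (i.castLE (hN.trans N'.le_succ))) ∈ A} =
        {_a | (fun i : Fin N => h (i.castLE hN)) ∈ A} := by
      ext a
      have e' : (fun i : Fin N => (Fin.snoc h a : Fin (N' + 1) → ℝ) (i.castLE (hN.trans N'.le_succ)))
          = fun i : Fin N => h (i.castLE hN) := by
        funext i
        exact Fin.snoc_castSucc (α := fun _ => ℝ) a h (i.castLE hN)
      simp only [Set.mem_preimage, Set.mem_ofPred_eq, e']
    rw [e]
    by_cases hh : (fun i : Fin N => h (i.castLE hN)) ∈ A
    · rw [Set.indicator_of_mem (by exact hh)]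
      simp [hh]
    · rw [Set.indicator_of_notMem (by exact hh)]
      simp [hh]

/-- As long as the queries do not depend on the previous answers, the answers are independent. -/
theorem transcript_eq_pi (f : ℕ → X → unitInterval) :
    ∀ N, (∀ t < N, ∀ h, S.query t h = f t) →
      transcript P g S xs N = Measure.pi fun t : Fin N => answerLaw P g xs (f t)
  | 0, _ => by
    refine (Measure.pi_eq fun s _ => ?_).symm
    rw [transcript, Measure.dirac_apply]
    simp
  | N + 1, hf => by
    refine (Measure.pi_eq fun s hs => ?_).symm
    rw [transcript_succ_apply P g S xs N (MeasurableSet.univ_pi hs),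
      transcript_eq_pi f N fun t ht => hf t (ht.trans N.lt_succ_self), Fin.prod_univ_castSucc,
      ← Measure.pi_pi]
    have hm : MeasurableSet (Set.univ.pi fun i : Fin N => s i.castSucc) :=
      MeasurableSet.univ_pi fun i => hs _
    rw [mul_comm, ← lintegral_indicator_const hm]
    refine lintegral_congr fun h => ?_
    rw [hf N N.lt_succ_self h]
    have e : (fun a => (Fin.snoc h a : Fin (N + 1) → ℝ)) ⁻¹' Set.univ.pi s =
        {a | h ∈ (Set.univ.pi fun i : Fin N => s i.castSucc) ∧ a ∈ s (Fin.last N)} := by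
      ext a
      simp [Set.mem_pi, Fin.forall_fin_succ']
    rw [e]
    by_cases hh : h ∈ (Set.univ.pi fun i : Fin N => s i.castSucc)
    · rw [Set.indicator_of_mem hh]
      simp only [hh, true_and, Set.ofPred_mem_eq]
      rfl
    · rw [Set.indicator_of_notMem hh]
      simp [hh]

theorem measurable_expect {β : Type*} [MeasurableSpace β] {p : β → stdSimplex ℝ X}
    (hp : Measurable p) {f : β → X → unitInterval} (hf : Measurable f) :
    Measurable fun z => expect (p z) (f z) := by
  unfold expect
  refine Finset.measurable_sum _ fun x _ => Measurable.mul ?_ ?_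
  · exact (measurable_pi_apply x).comp (measurable_subtype_coe.comp hp)
  · exact measurable_subtype_coe.comp ((measurable_pi_apply x).comp hf)

theorem measurableSet_inaccurate_prod (N : ℕ) (ε : ℝ) :
    MeasurableSet {z : stdSimplex ℝ X × (Fin N → ℝ) | z.2 ∈ inaccurate S z.1 N ε} := by
  have e : {z : stdSimplex ℝ X × (Fin N → ℝ) | z.2 ∈ inaccurate S z.1 N ε} =
      ⋃ i : Fin N, {z | |expect z.1 (S.query i fun j => z.2 (j.castLE i.2.le)) - z.2 i| < ε}ᶜ := by
    ext z; simp [inaccurate]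
  rw [e]
  refine MeasurableSet.iUnion fun i => MeasurableSet.compl ?_
  refine measurableSet_lt (Measurable.abs (Measurable.sub ?_ ?_)) measurable_const
  · refine measurable_expect measurable_fst ?_
    refine (measurable_comp_query S i id).comp ?_
    exact measurable_pi_lambda _ fun j => (measurable_pi_apply _).comp measurable_snd
  · exact (measurable_pi_apply i).comp measurable_snd

theorem measurable_transcript_inaccurate (N : ℕ) (ε : ℝ) :
    Measurable fun p => transcript P g S xs N (inaccurate S p N ε) :=
  measurable_measure_prodMk_left (measurableSet_inaccurate_prod S N ε)

theorem measurable_likelihood : Measurable fun p : stdSimplex ℝ X => likelihood p xs := by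
  unfold likelihood
  exact Finset.measurable_prod _ fun i _ => (measurable_pi_apply _).comp measurable_subtype_coe

end Transcript

/-! ### Means and likelihoods under product distributions -/

section Mean

variable {X Y ι : Type*} [Fintype X] [Fintype Y] [Fintype ι] {n : ℕ}

/-- The mean of a real function under a distribution. -/
def mean (p : stdSimplex ℝ X) (F : X → ℝ) : ℝ := ∑ x, (p : X → ℝ) x * F x

theorem mean_add (p : stdSimplex ℝ X) (F G : X → ℝ) :
    mean p (fun x => F x + G x) = mean p F + mean p G := by
  simp only [mean, mul_add, Finset.sum_add_distrib]

theorem mean_const_mul (p : stdSimplex ℝ X) (a : ℝ) (F : X → ℝ) :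
    mean p (fun x => a * F x) = a * mean p F := by
  simp only [mean, Finset.mul_sum]
  exact Finset.sum_congr rfl fun x _ => by ring

theorem mean_prodDistr_fst (p : stdSimplex ℝ X) (q : stdSimplex ℝ Y) (F : X → ℝ) :
    mean (prodDistr p q) (fun z => F z.1) = mean p F := by
  simp only [mean, prodDistr_apply, Fintype.sum_prod_type]
  refine Finset.sum_congr rfl fun x _ => ?_
  simp_rw [mul_right_comm _ _ (F x), ← Finset.mul_sum, stdSimplex.sum_eq_one q, mul_one]

theorem mean_prodDistr_snd (p : stdSimplex ℝ X) (q : stdSimplex ℝ Y) (F : Y → ℝ) :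
    mean (prodDistr p q) (fun z => F z.2) = mean q F := by
  simp only [mean, prodDistr_apply, Fintype.sum_prod_type]
  simp_rw [mul_assoc, ← Finset.mul_sum, ← Finset.sum_mul, stdSimplex.sum_eq_one p, one_mul]

theorem mean_piDistr [DecidableEq ι] (p : ι → stdSimplex ℝ X) (j : ι) (F : X → ℝ) :
    mean (piDistr p) (fun x => F (x j)) = mean (p j) F := by
  have h : ∀ x : ι → X, (piDistr p : (ι → X) → ℝ) x * F (x j) =
      ∏ i, ((p i : X → ℝ) (x i) * if i = j then F (x i) else 1) := by
    intro x
    rw [Finset.prod_mul_distrib, piDistr_apply]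
    simp
  simp_rw [mean, h]
  rw [← Fintype.piFinset_univ, Finset.sum_prod_piFinset Finset.univ
    fun i x => (p i : X → ℝ) x * if i = j then F x else 1, Fintype.prod_eq_single j]
  · simp
  · intro i hi
    simp [hi]

theorem expect_eq_mean (p : stdSimplex ℝ X) (f : X → unitInterval) :
    expect p f = mean p fun x => (f x : ℝ) := rfl

theorem likelihood_nonneg (p : stdSimplex ℝ X) (xs : Fin n → X) : 0 ≤ likelihood p xs :=
  Finset.prod_nonneg fun i _ => p.2.1 (xs i)

theorem sum_likelihood (p : stdSimplex ℝ X) : ∑ xs : Fin n → X, likelihood p xs = 1 := by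
  simp only [likelihood]
  rw [← Fintype.piFinset_univ, Finset.sum_prod_piFinset Finset.univ fun _ : Fin n => (p : X → ℝ)]
  exact Finset.prod_eq_one fun i _ => stdSimplex.sum_eq_one p

theorem likelihood_prodDistr (p : stdSimplex ℝ X) (q : stdSimplex ℝ Y) (xs : Fin n → X × Y) :
    likelihood (prodDistr p q) xs =
      likelihood p (fun r => (xs r).1) * likelihood q (fun r => (xs r).2) := by
  simp only [likelihood, prodDistr_apply, Finset.prod_mul_distrib]

theorem likelihood_piDistr [DecidableEq ι] (p : ι → stdSimplex ℝ X) (xs : Fin n → ι → X) :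
    likelihood (piDistr p) xs = ∏ i, likelihood (p i) fun r => xs r i := by
  simp only [likelihood, piDistr_apply]
  exact Finset.prod_comm

theorem continuous_apply_stdSimplex (x : X) :
    Continuous fun p : stdSimplex ℝ X => (p : X → ℝ) x :=
  (continuous_apply x).comp continuous_subtype_val

theorem continuous_likelihood (xs : Fin n → X) :
    Continuous fun p : stdSimplex ℝ X => likelihood p xs :=
  continuous_finsetProd _ fun i _ => continuous_apply_stdSimplex (xs i)

theorem continuous_mean (F : X → ℝ) : Continuous fun p : stdSimplex ℝ X => mean p F :=
  continuous_finsetSum _ fun x _ => (continuous_apply_stdSimplex x).mul continuous_const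

theorem measurable_prodDistr :
    Measurable fun p : stdSimplex ℝ X × stdSimplex ℝ Y => prodDistr p.1 p.2 := by
  refine Measurable.subtype_mk (measurable_pi_lambda _ fun z => Measurable.mul ?_ ?_)
  · exact ((continuous_apply_stdSimplex z.1).measurable).comp measurable_fst
  · exact ((continuous_apply_stdSimplex z.2).measurable).comp measurable_snd

theorem measurable_piDistr [DecidableEq ι] :
    Measurable fun p : ι → stdSimplex ℝ X => piDistr p := by
  refine Measurable.subtype_mk (measurable_pi_lambda _ fun z =>
    Finset.measurable_prod _ fun i _ => ?_)
  exact ((continuous_apply_stdSimplex (z i)).measurable).comp (measurable_pi_apply i)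

theorem measurable_coin : Measurable coin := by
  refine Measurable.subtype_mk (measurable_pi_lambda _ fun z => ?_)
  fin_cases z
  · exact measurable_const.sub measurable_subtype_coe
  · exact measurable_subtype_coe

end Mean

/-! ### Posterior means in product models -/

section Posterior

variable {X Y : Type*} [Fintype X] [Fintype Y] {n : ℕ}

theorem isProbabilityMeasure_tensor (P₁ : Measure (stdSimplex ℝ X)) (P₂ : Measure (stdSimplex ℝ Y))
    [IsProbabilityMeasure P₁] [IsProbabilityMeasure P₂] : IsProbabilityMeasure (tensor P₁ P₂) :=
  Measure.isProbabilityMeasure_map measurable_prodDistr.aemeasurable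

theorem isProbabilityMeasure_tensorPower (r : ℕ) (P : Measure (stdSimplex ℝ X))
    [IsProbabilityMeasure P] : IsProbabilityMeasure (tensorPower r P) :=
  Measure.isProbabilityMeasure_map measurable_piDistr.aemeasurable

theorem measurable_power (r : ℕ) :
    Measurable fun p : stdSimplex ℝ X => piDistr fun _ : Fin r => p :=
  measurable_piDistr.comp (measurable_pi_lambda _ fun _ => measurable_id)

theorem isProbabilityMeasure_power (r : ℕ) (P : Measure (stdSimplex ℝ X))
    [IsProbabilityMeasure P] : IsProbabilityMeasure (power r P) :=
  Measure.isProbabilityMeasure_map (measurable_power r).aemeasurable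

instance : IsProbabilityMeasure uniformModel :=
  Measure.isProbabilityMeasure_map measurable_coin.aemeasurable

/-- The probability of the samples `xs`. -/
def evidence (P : Measure (stdSimplex ℝ X)) (xs : Fin n → X) : ℝ := ∫ p, likelihood p xs ∂P

/-- The posterior mean, as a ratio of two integrals over the prior. -/
def bayesMean (P : Measure (stdSimplex ℝ X)) (xs : Fin n → X) (F : X → ℝ) : ℝ :=
  (∫ p, mean p F * likelihood p xs ∂P) / evidence P xs

theorem integrable_mean_mul_likelihood (P : Measure (stdSimplex ℝ X)) [IsFiniteMeasure P]
    (xs : Fin n → X) (F : X → ℝ) : Integrable (fun p => mean p F * likelihood p xs) P :=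
  ((continuous_mean F).mul (continuous_likelihood xs)).integrable_of_hasCompactSupport
    (HasCompactSupport.of_compactSpace _)

theorem integrable_likelihood (P : Measure (stdSimplex ℝ X)) [IsFiniteMeasure P]
    (xs : Fin n → X) : Integrable (fun p => likelihood p xs) P :=
  (continuous_likelihood xs).integrable_of_hasCompactSupport (HasCompactSupport.of_compactSpace _)

theorem aestronglyMeasurable_mean_mul_likelihood (P : Measure (stdSimplex ℝ X)) (xs : Fin n → X)
    (F : X → ℝ) : AEStronglyMeasurable (fun p => mean p F * likelihood p xs) P :=
  ((continuous_mean F).mul (continuous_likelihood xs)).aestronglyMeasurable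

theorem posteriorMean_eq_bayesMean (P : Measure (stdSimplex ℝ X)) [IsFiniteMeasure P]
    (xs : Fin n → X) (f : X → unitInterval) :
    posteriorMean P xs f = bayesMean P xs fun x => (f x : ℝ) := by
  rw [posteriorMean, posterior, integral_smul_measure,
    integral_withDensity_eq_integral_toReal_smul (measurable_likelihood xs).ennreal_ofReal
      (ae_of_all _ fun _ => ENNReal.ofReal_lt_top),
    ← ofReal_integral_eq_lintegral_ofReal (integrable_likelihood P xs)
      (ae_of_all _ fun p => likelihood_nonneg p xs), ENNReal.toReal_inv, ENNReal.toReal_ofReal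
      (integral_nonneg fun p => likelihood_nonneg p xs), bayesMean, evidence, smul_eq_mul,
      div_eq_inv_mul]
  congr 1
  refine integral_congr_ae (ae_of_all _ fun p => ?_)
  simp only [ENNReal.toReal_ofReal (likelihood_nonneg p xs), smul_eq_mul, expect_eq_mean, mul_comm]

theorem bayesMean_add (P : Measure (stdSimplex ℝ X)) [IsFiniteMeasure P] (xs : Fin n → X)
    (F G : X → ℝ) :
    bayesMean P xs (fun x => F x + G x) = bayesMean P xs F + bayesMean P xs G := by
  simp only [bayesMean, mean_add, add_mul]
  rw [integral_add (integrable_mean_mul_likelihood P xs F) (integrable_mean_mul_likelihood P xs G),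
    add_div]

theorem bayesMean_const_mul (P : Measure (stdSimplex ℝ X)) (xs : Fin n → X) (a : ℝ) (F : X → ℝ) :
    bayesMean P xs (fun x => a * F x) = a * bayesMean P xs F := by
  simp only [bayesMean, mean_const_mul, mul_assoc]
  rw [integral_const_mul, mul_div_assoc]

theorem evidence_tensor (P₁ : Measure (stdSimplex ℝ X)) (P₂ : Measure (stdSimplex ℝ Y))
    [IsProbabilityMeasure P₁] [IsProbabilityMeasure P₂] (xs : Fin n → X × Y) :
    evidence (tensor P₁ P₂) xs =
      evidence P₁ (fun r => (xs r).1) * evidence P₂ (fun r => (xs r).2) := by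
  rw [evidence, tensor, integral_map measurable_prodDistr.aemeasurable
    (continuous_likelihood xs).aestronglyMeasurable]
  simp only [likelihood_prodDistr]
  exact integral_prod_mul (fun p => likelihood p fun r => (xs r).1)
    (fun q => likelihood q fun r => (xs r).2)

/-- The likelihood factorizes, and the evidence of the other factor cancels; for this it must be
nonzero. -/
theorem bayesMean_tensor_fst (P₁ : Measure (stdSimplex ℝ X)) (P₂ : Measure (stdSimplex ℝ Y))
    [IsProbabilityMeasure P₁] [IsProbabilityMeasure P₂] (xs : Fin n → X × Y) (F : X → ℝ)
    (h : evidence P₂ (fun r => (xs r).2) ≠ 0) :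
    bayesMean (tensor P₁ P₂) xs (fun z => F z.1) = bayesMean P₁ (fun r => (xs r).1) F := by
  rw [bayesMean, evidence_tensor, tensor, integral_map measurable_prodDistr.aemeasurable
    (aestronglyMeasurable_mean_mul_likelihood _ xs _)]
  simp only [likelihood_prodDistr, mean_prodDistr_fst, ← mul_assoc]
  rw [integral_prod_mul (fun p => mean p F * likelihood p fun r => (xs r).1)
    (fun q => likelihood q fun r => (xs r).2)]
  exact mul_div_mul_right _ _ h

theorem bayesMean_tensor_snd (P₁ : Measure (stdSimplex ℝ X)) (P₂ : Measure (stdSimplex ℝ Y))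
    [IsProbabilityMeasure P₁] [IsProbabilityMeasure P₂] (xs : Fin n → X × Y) (F : Y → ℝ)
    (h : evidence P₁ (fun r => (xs r).1) ≠ 0) :
    bayesMean (tensor P₁ P₂) xs (fun z => F z.2) = bayesMean P₂ (fun r => (xs r).2) F := by
  rw [bayesMean, evidence_tensor, tensor, integral_map measurable_prodDistr.aemeasurable
    (aestronglyMeasurable_mean_mul_likelihood _ xs _)]
  simp only [likelihood_prodDistr, mean_prodDistr_snd, mul_left_comm (mean _ F)]
  rw [integral_prod_mul (fun p => likelihood p fun r => (xs r).1)
    (fun q => mean q F * likelihood q fun r => (xs r).2)]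
  exact mul_div_mul_left _ _ h

theorem evidence_tensorPower (r : ℕ) (P : Measure (stdSimplex ℝ X)) [IsProbabilityMeasure P]
    (xs : Fin n → Fin r → X) :
    evidence (tensorPower r P) xs = ∏ j, evidence P fun i => xs i j := by
  rw [evidence, tensorPower, integral_map measurable_piDistr.aemeasurable
    (continuous_likelihood xs).aestronglyMeasurable]
  simp only [likelihood_piDistr]
  exact integral_fintype_prod_eq_prod (fun j p => likelihood p fun i => xs i j)

theorem bayesMean_tensorPower (r : ℕ) (P : Measure (stdSimplex ℝ X)) [IsProbabilityMeasure P]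
    (xs : Fin n → Fin r → X) (j : Fin r) (F : X → ℝ)
    (h : ∀ j, evidence P (fun i => xs i j) ≠ 0) :
    bayesMean (tensorPower r P) xs (fun z => F (z j)) = bayesMean P (fun i => xs i j) F := by
  rw [bayesMean, evidence_tensorPower, tensorPower, integral_map measurable_piDistr.aemeasurable
    (aestronglyMeasurable_mean_mul_likelihood _ xs _)]
  have e : ∀ p : Fin r → stdSimplex ℝ X,
      mean (piDistr p) (fun z => F (z j)) * likelihood (piDistr p) xs =
        ∏ l, ((if l = j then mean (p l) F else 1) * likelihood (p l) fun i => xs i l) := by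
    intro p
    rw [mean_piDistr, likelihood_piDistr, Finset.prod_mul_distrib]
    simp
  simp only [e]
  rw [integral_fintype_prod_eq_prod
    (fun l p => (if l = j then mean p F else 1) * likelihood p fun i => xs i l),
    ← Finset.prod_div_distrib, Fintype.prod_eq_single j]
  · simp [bayesMean]
  · intro l hl
    simp only [hl, if_false, one_mul]
    exact div_self (h l)

theorem evidence_power_uniformModel (y : Fin n → Fin 8 → Fin 2) :
    evidence (power 8 uniformModel) y = ∫ s, coinLik s y := by
  rw [evidence, power, integral_map (measurable_power 8).aemeasurable
    (continuous_likelihood y).aestronglyMeasurable, uniformModel,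
    integral_map measurable_coin.aemeasurable]
  · rfl
  · exact ((measurable_likelihood y).comp (measurable_power 8)).aestronglyMeasurable

/-- The result of the first of eight tosses of a coin. -/
def firstToss (z : Fin 8 → Fin 2) : ℝ := ((z 0 : ℕ) : ℝ)

theorem mean_firstToss (s : unitInterval) :
    mean (piDistr fun _ : Fin 8 => coin s) firstToss = s := by
  have h := mean_piDistr (fun _ : Fin 8 => coin s) 0 fun v => ((v : ℕ) : ℝ)
  refine h.trans ?_
  simp [mean, coin_apply]

theorem bayesMean_firstToss (y : Fin n → Fin 8 → Fin 2) :
    bayesMean (power 8 uniformModel) y firstToss = (ones y + 1) / (8 * n + 2) := by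
  rw [bayesMean, evidence_power_uniformModel, power, integral_map (measurable_power 8).aemeasurable
    (aestronglyMeasurable_mean_mul_likelihood _ y _), uniformModel,
    integral_map measurable_coin.aemeasurable]
  · simp only [mean_firstToss]
    exact (div_eq_iff (integral_coinLik_pos y).ne').2 (integral_mul_coinLik y)
  · exact (((continuous_mean _).mul (continuous_likelihood y)).measurable.comp
      (measurable_power 8)).aestronglyMeasurable

end Posterior

/-! ### The model of a code -/

section Code

variable {ι : Type*} [Fintype ι] [Nonempty ι] {n : ℕ} (C : Submodule (ZMod 2) (ι → ZMod 2))

open Classical in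
theorem integral_codeModel (φ : stdSimplex ℝ (ι × ZMod 2) → ℝ) :
    ∫ p, φ p ∂(codeModel C) = (Nat.card C : ℝ)⁻¹ * ∑ c : C, φ (graphDistr c) := by
  rw [codeModel, integral_smul_measure, Measure.sum_fintype,
    integral_finsetSum_measure fun c _ => integrable_dirac (by simp)]
  simp [integral_dirac]

instance : IsProbabilityMeasure (codeModel C) := by
  classical
  refine ⟨?_⟩
  rw [codeModel, Measure.smul_apply, Measure.sum_fintype, Measure.finsetSum_apply]
  simp only [measure_univ, Finset.sum_const, Finset.card_univ, nsmul_eq_mul, mul_one, smul_eq_mul,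
    Nat.card_eq_fintype_card]
  exact ENNReal.inv_mul_cancel (by simp) (by simp)

/-- The indicator function of the point `(i, e)`. -/
def bitInd (i : ι) (e : ZMod 2) (z : ι × ZMod 2) : ℝ :=
  open Classical in if z = (i, e) then 1 else 0

theorem mean_bitInd (c : ι → ZMod 2) (i : ι) (e : ZMod 2) :
    mean (graphDistr c) (bitInd i e) = if c i = e then 1 / (Fintype.card ι : ℝ) else 0 := by
  simp [mean, bitInd, graphDistr_apply, eq_comm]

open Classical in
theorem likelihood_graphDistr (c c' : ι → ZMod 2) (I : Fin n → ι) :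
    likelihood (graphDistr c') (fun r => (I r, c (I r))) =
      if ∀ r, (c' - c) (I r) = 0 then (1 / (Fintype.card ι : ℝ)) ^ n else 0 := by
  simp only [likelihood, graphDistr_apply, Pi.sub_apply, sub_eq_zero]
  split_ifs with h
  · simp [h]
  · push Not at h
    obtain ⟨r, hr⟩ := h
    exact Finset.prod_eq_zero (Finset.mem_univ r) (by simp [hr.symm])

variable {C}

/-- The codewords consistent with the samples form the coset of `c` by the vanishing codewords, and
all of them have the same likelihood. -/
theorem integral_mul_likelihood_codeModel {c : ι → ZMod 2} (hc : c ∈ C) (I : Fin n → ι)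
    (φ : stdSimplex ℝ (ι × ZMod 2) → ℝ) :
    ∫ p, φ p * likelihood p (fun r => (I r, c (I r))) ∂(codeModel C) =
      (Nat.card C : ℝ)⁻¹ * (1 / (Fintype.card ι : ℝ)) ^ n *
        ∑ v ∈ vanishing C I, φ (graphDistr (c + v)) := by
  classical
  rw [integral_codeModel, mul_assoc]
  congr 1
  simp only [likelihood_graphDistr, mul_ite, mul_zero]
  rw [← Finset.sum_filter, Finset.mul_sum]
  refine Finset.sum_bij (fun c' _ => (c' : ι → ZMod 2) - c) ?_ ?_ ?_ ?_
  · intro c' hc'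
    exact mem_vanishing.2 ⟨C.sub_mem c'.2 hc, (Finset.mem_filter.1 hc').2⟩
  · intro a _ b _ h
    exact Subtype.ext (sub_left_injective h)
  · intro v hv
    rw [mem_vanishing] at hv
    exact ⟨⟨c + v, C.add_mem hc hv.1⟩, by simpa using hv.2, by simp⟩
  · intro c' _
    rw [add_sub_cancel, mul_comm]

theorem evidence_codeModel_pos {c : ι → ZMod 2} (hc : c ∈ C) (I : Fin n → ι) :
    0 < evidence (codeModel C) fun r => (I r, c (I r)) := by
  have h := integral_mul_likelihood_codeModel hc I fun _ => 1
  simp only [one_mul, Finset.sum_const, nsmul_eq_mul, mul_one] at h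
  rw [evidence, h]
  have := card_vanishing_pos (C := C) (I := I)
  have h2 : 0 < Nat.card C := Nat.card_pos
  have h3 : 0 < Fintype.card ι := Fintype.card_pos
  positivity

theorem bayesMean_codeModel {c : ι → ZMod 2} (hc : c ∈ C) (I : Fin n → ι) (F : ι × ZMod 2 → ℝ) :
    bayesMean (codeModel C) (fun r => (I r, c (I r))) F =
      (∑ v ∈ vanishing C I, mean (graphDistr (c + v)) F) / (vanishing C I).card := by
  have h := integral_mul_likelihood_codeModel hc I fun _ => 1
  have h' := integral_mul_likelihood_codeModel hc I fun p => mean p F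
  simp only [one_mul, Finset.sum_const, nsmul_eq_mul, mul_one] at h
  rw [bayesMean, evidence, h, h', mul_div_mul_left]
  have h2 : 0 < Nat.card C := Nat.card_pos
  have h3 : 0 < Fintype.card ι := Fintype.card_pos
  positivity

theorem zmod_two_eq_iff_add_one_eq :
    ∀ e e' a : ZMod 2, e ≠ e' → (a = e ↔ a + 1 = e') := by
  decide

/-- If no coordinate of the code is constant, then each of its bits is uniform. -/
theorem map_mean_bitInd_codeModel {i : ι} (hi : ∃ d ∈ C, d i = 1) (e e' : ZMod 2) :
    (codeModel C).map (fun p => mean p (bitInd i e)) =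
      (codeModel C).map (fun p => mean p (bitInd i e')) := by
  classical
  obtain ⟨d, hd, hdi⟩ := hi
  have h : ∀ e, (codeModel C).map (fun p => mean p (bitInd i e)) =
      (Nat.card C : ENNReal)⁻¹ • ∑ c : C, Measure.dirac (mean (graphDistr (c : ι → ZMod 2)) (bitInd i e)) := by
    intro e
    rw [codeModel, Measure.map_smul, Measure.sum_fintype,
      ← Measure.mapₗ_apply_of_measurable (continuous_mean _).measurable, map_sum]
    congr 1
    refine Finset.sum_congr rfl fun c _ => ?_
    rw [Measure.mapₗ_apply_of_measurable (continuous_mean _).measurable,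
      Measure.map_dirac' (continuous_mean _).measurable]
  rw [h, h]
  congr 1
  rcases eq_or_ne e e' with rfl | hne
  · rfl
  -- Translation by `d` permutes the code and flips the `i`-th bit.
  · refine Fintype.sum_equiv (Equiv.addRight (⟨d, hd⟩ : C)) _ _ fun c => ?_
    congr 1
    rw [mean_bitInd, mean_bitInd]
    congr 1
    simp only [Equiv.coe_addRight, Submodule.coe_add, Pi.add_apply, hdi]
    exact propext (zmod_two_eq_iff_add_one_eq e e' _ hne)

end Code

/-! ### Parametrized priors -/

section Parametrized

variable {X Y : Type*} [Fintype X] [Fintype Y] {Ω Ω' : Type*} [MeasurableSpace Ω]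
  [MeasurableSpace Ω']

theorem tensor_map (μ : Measure Ω) (ν : Measure Ω') [IsProbabilityMeasure μ]
    [IsProbabilityMeasure ν] {f : Ω → stdSimplex ℝ X} {h : Ω' → stdSimplex ℝ Y}
    (hf : Measurable f) (hh : Measurable h) :
    tensor (μ.map f) (ν.map h) = (μ.prod ν).map fun z => prodDistr (f z.1) (h z.2) := by
  rw [tensor, Measure.map_prod_map _ _ hf hh, Measure.map_map measurable_prodDistr
    (hf.prodMap hh)]
  rfl

theorem tensorPower_map (r : ℕ) (μ : Measure Ω) [IsProbabilityMeasure μ]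
    {f : Ω → stdSimplex ℝ X} (hf : Measurable f) :
    tensorPower r (μ.map f) =
      (Measure.pi fun _ : Fin r => μ).map fun w => piDistr fun i => f (w i) := by
  have := Measure.isProbabilityMeasure_map (μ := μ) hf.aemeasurable
  have hm : Measurable fun (w : Fin r → Ω) i => f (w i) :=
    measurable_pi_lambda _ fun i => hf.comp (measurable_pi_apply i)
  rw [tensorPower, ← Measure.pi_map_pi fun _ => hf.aemeasurable,
    Measure.map_map measurable_piDistr hm]
  rfl

theorem map_mean_tensorPower (r : ℕ) (P : Measure (stdSimplex ℝ X)) [IsProbabilityMeasure P]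
    (j : Fin r) (F : X → ℝ) :
    (tensorPower r P).map (fun p => mean p fun z => F (z j)) = P.map fun p => mean p F := by
  rw [tensorPower, Measure.map_map (continuous_mean _).measurable measurable_piDistr]
  have e : ((fun p => mean p fun z : Fin r → X => F (z j)) ∘ fun p => piDistr p) =
      (fun p => mean p F) ∘ Function.eval j := by
    funext p
    exact mean_piDistr p j F
  rw [e, ← Measure.map_map (continuous_mean _).measurable (measurable_pi_apply j),
    (measurePreserving_eval (fun _ : Fin r => P) j).map_eq]

theorem map_mean_tensor (P₁ : Measure (stdSimplex ℝ X)) (P₂ : Measure (stdSimplex ℝ Y))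
    [IsProbabilityMeasure P₁] [IsProbabilityMeasure P₂] (a b : ℝ) (F : X → ℝ) (G : Y → ℝ) :
    (tensor P₁ P₂).map (fun p => mean p fun z => a * G z.2 + b * F z.1) =
      ((P₁.map fun p => mean p F).prod (P₂.map fun p => mean p G)).map
        fun z => a * z.2 + b * z.1 := by
  rw [tensor, Measure.map_map (continuous_mean _).measurable measurable_prodDistr,
    Measure.map_prod_map _ _ (continuous_mean F).measurable (continuous_mean G).measurable,
    Measure.map_map (by fun_prop) ((continuous_mean F).measurable.prodMap
      (continuous_mean G).measurable)]
  congr 1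
  funext p
  simp only [Function.comp_apply, Prod.map]
  rw [mean_add, mean_const_mul, mean_const_mul, mean_prodDistr_snd p.1 p.2 G,
    mean_prodDistr_fst p.1 p.2 F]

end Parametrized

/-! ### The challenge model -/

section Challenge

variable {ι : Type*} [Fintype ι] [Nonempty ι] (C : Submodule (ZMod 2) (ι → ZMod 2)) (k m : ℕ)
  {n : ℕ}

/-- A uniformly random codeword. -/
def uniformCodeword : Measure C :=
  (Nat.card C : ENNReal)⁻¹ • Measure.sum fun c : C => Measure.dirac c

instance : IsProbabilityMeasure (uniformCodeword C) := by
  classical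
  refine ⟨?_⟩
  rw [uniformCodeword, Measure.smul_apply, Measure.sum_fintype, Measure.finsetSum_apply]
  simp only [measure_univ, Finset.sum_const, Finset.card_univ, nsmul_eq_mul, mul_one, smul_eq_mul,
    Nat.card_eq_fintype_card]
  exact ENNReal.inv_mul_cancel (by simp) (by simp)

theorem uniformCodeword_singleton (c : C) : uniformCodeword C {c} = (Nat.card C : ENNReal)⁻¹ := by
  classical
  rw [uniformCodeword, Measure.smul_apply, Measure.sum_fintype, Measure.finsetSum_apply]
  simp [Set.indicator_apply]

theorem codeModel_eq_map :
    codeModel C = (uniformCodeword C).map fun c : C => graphDistr (c : ι → ZMod 2) := by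
  classical
  have hm : Measurable fun c : C => graphDistr (c : ι → ZMod 2) := measurable_of_finite _
  rw [codeModel, uniformCodeword, Measure.map_smul, Measure.sum_fintype, Measure.sum_fintype,
    ← Measure.mapₗ_apply_of_measurable hm, map_sum]
  congr 1
  refine Finset.sum_congr rfl fun c _ => ?_
  rw [Measure.mapₗ_apply_of_measurable hm, Measure.map_dirac' hm]

variable {C k m}

/-- The hypothesis with the codewords `c` and the biases `s`. -/
def hypothesis (c : Fin m → ι → ZMod 2) (s : Fin m → Fin (k - 1) → unitInterval) :
    stdSimplex ℝ (ChallengeUniverse ι k m) :=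
  piDistr fun j => prodDistr (graphDistr (c j))
    (piDistr fun l => piDistr fun _ : Fin 8 => coin (s j l))

/-- The samples with positions `I` from the codewords `c`, and with the tosses `y`. -/
def sample (c : Fin m → ι → ZMod 2) (I : Fin m → Fin n → ι)
    (y : Fin m → Fin (k - 1) → Fin n → Fin 8 → Fin 2) : Fin n → ChallengeUniverse ι k m :=
  fun r j => ((I j r, c j (I j r)), fun l => y j l r)

theorem measurable_coins (K : ℕ) : Measurable fun s : Fin K → unitInterval =>
    piDistr fun l => piDistr fun _ : Fin 8 => coin (s l) :=
  measurable_piDistr.comp (measurable_pi_lambda _ fun l =>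
    (measurable_power 8).comp (measurable_coin.comp (measurable_pi_apply l)))

theorem measurable_hypothesis (c : Fin m → ι → ZMod 2) :
    Measurable fun s : Fin m → Fin (k - 1) → unitInterval => hypothesis c s :=
  measurable_piDistr.comp (measurable_pi_lambda _ fun j => measurable_prodDistr.comp
    (measurable_const.prodMk ((measurable_coins _).comp (measurable_pi_apply j))))

instance : IsProbabilityMeasure (challengeModel C k m) := by
  have := isProbabilityMeasure_power 8 uniformModel
  have := isProbabilityMeasure_tensorPower (k - 1) (power 8 uniformModel)
  have := isProbabilityMeasure_tensor (codeModel C) (tensorPower (k - 1) (power 8 uniformModel))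
  exact isProbabilityMeasure_tensorPower _ _

open Classical in
-- The prior is the image of independent uniform codewords and biases, so that the codewords can be
-- fixed before the coins are averaged.
theorem lintegral_challengeModel {φ : stdSimplex ℝ (ChallengeUniverse ι k m) → ENNReal}
    (hφ : Measurable φ) :
    ∫⁻ p, φ p ∂(challengeModel C k m) =
      ∑ c : Fin m → C, ((Nat.card C : ENNReal)⁻¹) ^ m *
        ∫⁻ s, φ (hypothesis (fun j => (c j : ι → ZMod 2)) s) := by
  have hg : Measurable fun c : C => graphDistr (c : ι → ZMod 2) := measurable_of_finite _
  have h1 : power 8 uniformModel =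
      (volume : Measure unitInterval).map fun s => piDistr fun _ : Fin 8 => coin s := by
    rw [power, uniformModel, Measure.map_map (measurable_power 8) measurable_coin]
    rfl
  have hm : Measurable fun z : C × (Fin (k - 1) → unitInterval) =>
      prodDistr (graphDistr (z.1 : ι → ZMod 2))
        (piDistr fun l => piDistr fun _ : Fin 8 => coin (z.2 l)) :=
    measurable_prodDistr.comp ((hg.comp measurable_fst).prodMk
      ((measurable_coins _).comp measurable_snd))
  have h2 : challengeModel C k m = (Measure.pi fun _ : Fin m => (uniformCodeword C).prod volume).map
      fun w => hypothesis (fun j => ((w j).1 : ι → ZMod 2)) fun j => (w j).2 := by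
    rw [challengeModel, h1, tensorPower_map (f := fun s => piDistr fun _ : Fin 8 => coin s) _ _
        ((measurable_power 8).comp measurable_coin),
      codeModel_eq_map, tensor_map _ _ hg (measurable_coins _), ← volume_pi,
      tensorPower_map _ _ hm]
    rfl
  have hm' : Measurable fun z : (Fin m → C) × (Fin m → Fin (k - 1) → unitInterval) =>
      φ (hypothesis (fun j => (z.1 j : ι → ZMod 2)) z.2) := by
    refine hφ.comp (measurable_piDistr.comp (measurable_pi_lambda _ fun j => hm.comp
      (Measurable.prodMk ?_ ?_)))
    · exact (measurable_pi_apply j).comp measurable_fst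
    · exact (measurable_pi_apply j).comp measurable_snd
  have h3 := (measurePreserving_arrowProdEquivProdArrow C (Fin (k - 1) → unitInterval) (Fin m)
    (fun _ => uniformCodeword C) (fun _ => volume)).lintegral_comp hm'
  rw [h2, lintegral_map hφ]
  · refine Eq.trans h3 ?_
    rw [lintegral_prod _ hm'.aemeasurable, lintegral_fintype]
    refine Finset.sum_congr rfl fun c _ => ?_
    rw [Measure.pi_singleton, mul_comm]
    simp only [uniformCodeword_singleton, Finset.prod_const, Finset.card_univ, Fintype.card_fin]
    rfl
  · exact measurable_piDistr.comp (measurable_pi_lambda _ fun j => hm.comp (measurable_pi_apply j))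

theorem likelihood_sample (c : Fin m → ι → ZMod 2) (s : Fin m → Fin (k - 1) → unitInterval)
    (I : Fin m → Fin n → ι) (y : Fin m → Fin (k - 1) → Fin n → Fin 8 → Fin 2) :
    likelihood (hypothesis c s) (sample c I y) =
      ((1 / (Fintype.card ι : ℝ)) ^ n) ^ m * ∏ j, ∏ l, coinLik (s j l) (y j l) := by
  classical
  simp only [hypothesis, likelihood_piDistr, likelihood_prodDistr, Finset.prod_mul_distrib, sample,
    likelihood_graphDistr, sub_self]
  simp [coinLik, likelihood_piDistr]

theorem sample_injective (c : Fin m → ι → ZMod 2) :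
    Function.Injective fun z : (Fin m → Fin n → ι) ×
      (Fin m → Fin (k - 1) → Fin n → Fin 8 → Fin 2) => sample c z.1 z.2 := by
  rintro ⟨I, y⟩ ⟨I', y'⟩ h
  refine Prod.ext ?_ ?_
  · funext j r
    exact congrArg (fun z => z.1.1) (congrFun (congrFun h r) j)
  · funext j l r
    exact congrFun (congrArg (fun z => z.2) (congrFun (congrFun h r) j)) l

open Classical in
-- The tuples `sample c I y` are only some of all possible samples; dropping the others can only
-- decrease the sum.
theorem le_failureProb (g : MeanCurator) (S : Strategy (ChallengeUniverse ι k m)) (N : ℕ) (ε : ℝ) :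
    ∑ c : Fin m → C, ∑ I : Fin m → Fin n → ι,
      ((Nat.card C : ENNReal)⁻¹) ^ m * ENNReal.ofReal (((1 / (Fintype.card ι : ℝ)) ^ n) ^ m) *
        ∫⁻ s : Fin m → Fin (k - 1) → unitInterval,
          ∑ y : Fin m → Fin (k - 1) → Fin n → Fin 8 → Fin 2,
            (∏ j, ∏ l, ENNReal.ofReal (coinLik (s j l) (y j l))) *
            transcript (challengeModel C k m) g S (sample (fun j => (c j : ι → ZMod 2)) I y) N
              (inaccurate S (hypothesis (fun j => (c j : ι → ZMod 2)) s) N ε) ≤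
    failureProb (challengeModel C k m) n g S N ε := by
  have hmeas : ∀ xs : Fin n → ChallengeUniverse ι k m,
      Measurable fun p => ENNReal.ofReal (likelihood p xs) *
        transcript (challengeModel C k m) g S xs N (inaccurate S p N ε) := fun xs =>
    (measurable_likelihood xs).ennreal_ofReal.mul (measurable_transcript_inaccurate _ g S xs N ε)
  rw [failureProb, lintegral_challengeModel (Finset.measurable_sum _ fun xs _ => hmeas xs)]
  refine Finset.sum_le_sum fun c _ => ?_
  simp only [mul_assoc]
  rw [← Finset.mul_sum]
  gcongr
  simp_rw [← lintegral_const_mul' _ _ ENNReal.ofReal_ne_top]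
  have hm1 : ∀ I : Fin m → Fin n → ι, Measurable fun s : Fin m → Fin (k - 1) → unitInterval =>
      ENNReal.ofReal (((1 / (Fintype.card ι : ℝ)) ^ n) ^ m) *
        ∑ y : Fin m → Fin (k - 1) → Fin n → Fin 8 → Fin 2,
          (∏ j, ∏ l, ENNReal.ofReal (coinLik (s j l) (y j l))) *
          transcript (challengeModel C k m) g S (sample (fun j => (c j : ι → ZMod 2)) I y) N
            (inaccurate S (hypothesis (fun j => (c j : ι → ZMod 2)) s) N ε) := by
    intro I
    refine measurable_const.mul (Finset.measurable_sum _ fun y _ => Measurable.mul ?_ ?_)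
    · refine Finset.measurable_prod _ fun j _ => Finset.measurable_prod _ fun l _ => ?_
      exact ((continuous_coinLik (y j l)).measurable.comp
        ((measurable_pi_apply l).comp (measurable_pi_apply j))).ennreal_ofReal
    · exact (measurable_transcript_inaccurate _ g S _ N ε).comp (measurable_hypothesis _)
  rw [← lintegral_finsetSum _ fun I _ => hm1 I]
  refine lintegral_mono fun s => ?_
  simp only [Finset.mul_sum]
  rw [← Fintype.sum_prod_type']
  refine le_trans (le_of_eq ?_) (Finset.sum_le_sum_of_subset (Finset.subset_univ
    (Finset.univ.image fun z : (Fin m → Fin n → ι) ×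
      (Fin m → Fin (k - 1) → Fin n → Fin 8 → Fin 2) => sample (fun j => (c j : ι → ZMod 2)) z.1 z.2)))
  rw [Finset.sum_image fun a _ b _ h => sample_injective _ h]
  refine Finset.sum_congr rfl fun z _ => ?_
  rw [likelihood_sample, ENNReal.ofReal_mul (by positivity), ENNReal.ofReal_prod_of_nonneg
    fun j _ => Finset.prod_nonneg fun l _ => coinLik_nonneg _ _, mul_assoc]
  congr 3
  funext j
  rw [ENNReal.ofReal_prod_of_nonneg fun l _ => coinLik_nonneg _ _]

/-- A toss of the `l`-th coin, mixed with the indicator of the point `(i, e)`. -/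
def blockQuery (a b : ℝ) (i : ι) (e : ZMod 2) (l : Fin (k - 1))
    (z : (ι × ZMod 2) × (Fin (k - 1) → Fin 8 → Fin 2)) : ℝ :=
  a * firstToss (z.2 l) + b * bitInd i e z.1

/-- The query that hides the question whether the `i`-th bit of the `j`-th codeword is `e` behind
the `l`-th coin. -/
def learnQuery (a b : ℝ) (j : Fin m) (i : ι) (e : ZMod 2) (l : Fin (k - 1)) :
    ChallengeUniverse ι k m → unitInterval :=
  -- For the parameters in use the value already lies in [0, 1], and the projection changes nothing.
  fun x => Set.projIcc 0 1 zero_le_one (blockQuery a b i e l (x j))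

/-- The query for the agreement of the `j`-th codeword with the word `w`. -/
def agreeQuery (j : Fin m) (w : ι → ZMod 2) : ChallengeUniverse ι k m → unitInterval :=
  fun x => if (x j).1.2 = w (x j).1.1 then 1 else 0

theorem firstToss_mem (z : Fin 8 → Fin 2) : firstToss z ∈ Set.Icc (0 : ℝ) 1 := by
  unfold firstToss
  generalize z 0 = v
  fin_cases v <;> simp

theorem bitInd_mem (i : ι) (e : ZMod 2) (z : ι × ZMod 2) : bitInd i e z ∈ Set.Icc (0 : ℝ) 1 := by
  unfold bitInd
  split_ifs <;> simp

variable {a b : ℝ}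

theorem coe_learnQuery (ha : 0 ≤ a) (hb : 0 ≤ b) (hab : a + b ≤ 1) (j : Fin m) (i : ι) (e : ZMod 2)
    (l : Fin (k - 1)) (x : ChallengeUniverse ι k m) :
    (learnQuery a b j i e l x : ℝ) = blockQuery a b i e l (x j) := by
  have h1 := firstToss_mem ((x j).2 l)
  have h2 := bitInd_mem i e (x j).1
  rw [learnQuery, Set.projIcc_of_mem]
  unfold blockQuery
  constructor
  · exact add_nonneg (mul_nonneg ha h1.1) (mul_nonneg hb h2.1)
  · nlinarith [h1.2, h2.2]

theorem expect_learnQuery (ha : 0 ≤ a) (hb : 0 ≤ b) (hab : a + b ≤ 1) (j : Fin m) (i : ι)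
    (e : ZMod 2) (l : Fin (k - 1)) (c : Fin m → ι → ZMod 2)
    (s : Fin m → Fin (k - 1) → unitInterval) :
    expect (hypothesis c s) (learnQuery a b j i e l) =
      a * s j l + b * if c j i = e then 1 / (Fintype.card ι : ℝ) else 0 := by
  simp only [expect_eq_mean, coe_learnQuery ha hb hab]
  rw [hypothesis, mean_piDistr (F := blockQuery a b i e l)]
  unfold blockQuery
  rw [mean_add, mean_const_mul, mean_const_mul, mean_prodDistr_snd 
      (F := fun z : Fin (k - 1) → Fin 8 → Fin 2 => firstToss (z l)),
    mean_prodDistr_fst, mean_bitInd, mean_piDistr (F := firstToss), mean_firstToss]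

theorem expect_agreeQuery (j : Fin m) (w : ι → ZMod 2) (c : Fin m → ι → ZMod 2)
    (s : Fin m → Fin (k - 1) → unitInterval) :
    expect (hypothesis c s) (agreeQuery j w) = 1 - wt (c j - w) / (Fintype.card ι : ℝ) := by
  classical
  have h : ∀ x : ChallengeUniverse ι k m, (agreeQuery j w x : ℝ) =
      (fun z : ι × ZMod 2 => if z.2 = w z.1 then (1 : ℝ) else 0) (x j).1 := by
    intro x
    simp only [agreeQuery]
    split_ifs <;> rfl
  have hι : (Fintype.card ι : ℝ) ≠ 0 := by exact_mod_cast Fintype.card_ne_zero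
  simp only [expect_eq_mean, h]
  rw [hypothesis, mean_piDistr (F := fun x : (ι × ZMod 2) × (Fin (k - 1) → Fin 8 → Fin 2) =>
      (fun z : ι × ZMod 2 => if z.2 = w z.1 then (1 : ℝ) else 0) x.1), mean_prodDistr_fst
      (F := fun z : ι × ZMod 2 => if z.2 = w z.1 then (1 : ℝ) else 0)]
  simp only [mean, graphDistr_apply, Fintype.sum_prod_type, mul_ite, mul_one,
    mul_zero, Finset.sum_ite_eq', Finset.mem_univ, if_true]
  rw [← Finset.sum_filter, Finset.sum_const, nsmul_eq_mul]
  have h2 := Finset.card_filter_add_card_filter_not (s := Finset.univ) (fun i : ι => c j i = w i)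
  rw [Finset.card_univ] at h2
  have h3 : wt (c j - w) = (Finset.univ.filter fun i : ι => ¬ c j i = w i).card := by
    simp only [wt, Pi.sub_apply, ne_eq, sub_eq_zero]
  rw [h3, eq_sub_iff_add_eq, mul_one_div, ← add_div]
  rw [div_eq_one_iff_eq hι]
  simp only [eq_comm (b := w _)] at h2 ⊢
  exact_mod_cast h2

/-- Because of this the curator's first argument reveals neither the bit value asked for nor the
coin; his answer can depend on them only through the posterior mean. -/
theorem queryPrior_learnQuery (ha : 0 ≤ a) (hb : 0 ≤ b) (hab : a + b ≤ 1)
    (hC : ∀ i, ∃ d ∈ C, d i = 1) (j : Fin m) (i : ι) (e e' : ZMod 2) (l l' : Fin (k - 1)) :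
    queryPrior (challengeModel C k m) (learnQuery a b j i e l) =
      queryPrior (challengeModel C k m) (learnQuery a b j i e' l') := by
  have := isProbabilityMeasure_power 8 uniformModel
  have := isProbabilityMeasure_tensorPower (k - 1) (power 8 uniformModel)
  have := isProbabilityMeasure_tensor (codeModel C) (tensorPower (k - 1) (power 8 uniformModel))
  have h : ∀ e l, queryPrior (challengeModel C k m) (learnQuery a b j i e l) =
      (((codeModel C).map fun p => mean p (bitInd i e)).prod
        ((power 8 uniformModel).map fun p => mean p firstToss)).map fun z => a * z.2 + b * z.1 := by
    intro e l
    simp only [queryPrior, expect_eq_mean, coe_learnQuery ha hb hab]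
    rw [challengeModel, map_mean_tensorPower m _ j (blockQuery a b i e l)]
    unfold blockQuery
    rw [map_mean_tensor _ _ a b (bitInd i e) fun z : Fin (k - 1) → Fin 8 → Fin 2 => firstToss (z l), map_mean_tensorPower]
  rw [h, h, map_mean_bitInd_codeModel (hC i) e e']

/-- The number of ones and the knowledge about the bit enter only through one sum, so that the coin
masks the bit. -/
theorem posteriorMean_learnQuery (ha : 0 ≤ a) (hb : 0 ≤ b) (hab : a + b ≤ 1)
    (c : Fin m → C) (I : Fin m → Fin n → ι) (y : Fin m → Fin (k - 1) → Fin n → Fin 8 → Fin 2)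
    (j : Fin m) (i : ι) (e : ZMod 2) (l : Fin (k - 1)) :
    posteriorMean (challengeModel C k m) (sample (fun j => (c j : ι → ZMod 2)) I y)
        (learnQuery a b j i e l) =
      a * ((ones (y j l) + 1) / (8 * n + 2)) +
        b * bayesMean (codeModel C) (fun r => (I j r, (c j : ι → ZMod 2) (I j r))) (bitInd i e) := by
  have := isProbabilityMeasure_power 8 uniformModel
  have := isProbabilityMeasure_tensorPower (k - 1) (power 8 uniformModel)
  have := isProbabilityMeasure_tensor (codeModel C) (tensorPower (k - 1) (power 8 uniformModel))
  have e1 : ∀ j, evidence (codeModel C)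
      (fun r => (sample (fun j => (c j : ι → ZMod 2)) I y r j).1) ≠ 0 :=
    fun j => (evidence_codeModel_pos (c j).2 (I j)).ne'
  have e2 : ∀ j l, evidence (power 8 uniformModel)
      (fun r => (sample (fun j => (c j : ι → ZMod 2)) I y r j).2 l) ≠ 0 := by
    intro j l
    rw [evidence_power_uniformModel]
    exact (integral_coinLik_pos (y j l)).ne'
  have e3 : ∀ j, evidence (tensorPower (k - 1) (power 8 uniformModel))
      (fun r => (sample (fun j => (c j : ι → ZMod 2)) I y r j).2) ≠ 0 := by
    intro j
    rw [evidence_tensorPower]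
    exact Finset.prod_ne_zero_iff.2 fun l _ => e2 j l
  rw [posteriorMean_eq_bayesMean]
  simp only [coe_learnQuery ha hb hab]
  rw [challengeModel, bayesMean_tensorPower m _ _ j (blockQuery a b i e l)]
  unfold blockQuery
  rw [bayesMean_add, bayesMean_const_mul,
    bayesMean_const_mul, bayesMean_tensor_fst _ _ _ _ (e3 j),
    bayesMean_tensor_snd _ _ _ (fun z : Fin (k - 1) → Fin 8 → Fin 2 => firstToss (z l)) (e1 j),
    bayesMean_tensorPower _ _ _ l firstToss (e2 j)]
  · congr 2
    exact bayesMean_firstToss (y j l)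
  · intro j
    rw [evidence_tensor]
    exact mul_ne_zero (e1 j) (e3 j)

end Challenge

/-! ### Averages over many independent coins -/

section CoinAverages

theorem lintegral_pi_prod {ι : Type*} [Fintype ι] {Ω : ι → Type*} [∀ i, MeasurableSpace (Ω i)]
    (μ : ∀ i, Measure (Ω i)) [∀ i, IsProbabilityMeasure (μ i)] {f : ∀ i, Ω i → ENNReal}
    (hf : ∀ i, Measurable (f i)) :
    ∫⁻ x, ∏ i, f i (x i) ∂(Measure.pi μ) = ∏ i, ∫⁻ x, f i x ∂(μ i) := by
  refine (ProbabilityTheory.lintegral_prod_eq_prod_lintegral_of_indepFun Finset.univ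
    (fun i (x : ∀ i, Ω i) => f i (x i))
    (ProbabilityTheory.iIndepFun_pi fun i => (hf i).aemeasurable)
    fun i => (hf i).comp (measurable_pi_apply i)).trans ?_
  refine Finset.prod_congr rfl fun i _ => ?_
  exact (measurePreserving_eval μ i).lintegral_comp (hf i)

variable {m K n : ℕ}

/-- The probability of the tosses `y` of independent coins with the biases `s`. -/
def coinsWeight (s : Fin m → Fin K → unitInterval) (y : Fin m → Fin K → Fin n → Fin 8 → Fin 2) :
    ENNReal :=
  ∏ j, ∏ l, ENNReal.ofReal (coinLik (s j l) (y j l))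

theorem measurable_ofReal_coinLik (y : Fin n → Fin 8 → Fin 2) :
    Measurable fun s => ENNReal.ofReal (coinLik s y) :=
  (continuous_coinLik y).measurable.ennreal_ofReal

theorem measurable_coinsWeight (y : Fin m → Fin K → Fin n → Fin 8 → Fin 2) :
    Measurable fun s : Fin m → Fin K → unitInterval => coinsWeight s y :=
  Finset.measurable_prod _ fun j _ => Finset.measurable_prod _ fun l _ =>
    (measurable_ofReal_coinLik (y j l)).comp ((measurable_pi_apply l).comp (measurable_pi_apply j))

/-- The average of `h` over the bias and the tosses of one coin. -/
def coinAverage (h : unitInterval → (Fin n → Fin 8 → Fin 2) → ENNReal) : ENNReal :=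
  ∫⁻ s, ∑ y, ENNReal.ofReal (coinLik s y) * h s y

theorem coinAverage_one : coinAverage (n := n) (fun _ _ => 1) = 1 := by
  have h : ∀ s, ∑ y : Fin n → Fin 8 → Fin 2, ENNReal.ofReal (coinLik s y) = 1 := by
    intro s
    rw [← ENNReal.ofReal_sum_of_nonneg fun y _ => coinLik_nonneg s y]
    simp only [coinLik, sum_likelihood, ENNReal.ofReal_one]
  simp [coinAverage, h]

theorem coinAverage_add {h : unitInterval → (Fin n → Fin 8 → Fin 2) → ENNReal}
    (hh : ∀ y, Measurable fun s => h s y) (h' : unitInterval → (Fin n → Fin 8 → Fin 2) → ENNReal) :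
    coinAverage (fun s y => h s y + h' s y) = coinAverage h + coinAverage h' := by
  have hm : Measurable fun s => ∑ y, ENNReal.ofReal (coinLik s y) * h s y :=
    Finset.measurable_sum _ fun y _ => (measurable_ofReal_coinLik y).mul (hh y)
  rw [coinAverage, coinAverage, coinAverage, ← lintegral_add_left hm]
  simp only [mul_add, Finset.sum_add_distrib]

theorem coinAverage_ones (φ : ℕ → ENNReal) :
    coinAverage (n := n) (fun _ y => φ (ones y)) =
      ENNReal.ofReal (1 / (8 * n + 1)) * ∑ N ∈ Finset.range (8 * n + 1), φ N := by
  rw [← sum_integral_coinLik_mul, coinAverage, lintegral_finsetSum _ fun y _ =>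
    (measurable_ofReal_coinLik y).mul_const _]
  refine Finset.sum_congr rfl fun y _ => ?_
  rw [lintegral_mul_const _ (measurable_ofReal_coinLik y),
    ofReal_integral_eq_lintegral_ofReal (integrable_coinLik y)
      (ae_of_all _ fun s => coinLik_nonneg s y)]

theorem lintegral_sum_coinsWeight_mul_prod
    {h : Fin m → Fin K → unitInterval → (Fin n → Fin 8 → Fin 2) → ENNReal}
    (hh : ∀ j l y, Measurable fun s => h j l s y) :
    ∫⁻ s : Fin m → Fin K → unitInterval, ∑ y : Fin m → Fin K → Fin n → Fin 8 → Fin 2,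
        coinsWeight s y * ∏ j, ∏ l, h j l (s j l) (y j l) =
      ∏ j, ∏ l, coinAverage (h j l) := by
  have e1 : ∀ s : Fin m → Fin K → unitInterval,
      ∑ y : Fin m → Fin K → Fin n → Fin 8 → Fin 2,
        coinsWeight s y * ∏ j, ∏ l, h j l (s j l) (y j l) =
      ∏ j, ∏ l, ∑ y, ENNReal.ofReal (coinLik (s j l) y) * h j l (s j l) y := by
    intro s
    simp_rw [coinsWeight, ← Finset.prod_mul_distrib]
    rw [← Fintype.piFinset_univ, Finset.sum_prod_piFinset Finset.univ
      fun j (z : Fin K → Fin n → Fin 8 → Fin 2) => ∏ l, ENNReal.ofReal (coinLik (s j l) (z l)) * h j l (s j l) (z l)]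
    refine Finset.prod_congr rfl fun j _ => ?_
    rw [← Fintype.piFinset_univ, Finset.sum_prod_piFinset Finset.univ fun l z =>
      ENNReal.ofReal (coinLik (s j l) z) * h j l (s j l) z]
  have hm : ∀ j l, Measurable fun s => ∑ y, ENNReal.ofReal (coinLik s y) * h j l s y :=
    fun j l => Finset.measurable_sum _ fun y _ => (measurable_ofReal_coinLik y).mul (hh j l y)
  simp_rw [e1]
  rw [volume_pi, lintegral_pi_prod (fun _ : Fin m => (volume : Measure (Fin K → unitInterval)))
    (f := fun j s => ∏ l, ∑ y, ENNReal.ofReal (coinLik (s l) y) * h j l (s l) y)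
    fun j => Finset.measurable_prod _ fun l _ => (hm j l).comp (measurable_pi_apply l)]
  refine Finset.prod_congr rfl fun j _ => ?_
  rw [volume_pi, lintegral_pi_prod (fun _ : Fin K => (volume : Measure unitInterval)) (hm j)]
  rfl

variable {Q : Type*} [Fintype Q] {pos : Q → Fin m × Fin K}

theorem prod_eq_prod_fiber {M : Type*} [CommMonoid M] (F : Q → M) :
    ∏ q, F q = ∏ j, ∏ l, ∏ q ∈ Finset.univ.filter (fun q => pos q = (j, l)), F q := by
  rw [← Fintype.prod_prod_type' (f := fun j l =>
      ∏ q ∈ Finset.univ.filter (fun q => pos q = (j, l)), F q)]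
  exact (Finset.prod_fiberwise Finset.univ pos F).symm

/-- By injectivity each coin serves at most one query, and unused coins contribute the factor 1. -/
theorem lintegral_sum_coinsWeight_mul_prod_comp (hpos : Function.Injective pos)
    {h : Q → unitInterval → (Fin n → Fin 8 → Fin 2) → ENNReal}
    (hh : ∀ q y, Measurable fun s => h q s y) :
    ∫⁻ s : Fin m → Fin K → unitInterval, ∑ y : Fin m → Fin K → Fin n → Fin 8 → Fin 2,
        coinsWeight s y * ∏ q, h q (s (pos q).1 (pos q).2) (y (pos q).1 (pos q).2) =
      ∏ q, coinAverage (h q) := by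
  classical
  have e1 : ∀ (s : Fin m → Fin K → unitInterval) (y : Fin m → Fin K → Fin n → Fin 8 → Fin 2),
      ∏ q, h q (s (pos q).1 (pos q).2) (y (pos q).1 (pos q).2) =
      ∏ j, ∏ l, ∏ q ∈ Finset.univ.filter (fun q => pos q = (j, l)), h q (s j l) (y j l) := by
    intro s y
    rw [prod_eq_prod_fiber (pos := pos)]
    refine Finset.prod_congr rfl fun j _ => Finset.prod_congr rfl fun l _ =>
      Finset.prod_congr rfl fun q hq => ?_
    rw [(Finset.mem_filter.1 hq).2]
  simp_rw [e1]
  rw [lintegral_sum_coinsWeight_mul_prod (h := fun j l s y =>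
      ∏ q ∈ Finset.univ.filter (fun q => pos q = (j, l)), h q s y)
      fun j l y => Finset.measurable_prod _ fun q _ => hh q y, prod_eq_prod_fiber (pos := pos)]
  refine Finset.prod_congr rfl fun j _ => Finset.prod_congr rfl fun l _ => ?_
  by_cases hq : ∃ q, pos q = (j, l)
  · obtain ⟨q, hq⟩ := hq
    have e : Finset.univ.filter (fun q => pos q = (j, l)) = {q} := by
      ext q'
      simp only [Finset.mem_filter, Finset.mem_univ, true_and, Finset.mem_singleton, ← hq]
      exact hpos.eq_iff
    simp only [e, Finset.prod_singleton]
  · have e : Finset.univ.filter (fun q => pos q = (j, l)) = ∅ := by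
      simpa [Finset.filter_eq_empty_iff] using hq
    simp only [e, Finset.prod_empty, coinAverage_one]

theorem lintegral_sum_coinsWeight :
    ∫⁻ s : Fin m → Fin K → unitInterval, ∑ y : Fin m → Fin K → Fin n → Fin 8 → Fin 2,
      coinsWeight s y = 1 := by
  have h := lintegral_sum_coinsWeight_mul_prod (m := m) (K := K) (n := n)
    (h := fun _ _ _ _ => 1) fun _ _ _ => measurable_const
  simpa [coinAverage_one] using h

/-- The law of an answer with law `γ N` in the case of `N` ones, if `N` is uniform. -/
def mixedLaw (n : ℕ) (γ : ℕ → Measure ℝ) : Measure ℝ :=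
  ENNReal.ofReal (1 / (8 * n + 1)) • ∑ N ∈ Finset.range (8 * n + 1), γ N

theorem mixedLaw_apply (γ : ℕ → Measure ℝ) (A : Set ℝ) :
    mixedLaw n γ A = ENNReal.ofReal (1 / (8 * n + 1)) *
      ∑ N ∈ Finset.range (8 * n + 1), γ N A := by
  rw [mixedLaw, Measure.smul_apply, Measure.finsetSum_apply, smul_eq_mul]

instance (γ : ℕ → Measure ℝ) [∀ N, IsProbabilityMeasure (γ N)] :
    IsProbabilityMeasure (mixedLaw n γ) := by
  refine ⟨?_⟩
  rw [mixedLaw_apply]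
  simp only [measure_univ, Finset.sum_const, Finset.card_range, nsmul_eq_mul, mul_one]
  rw [← ENNReal.ofReal_natCast, ← ENNReal.ofReal_mul (by positivity)]
  push_cast
  rw [one_div_mul_cancel (by positivity), ENNReal.ofReal_one]

/-- On average over the coins, the answers to the queries are independent. -/
theorem lintegral_sum_coinsWeight_mul_pi (hpos : Function.Injective pos)
    (γ : Q → ℕ → Measure ℝ) [∀ q N, IsProbabilityMeasure (γ q N)]
    (H : Set (Q → ℝ)) :
    ∫⁻ s : Fin m → Fin K → unitInterval, ∑ y : Fin m → Fin K → Fin n → Fin 8 → Fin 2,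
        coinsWeight s y * Measure.pi (fun q => γ q (ones (y (pos q).1 (pos q).2))) H =
      Measure.pi (fun q => mixedLaw n (γ q)) H := by
  classical
  -- The left side is a measure in `H`, so it suffices to compare on boxes, where the average
  -- factorizes over the coins.
  let M : Measure (Q → ℝ) := ∑ y : Fin m → Fin K → Fin n → Fin 8 → Fin 2,
    (∫⁻ s : Fin m → Fin K → unitInterval, coinsWeight s y) •
      Measure.pi fun q => γ q (ones (y (pos q).1 (pos q).2))
  have hM : ∀ H, M H = ∫⁻ s : Fin m → Fin K → unitInterval,
      ∑ y : Fin m → Fin K → Fin n → Fin 8 → Fin 2,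
        coinsWeight s y * Measure.pi (fun q => γ q (ones (y (pos q).1 (pos q).2))) H := by
    intro H
    rw [lintegral_finsetSum _ fun y _ => (measurable_coinsWeight y).mul_const _]
    simp only [M, Measure.finsetSum_apply, Measure.smul_apply, smul_eq_mul]
    refine Finset.sum_congr rfl fun y _ => ?_
    rw [lintegral_mul_const _ (measurable_coinsWeight y)]
  have hpi : Measure.pi (fun q => mixedLaw n (γ q)) = M := by
    refine Measure.pi_eq fun A _ => ?_
    rw [hM]
    simp only [Measure.pi_pi]
    rw [lintegral_sum_coinsWeight_mul_prod_comp hpos (h := fun q _ y => γ q (ones y) (A q))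
      fun _ _ => measurable_const]
    refine Finset.prod_congr rfl fun q _ => ?_
    rw [mixedLaw_apply, coinAverage_ones fun N => γ q N (A q)]
  rw [hpi, hM]

/-- The bound is a product of three factors: 1/(8n+1) for each number of ones, 1/4 for the bad
answers summed over the numbers in `D`, and 1/2 for the posterior probability that the bias lies in
`U`. -/
theorem le_coinAverage {U : Set unitInterval} (hU : MeasurableSet U) {D : Finset ℕ}
    (hD : D ⊆ Finset.range (8 * n + 1))
    (hw : ∀ y : Fin n → Fin 8 → Fin 2, ones y ∈ D →
      ENNReal.ofReal (∫ s, coinLik s y) * ENNReal.ofReal (1 / 2) ≤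
        ∫⁻ s in U, ENNReal.ofReal (coinLik s y))
    {φ : ℕ → ENNReal} {h : unitInterval → (Fin n → Fin 8 → Fin 2) → ENNReal}
    (hφ : ENNReal.ofReal (1 / 4) ≤ ∑ N ∈ D, φ N)
    (hh : ∀ s ∈ U, ∀ y, ones y ∈ D → φ (ones y) ≤ h s y) :
    ENNReal.ofReal (1 / (8 * (8 * n + 1))) ≤ coinAverage h := by
  set ψ : ℕ → ENNReal := fun N => if N ∈ D then φ N else 0 with hψ
  calc ENNReal.ofReal (1 / (8 * (8 * n + 1)))
      = ENNReal.ofReal (1 / 2) * (ENNReal.ofReal (1 / (8 * n + 1)) * ENNReal.ofReal (1 / 4)) := by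
        rw [← ENNReal.ofReal_mul (by positivity), ← ENNReal.ofReal_mul (by positivity)]
        congr 1
        field_simp
        norm_num
    _ ≤ ENNReal.ofReal (1 / 2) * (ENNReal.ofReal (1 / (8 * n + 1)) *
          ∑ N ∈ Finset.range (8 * n + 1), ψ N) := by
        gcongr
        refine hφ.trans (le_trans ?_ (Finset.sum_le_sum_of_subset hD))
        exact le_of_eq (Finset.sum_congr rfl fun N hN => by simp [hψ, hN])
    _ = ∑ y : Fin n → Fin 8 → Fin 2,
          ENNReal.ofReal (1 / 2) * (ENNReal.ofReal (∫ s, coinLik s y) * ψ (ones y)) := by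
        rw [← sum_integral_coinLik_mul, Finset.mul_sum]
    _ ≤ ∑ y : Fin n → Fin 8 → Fin 2,
          ∫⁻ s, ENNReal.ofReal (coinLik s y) * (U.indicator 1 s * ψ (ones y)) := by
        refine Finset.sum_le_sum fun y _ => ?_
        by_cases hy : ones y ∈ D
        · have h3 : ∫⁻ s, ENNReal.ofReal (coinLik s y) * (U.indicator 1 s * ψ (ones y)) =
              (∫⁻ s in U, ENNReal.ofReal (coinLik s y)) * ψ (ones y) := by
            rw [← lintegral_indicator hU, ← lintegral_mul_const _
              ((measurable_ofReal_coinLik y).indicator hU)]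
            refine lintegral_congr fun s => ?_
            by_cases hs : s ∈ U
            · rw [Set.indicator_of_mem hs, Set.indicator_of_mem hs, Pi.one_apply, one_mul]
            · rw [Set.indicator_of_notMem hs, Set.indicator_of_notMem hs, zero_mul, mul_zero]
          rw [h3, ← mul_assoc, mul_comm (ENNReal.ofReal (1 / 2))]
          gcongr
          exact hw y hy
        · simp [hψ, hy]
    _ = ∫⁻ s, ∑ y : Fin n → Fin 8 → Fin 2, ENNReal.ofReal (coinLik s y) *
            (U.indicator 1 s * ψ (ones y)) := by
        rw [lintegral_finsetSum]
        exact fun y _ => (measurable_ofReal_coinLik y).mul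
          ((measurable_one.indicator hU).mul_const _)
    _ ≤ coinAverage h := by
        refine lintegral_mono fun s => Finset.sum_le_sum fun y _ => ?_
        gcongr
        by_cases hs : s ∈ U
        · rw [Set.indicator_of_mem hs, Pi.one_apply, one_mul]
          simp only [hψ]
          split_ifs with hy
          · exact hh s hs y hy
          · exact zero_le
        · rw [Set.indicator_of_notMem hs, zero_mul]
          exact zero_le

/-- With at most one 1 among the tosses, the posterior mean of the bias is at most 2/(8n+2) ≤ 1/8,
so s ≤ 1/4 has posterior probability at least 1/2. -/
theorem le_coinAverage_low (hn : 2 ≤ n) {φ : ℕ → ENNReal}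
    {h : unitInterval → (Fin n → Fin 8 → Fin 2) → ENNReal}
    (hφ : ENNReal.ofReal (1 / 4) ≤ φ 0 + φ 1)
    (hh : ∀ s : unitInterval, (s : ℝ) ≤ 1 / 4 → ∀ y, ones y ≤ 1 → φ (ones y) ≤ h s y) :
    ENNReal.ofReal (1 / (8 * (8 * n + 1))) ≤ coinAverage h := by
  have hn' : (2 : ℝ) ≤ n := by exact_mod_cast hn
  refine le_coinAverage (U := {s : unitInterval | (s : ℝ) ≤ 1 / 4})
    (measurableSet_le measurable_subtype_coe measurable_const) (D := {0, 1}) (φ := φ) ?_ ?_ ?_ ?_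
  · intro N hN
    simp only [Finset.mem_insert, Finset.mem_singleton] at hN
    exact Finset.mem_range.2 (by omega)
  · intro y hy
    simp only [Finset.mem_insert, Finset.mem_singleton] at hy
    have hy' : (ones y : ℝ) ≤ 1 := by exact_mod_cast (show ones y ≤ 1 by omega)
    refine le_trans ?_ (le_lintegral_indicator_low y)
    gcongr
    have : (ones y + 1) / (8 * n + 2 : ℝ) ≤ 1 / 8 := by
      rw [div_le_div_iff₀ (by positivity) (by norm_num)]
      linarith
    linarith
  · simpa using hφ
  · intro s hs y hy
    simp only [Finset.mem_insert, Finset.mem_singleton] at hy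
    exact hh s hs y (by omega)

theorem le_coinAverage_high (hn : 2 ≤ n) {φ : ℕ → ENNReal}
    {h : unitInterval → (Fin n → Fin 8 → Fin 2) → ENNReal}
    (hφ : ENNReal.ofReal (1 / 4) ≤ φ (8 * n - 1) + φ (8 * n))
    (hh : ∀ s : unitInterval, 3 / 4 ≤ (s : ℝ) → ∀ y, 8 * n ≤ ones y + 1 → φ (ones y) ≤ h s y) :
    ENNReal.ofReal (1 / (8 * (8 * n + 1))) ≤ coinAverage h := by
  have hn' : (2 : ℝ) ≤ n := by exact_mod_cast hn
  refine le_coinAverage (U := {s : unitInterval | 3 / 4 ≤ (s : ℝ)})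
    (measurableSet_le measurable_const measurable_subtype_coe) (D := {8 * n - 1, 8 * n}) (φ := φ)
    ?_ ?_ ?_ ?_
  · intro N hN
    simp only [Finset.mem_insert, Finset.mem_singleton] at hN
    exact Finset.mem_range.2 (by omega)
  · intro y hy
    simp only [Finset.mem_insert, Finset.mem_singleton] at hy
    have hy' : (8 * n : ℝ) ≤ ones y + 1 := by exact_mod_cast (show 8 * n ≤ ones y + 1 by omega)
    refine le_trans ?_ (le_lintegral_indicator_high y)
    gcongr
    have : (8 * n - ones y + 1) / (8 * n + 2 : ℝ) ≤ 1 / 8 := by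
      rw [div_le_div_iff₀ (by positivity) (by norm_num)]
      linarith
    linarith
  · rwa [Finset.sum_pair (by omega)]
  · intro s hs y hy
    simp only [Finset.mem_insert, Finset.mem_singleton] at hy
    exact hh s hs y (by omega)

end CoinAverages

/-! ### The strategy of the analyst -/

section Learning

/-- Hoeffding's inequality for functions of distinct coordinates of a product measure. -/
theorem measure_pi_sum_sub_integral_ge_le {Q Z : Type*} [Fintype Q] [Fintype Z]
    (ν : Q → Measure ℝ) [∀ q, IsProbabilityMeasure (ν q)] {q : Z → Q}
    (hq : Function.Injective q) {f : Z → ℝ → ℝ} (hf : ∀ z, Measurable (f z)) {lo : Z → ℝ}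
    (hlo : ∀ z x, f z x ∈ Set.Icc (lo z) (lo z + 1)) {r : ℝ} (hr : 0 ≤ r) :
    (Measure.pi ν).real {a | r ≤ ∑ z, (f z (a (q z)) - ∫ x, f z x ∂(ν (q z)))} ≤
      Real.exp (-(2 * r ^ 2 / Fintype.card Z)) := by
  have hind : ProbabilityTheory.iIndepFun
      (fun z (a : Q → ℝ) => f z (a (q z)) - ∫ x, f z x ∂(ν (q z))) (Measure.pi ν) :=
    ((ProbabilityTheory.iIndepFun_pi (μ := ν) (X := fun _ x => x)
      fun _ => aemeasurable_id).precomp hq).comp (fun z x => f z x - ∫ x, f z x ∂(ν (q z)))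
      fun z => (hf z).sub_const _
  have hsub : ∀ z ∈ (Finset.univ : Finset Z), ProbabilityTheory.HasSubgaussianMGF
      (fun a : Q → ℝ => f z (a (q z)) - ∫ x, f z x ∂(ν (q z))) (1 / 4) (Measure.pi ν) := by
    intro z _
    have h := ProbabilityTheory.hasSubgaussianMGF_of_mem_Icc (μ := Measure.pi ν)
      (X := fun a : Q → ℝ => f z (a (q z))) (a := lo z) (b := lo z + 1)
      ((hf z).comp (measurable_pi_apply _)).aemeasurable (ae_of_all _ fun a => hlo z _)
    rw [integral_comp_eval (hf z).aestronglyMeasurable] at h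
    convert h using 1
    simp
    norm_num
  refine (ProbabilityTheory.HasSubgaussianMGF.measure_sum_ge_le_of_iIndepFun hind hsub hr).trans
    (le_of_eq ?_)
  congr 1
  simp only [Finset.sum_const, Finset.card_univ, nsmul_eq_mul]
  push_cast
  rw [neg_div]
  congr 1
  rcases eq_or_ne (Fintype.card Z : ℝ) 0 with h0 | h0
  · simp [h0]
  · field_simp
    ring

variable {ι : Type*} [Fintype ι] {m N T : ℕ}
  (idx : Fin N ≃ Fin m × ι × ZMod 2 × Fin T)

/-- How much more often the answers to the queries for `bit = 1` are large than the answers to the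
queries for `bit = 0`. -/
def score (u : Fin N → Bool) (j : Fin m) (i : ι) : ℝ :=
  ∑ τ, ((if u (idx.symm (j, i, 1, τ)) then 1 else 0) -
    (if u (idx.symm (j, i, 0, τ)) then 1 else 0))

/-- Which of the answers are large. -/
def bits (a : Fin N → ℝ) : Fin N → Bool := fun q => decide (1 / 6 < a q)

/-- A codeword that agrees with all the bits for which the scores give a clear answer. -/
def guess (C : Submodule (ZMod 2) (ι → ZMod 2)) (θ : ℝ) (u : Fin N → Bool) (j : Fin m) :
    ι → ZMod 2 :=
  open Classical in
  if h : ∃ w ∈ C, ∀ i, (θ ≤ score idx u j i → w i = 1) ∧ (score idx u j i ≤ -θ → w i = 0)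
  -- The default is irrelevant for the analysis: when the scores are close to their means, the true
  -- codeword is a witness.
  then h.choose else 0

theorem guess_spec {C : Submodule (ZMod 2) (ι → ZMod 2)} {θ : ℝ} {u : Fin N → Bool} {j : Fin m}
    (h : ∃ w ∈ C, ∀ i, (θ ≤ score idx u j i → w i = 1) ∧ (score idx u j i ≤ -θ → w i = 0)) :
    guess idx C θ u j ∈ C ∧ ∀ i, (θ ≤ score idx u j i → guess idx C θ u j i = 1) ∧
      (score idx u j i ≤ -θ → guess idx C θ u j i = 0) := by
  rw [guess, dif_pos h]
  exact h.choose_spec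

theorem measurable_bits : Measurable (bits (N := N)) := by
  refine measurable_pi_lambda _ fun q => ?_
  refine measurable_to_bool ?_
  have : (fun a : Fin N → ℝ => bits a q) ⁻¹' {true} = {a | 1 / 6 < a q} := by
    ext a; simp [bits]
  rw [this]
  exact measurableSet_lt measurable_const (measurable_pi_apply q)

/-- The analyst first asks all the queries that hide the bits of the codewords behind coins. Then
he asks, for each of the codewords, whether it is the one which he has guessed. -/
def challengeStrategy [Nonempty ι] (C : Submodule (ZMod 2) (ι → ZMod 2)) (k : ℕ) (α β θ : ℝ)
    (coinOf : ι × ZMod 2 × Fin T → Fin (k - 1)) : Strategy (ChallengeUniverse ι k m) where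
  query t h :=
    if ht : t < N then
      learnQuery α β (idx ⟨t, ht⟩).1 (idx ⟨t, ht⟩).2.1 (idx ⟨t, ht⟩).2.2.1 (coinOf (idx ⟨t, ht⟩).2)
    else if ht' : t - N < m then
      agreeQuery ⟨t - N, ht'⟩
        (guess idx C θ (bits fun q => h ⟨q, q.2.trans_le (not_lt.1 ht)⟩) ⟨t - N, ht'⟩)
    -- Rounds after the first `N + m` are never played.
    else fun _ => 0
  measurableSet_query t A := by
    split_ifs with h1 h2
    · exact MeasurableSet.const _
    -- The query depends on the real answers only through a vector of bits, for which there are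
    -- finitely many possibilities.
    · have hm : Measurable fun h : Fin t → ℝ =>
          bits fun q : Fin N => h ⟨q, q.2.trans_le (not_lt.1 h1)⟩ :=
        measurable_bits.comp (measurable_pi_lambda _ fun q => measurable_pi_apply _)
      exact hm (Set.toFinite ((fun u => agreeQuery ⟨t - N, h2⟩
        (guess idx C θ u ⟨t - N, h2⟩)) ⁻¹' A)).measurableSet
    · exact MeasurableSet.const _

/-- The scores are close to their means. -/
theorem measure_pi_score_deviation_le (ν : Fin N → Measure ℝ) [∀ q, IsProbabilityMeasure (ν q)]
    (j : Fin m) (p : ι → ZMod 2 → ℝ)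
    (hp : ∀ i e τ, (ν (idx.symm (j, i, e, τ))).real (Set.Ioi (1 / 6)) = p i e)
    {R : ℝ} (hR : 0 < R) :
    (Measure.pi ν).real {a | ∃ i, T / R / 2 ≤ |score idx (bits a) j i - T * (p i 1 - p i 0)|} ≤
      Fintype.card ι * (2 * Real.exp (-(T / (4 * R ^ 2)))) := by
  -- Hoeffding's inequality for 2T signed indicators, with exponent 2(T/(2R))²/(2T) = T/(4R²); the
  -- two values of σ are the two tails.
  have key : ∀ (i : ι) (σ : ℝ), σ = 1 ∨ σ = -1 →
      (Measure.pi ν).real {a | T / R / 2 ≤ σ * (score idx (bits a) j i - T * (p i 1 - p i 0))} ≤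
        Real.exp (-(T / (4 * R ^ 2))) := by
    intro i σ hσ
    let sg : ZMod 2 × Fin T → ℝ := fun z => if z.1 = 1 then σ else -σ
    let ind : ℝ → ℝ := (Set.Ioi (1 / 6)).indicator 1
    have hind : Measurable ind := measurable_one.indicator measurableSet_Ioi
    have hq : Function.Injective fun z : ZMod 2 × Fin T => idx.symm (j, i, z.1, z.2) := by
      intro z z' h
      have := idx.symm.injective h
      simp only [Prod.mk.injEq, true_and] at this
      exact Prod.ext this.1 this.2
    -- The choice of `lo` gives the range [0, 1] for the sign 1 and [-1, 0] for the sign -1.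
    have h := measure_pi_sum_sub_integral_ge_le ν hq (f := fun z x => sg z * ind x)
      (fun z => hind.const_mul _) (lo := fun z => (sg z - 1) / 2) ?_ (r := T / R / 2)
      (by positivity)
    · convert h using 2
      · congr 1
        ext a
        have e1 : ∀ z : ZMod 2 × Fin T, ∫ x, sg z * ind x ∂(ν (idx.symm (j, i, z.1, z.2))) =
            sg z * p i z.1 := by
          intro z
          rw [integral_const_mul, integral_indicator_one measurableSet_Ioi, hp]
        have e2 : ∀ q, ind (a q) = if bits a q then 1 else 0 := by
          intro q
          by_cases hx : 1 / 6 < a q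
          · rw [show ind (a q) = 1 from Set.indicator_of_mem hx 1,
              show bits a q = true from decide_eq_true hx, if_pos rfl]
          · rw [show ind (a q) = 0 from Set.indicator_of_notMem hx 1,
              show bits a q = false from decide_eq_false hx]
            simp
        simp only [e1, e2]
        have e3 : σ * (score idx (bits a) j i - T * (p i 1 - p i 0)) =
            ∑ z : ZMod 2 × Fin T, (sg z * (if bits a (idx.symm (j, i, z.1, z.2)) then 1 else 0) -
              sg z * p i z.1) := by
          rw [Fintype.sum_prod_type, show (Finset.univ : Finset (ZMod 2)) = {1, 0} by decide,
            Finset.sum_pair (by decide)]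
          simp only [sg, if_true, show (0 : ZMod 2) ≠ 1 by decide, if_false, score,
            Finset.sum_sub_distrib, Finset.sum_const, Finset.card_univ, Fintype.card_fin,
            nsmul_eq_mul, ← Finset.mul_sum]
          ring
        rw [e3]
      · simp only [Fintype.card_prod, ZMod.card, Fintype.card_fin]
        push_cast
        rcases eq_or_ne (T : ℝ) 0 with h0 | h0
        · simp [h0]
        · field_simp
          norm_num
    · intro z x
      have hx : ind x = 0 ∨ ind x = 1 := by
        by_cases hx : x ∈ Set.Ioi (1 / 6 : ℝ)
        · right; exact Set.indicator_of_mem hx 1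
        · left; exact Set.indicator_of_notMem hx 1
      have hs : sg z = 1 ∨ sg z = -1 := by
        simp only [sg]
        rcases hσ with rfl | rfl <;> split_ifs <;> simp
      rcases hx with hx | hx <;> rcases hs with hs | hs <;> rw [hx, hs] <;> constructor <;> norm_num
  have hsub : {a | ∃ i, T / R / 2 ≤ |score idx (bits a) j i - T * (p i 1 - p i 0)|} ⊆
      ⋃ i, ({a | T / R / 2 ≤ 1 * (score idx (bits a) j i - T * (p i 1 - p i 0))} ∪
        {a | T / R / 2 ≤ -1 * (score idx (bits a) j i - T * (p i 1 - p i 0))}) := by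
    rintro a ⟨i, hi⟩
    refine Set.mem_iUnion.2 ⟨i, ?_⟩
    rcases le_abs.1 hi with h | h
    · left; simpa using h
    · right; simpa using h
  refine (measureReal_mono hsub).trans ((measureReal_iUnion_fintype_le _).trans ?_)
  rw [← nsmul_eq_mul, ← Finset.card_univ, ← Finset.sum_const]
  refine Finset.sum_le_sum fun i _ => (measureReal_union_le _ _).trans ?_
  rw [two_mul]
  exact add_le_add (key i 1 (Or.inl rfl)) (key i (-1) (Or.inr rfl))

end Learning

/-! ### The game with fixed codewords and fixed positions of the samples -/

section FixedCodewords

variable {ι : Type*} [Fintype ι] [Nonempty ι] {C : Submodule (ZMod 2) (ι → ZMod 2)}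
  {k m n N T : ℕ} (idx : Fin N ≃ Fin m × ι × ZMod 2 × Fin T)
  (coinOf : ι × ZMod 2 × Fin T → Fin (k - 1)) (g : MeanCurator)

/-- The weight of a bit in a query, which makes the bit shift the posterior mean by exactly as much
as two further ones among the tosses of the coin. -/
def signal (ι : Type*) [Fintype ι] (n : ℕ) : ℝ := 2 * Fintype.card ι / (3 * (8 * n + 2))

theorem signal_nonneg : 0 ≤ signal ι n := by unfold signal; positivity

/-- The eight tosses per sample are needed here: they make the required weight of the bit small
enough for a query with values in [0, 1]. -/
theorem signal_le (hn : Fintype.card ι ≤ 8 * n) : 1 / 3 + signal ι n ≤ 1 := by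
  have : (Fintype.card ι : ℝ) ≤ 8 * n := by exact_mod_cast hn
  have h : signal ι n ≤ 2 / 3 := by
    rw [signal, div_le_div_iff₀ (by positivity) (by norm_num)]
    linarith
  linarith

variable (C n) in
/-- The strategy of the analyst, with the parameters for `n` samples. -/
abbrev analyst : Strategy (ChallengeUniverse ι k m) :=
  challengeStrategy idx C k (1 / 3) (signal ι n) (T / (8 * n + 1)) coinOf

variable (k n) in
/-- The query about the codeword, bit, and coin of the index `q`. -/
def indexQuery (q : Fin N) : ChallengeUniverse ι k m → unitInterval :=
  learnQuery (1 / 3) (signal ι n) (idx q).1 (idx q).2.1 (idx q).2.2.1 (coinOf (idx q).2)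

theorem analyst_query_of_lt {t : ℕ} (ht : t < N) (h : Fin t → ℝ) :
    (analyst C n idx coinOf).query t h = indexQuery k n idx coinOf ⟨t, ht⟩ := by
  simp only [analyst, challengeStrategy, dif_pos ht, indexQuery]

theorem analyst_query_add (j : Fin m) (h : Fin (N + j) → ℝ) :
    (analyst C n idx coinOf).query (N + j) h = agreeQuery j
      (guess idx C (T / (8 * n + 1)) (bits fun q => h ⟨q, q.2.trans_le (Nat.le_add_right _ _)⟩) j) := by
  have h1 : ¬ N + (j : ℕ) < N := by omega
  have h2 : N + (j : ℕ) - N = j := by omega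
  have h3 : (⟨N + (j : ℕ) - N, by omega⟩ : Fin m) = j := Fin.ext h2
  simp only [analyst, challengeStrategy, dif_neg h1]
  rw [dif_pos (by omega)]
  rw [h3]

/-- The position of the coin of the query with the index `q`. -/
def coinPos (q : Fin N) : Fin m × Fin (k - 1) := ((idx q).1, coinOf (idx q).2)

theorem coinPos_injective (hc : Function.Injective coinOf) :
    Function.Injective (coinPos idx coinOf) := by
  intro q q' h
  have h' := Prod.ext_iff.1 h
  exact idx.injective (Prod.ext h'.1 (hc h'.2))

variable (c : Fin m → C) (I : Fin m → Fin n → ι)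

/-- The law of the answer to the query with the index `q` in the case of `x` ones. -/
def indexLaw (q : Fin N) (x : ℕ) : Measure ℝ :=
  g (queryPrior (challengeModel C k m) (indexQuery k n idx coinOf q))
    (1 / 3 * ((x + 1) / (8 * n + 2)) + signal ι n * bayesMean (codeModel C)
      (fun r => (I (idx q).1 r, (c (idx q).1 : ι → ZMod 2) (I (idx q).1 r)))
      (bitInd (idx q).2.1 (idx q).2.2.1))

instance (q : Fin N) (x : ℕ) : IsProbabilityMeasure (indexLaw idx coinOf g c I q x) := by
  unfold indexLaw; infer_instance

/-- The codewords, as words. -/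
abbrev words (c : Fin m → C) : Fin m → ι → ZMod 2 := fun j => c j

/-- The first `N` queries are fixed in advance, so given the samples their answers are independent.
-/
theorem transcript_learning (hn : Fintype.card ι ≤ 8 * n)
    (y : Fin m → Fin (k - 1) → Fin n → Fin 8 → Fin 2) :
    transcript (challengeModel C k m) g (analyst C n idx coinOf) (sample (words c) I y) N =
      Measure.pi fun q => indexLaw idx coinOf g c I q
        (ones (y (coinPos idx coinOf q).1 (coinPos idx coinOf q).2)) := by
  rw [transcript_eq_pi _ g (analyst C n idx coinOf) _
    (fun t => if ht : t < N then indexQuery k n idx coinOf ⟨t, ht⟩ else fun _ => 0) N]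
  · congr 1
    funext q
    simp only [q.2, dif_pos, Fin.eta]
    rw [answerLaw, indexLaw]
    congr 2
    exact posteriorMean_learnQuery (by norm_num) signal_nonneg (signal_le hn) c I y _ _ _ _
  · intro t ht h
    rw [dif_pos ht, analyst_query_of_lt]

/-- The probability that some answer is inaccurate, with fixed codewords and positions. -/
def inaccuracy (ε : ℝ) : ENNReal :=
  ∫⁻ s : Fin m → Fin (k - 1) → unitInterval,
    ∑ y : Fin m → Fin (k - 1) → Fin n → Fin 8 → Fin 2, coinsWeight s y *
      transcript (challengeModel C k m) g (analyst C n idx coinOf) (sample (words c) I y) (N + m)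
        (inaccurate (analyst C n idx coinOf) (hypothesis (words c) s) (N + m) ε)

/-- The accurate answers to the query with the index `q`. -/
def accurateSet (ε : ℝ) (q : Fin N) (s : unitInterval) : Set ℝ :=
  {a | |(1 / 3 * (s : ℝ) + signal ι n * if (c (idx q).1 : ι → ZMod 2) (idx q).2.1 = (idx q).2.2.1
    then 1 / (Fintype.card ι : ℝ) else 0) - a| < ε}

theorem measurableSet_accurateSet (ε : ℝ) (q : Fin N) :
    MeasurableSet {z : unitInterval × ℝ | z.2 ∈ accurateSet (n := n) idx c ε q z.1} := by
  unfold accurateSet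
  exact measurableSet_lt (((((measurable_subtype_coe.comp measurable_fst).const_mul _).add_const
    _).sub measurable_snd).abs) measurable_const

/-- If every query from a group of `T` queries with distinct coins has a noticeable chance to be
answered inaccurately, then some answer is inaccurate. -/
theorem le_inaccuracy_of_group (hn : Fintype.card ι ≤ 8 * n) (hcoin : Function.Injective coinOf)
    {ε : ℝ} (j : Fin m) (i : ι) (e : ZMod 2)
    (hT : Real.exp (-(T / (8 * (8 * n + 1)))) ≤ 1 / 4)
    (hgroup : ∀ τ, ENNReal.ofReal (1 / (8 * (8 * n + 1))) ≤ coinAverage (n := n) fun s y =>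
      indexLaw idx coinOf g c I (idx.symm (j, i, e, τ)) (ones y)
        (accurateSet (n := n) idx c ε (idx.symm (j, i, e, τ)) s)ᶜ) :
    ENNReal.ofReal (3 / 4) ≤ inaccuracy idx coinOf g c I ε := by
  classical
  set grp : Finset (Fin N) := Finset.univ.image fun τ => idx.symm (j, i, e, τ) with hgrp
  have hcard : grp.card = T := by
    rw [hgrp, Finset.card_image_of_injective, Finset.card_univ, Fintype.card_fin]
    intro τ τ' h
    simpa using idx.symm.injective h
  -- Queries outside the group are left unconstrained, so that accuracy within the group becomes a
  -- box.
  set A : Fin N → unitInterval → Set ℝ := fun q s =>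
    if q ∈ grp then accurateSet (n := n) idx c ε q s else Set.univ with hA
  have hAm : ∀ q, MeasurableSet {z : unitInterval × ℝ | z.2 ∈ A q z.1} := by
    intro q
    simp only [hA]
    split_ifs
    · exact measurableSet_accurateSet idx c ε q
    · simp
  have hAs : ∀ q s, MeasurableSet (A q s) := fun q s => measurable_prodMk_left (hAm q)
  have hAmeas : ∀ q (y : Fin n → Fin 8 → Fin 2), Measurable fun s =>
      indexLaw idx coinOf g c I q (ones y) (A q s) := fun q y => measurable_measure_prodMk_left (hAm q)
  have hfactor : ∀ q, coinAverage (n := n) (fun s y => indexLaw idx coinOf g c I q (ones y) (A q s)) ≤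
      if q ∈ grp then ENNReal.ofReal (1 - 1 / (8 * (8 * n + 1))) else 1 := by
    intro q
    split_ifs with hq
    · have hadd : coinAverage (n := n) (fun s y => indexLaw idx coinOf g c I q (ones y) (A q s)) +
          coinAverage (n := n) (fun s y => indexLaw idx coinOf g c I q (ones y) (A q s)ᶜ) = 1 := by
        rw [← coinAverage_add (hAmeas q), ← coinAverage_one (n := n)]
        congr 1
        funext s y
        rw [measure_add_measure_compl (hAs q s), measure_univ]
      obtain ⟨τ, _, rfl⟩ := Finset.mem_image.1 hq
      have h := hgroup τ
      have hA' : ∀ s, accurateSet (n := n) idx c ε (idx.symm (j, i, e, τ)) s =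
          A (idx.symm (j, i, e, τ)) s := fun s => by simp only [hA, if_pos hq]
      simp only [hA'] at h
      rw [ENNReal.ofReal_sub _ (by positivity), ENNReal.ofReal_one, ← hadd]
      refine ENNReal.le_sub_of_add_le_right ENNReal.ofReal_ne_top ?_
      gcongr
    · simp only [hA, if_neg hq, measure_univ, coinAverage_one, le_refl]
  have hprod : ∏ q, coinAverage (n := n)
      (fun s y => indexLaw idx coinOf g c I q (ones y) (A q s)) ≤ ENNReal.ofReal (1 / 4) := by
    refine (Finset.prod_le_prod' fun q _ => hfactor q).trans ?_
    rw [Finset.prod_ite_mem, Finset.univ_inter, Finset.prod_const, hcard,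
      ← ENNReal.ofReal_pow]
    · refine ENNReal.ofReal_le_ofReal (le_trans ?_ hT)
      calc (1 - 1 / (8 * (8 * n + 1)) : ℝ) ^ T ≤ Real.exp (-(1 / (8 * (8 * n + 1)))) ^ T := by
            refine pow_le_pow_left₀ ?_ (Real.one_sub_le_exp_neg _) _
            rw [sub_nonneg, div_le_one (by positivity)]
            have : (0 : ℝ) ≤ n := by positivity
            linarith
        _ = _ := by
            rw [← Real.exp_nat_mul]
            congr 1
            ring
    · rw [sub_nonneg, div_le_one (by positivity)]
      have : (0 : ℝ) ≤ n := by positivity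
      linarith
  have hpos := coinPos_injective idx coinOf hcoin
  -- Either some answer is inaccurate, or the answers lie in the box; the average probability of the
  -- box factorizes over the coins.
  have hkey : 1 ≤ inaccuracy idx coinOf g c I ε + ∏ q, coinAverage (n := n)
      (fun s y => indexLaw idx coinOf g c I q (ones y) (A q s)) := by
    rw [← lintegral_sum_coinsWeight_mul_prod_comp (m := m) (K := k - 1) hpos (h := fun q s y =>
      indexLaw idx coinOf g c I q (ones y) (A q s)) hAmeas, inaccuracy, ← lintegral_add_right,
      ← lintegral_sum_coinsWeight (m := m) (K := k - 1) (n := n)]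
    · refine lintegral_mono fun s => ?_
      rw [← Finset.sum_add_distrib]
      refine Finset.sum_le_sum fun y _ => ?_
      rw [← mul_add]
      nth_rewrite 1 [← mul_one (coinsWeight s y)]
      gcongr
      set rect : Set (Fin N → ℝ) := Set.univ.pi fun q =>
        A q (s (coinPos idx coinOf q).1 (coinPos idx coinOf q).2) with hrect
      have hrm : MeasurableSet rect := MeasurableSet.univ_pi fun q => hAs q _
      have h1 := transcript_castLE (challengeModel C k m) g (analyst C n idx coinOf)
        (sample (words c) I y) (Nat.le_add_right N m) hrm
      rw [transcript_learning idx coinOf g c I hn y, hrect, Measure.pi_pi] at h1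
      rw [← h1, ← measure_univ (μ := transcript (challengeModel C k m) g (analyst C n idx coinOf)
        (sample (words c) I y) (N + m))]
      refine (measure_mono fun a _ => ?_).trans (measure_union_le _ _)
      by_cases ha : (fun q : Fin N => a (q.castLE (Nat.le_add_right N m))) ∈ rect
      · exact Or.inr ha
      · left
        rw [hrect, Set.mem_univ_pi] at ha
        push Not at ha
        obtain ⟨q, hq⟩ := ha
        have hqg : q ∈ grp := by
          by_contra hqg
          simp only [hA, if_neg hqg, Set.mem_univ, not_true] at hq
        refine ⟨q.castLE (Nat.le_add_right N m), ?_⟩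
        simp only [hA, if_pos hqg, accurateSet, Set.mem_ofPred_eq] at hq
        have hqq : ((q.castLE (Nat.le_add_right N m) : Fin (N + m)) : ℕ) < N := q.2
        rw [analyst_query_of_lt idx coinOf hqq, indexQuery, expect_learnQuery (by norm_num)
          signal_nonneg (signal_le hn)]
        exact hq
    · refine Finset.measurable_sum _ fun y _ => (measurable_coinsWeight y).mul
        (Finset.measurable_prod _ fun q _ => (hAmeas q _).comp ?_)
      exact (measurable_pi_apply _).comp (measurable_pi_apply _)
  have h34 : ENNReal.ofReal (3 / 4) + ENNReal.ofReal (1 / 4) = 1 := by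
    rw [← ENNReal.ofReal_add (by norm_num) (by norm_num)]
    norm_num
  rw [← h34] at hkey
  exact ENNReal.le_of_add_le_add_right ENNReal.ofReal_ne_top (hkey.trans (by gcongr))

end FixedCodewords

/-! ### A block whose samples leave exactly two codewords possible. -/

section CriticalBlock

variable {ι : Type*} [Fintype ι] [Nonempty ι] {C : Submodule (ZMod 2) (ι → ZMod 2)}
  {k m n N T : ℕ} (idx : Fin N ≃ Fin m × ι × ZMod 2 × Fin T)
  (coinOf : ι × ZMod 2 × Fin T → Fin (k - 1)) (g : MeanCurator)

variable (C n) in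
/-- The law of the answer to a query for the `i`-th bit of the `j`-th codeword, when the posterior
mean is as if there were `x` ones, and the bit were known to be absent. -/
def curatorLaw (τ₀ : Fin T) (j : Fin m) (i : ι) (x : ℕ) : Measure ℝ :=
  g (queryPrior (challengeModel C k m)
    (learnQuery (1 / 3) (signal ι n) j i 0 (coinOf (i, 0, τ₀)))) (1 / 3 * ((x + 1) / (8 * n + 2)))

instance (τ₀ : Fin T) (j : Fin m) (i : ι) (x : ℕ) :
    IsProbabilityMeasure (curatorLaw C n coinOf g τ₀ j i x) := by
  unfold curatorLaw; infer_instance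

variable (c : Fin m → C) (I : Fin m → Fin n → ι) {j : Fin m} {d : ι → ZMod 2}

/-- The posterior of the block is uniform on `c j` and `c j + d`. Each of them with the value `e` at
`i` adds 1/(2m) to the posterior mean of the indicator, and `signal` times 1/(2m) is 1/3 times
1/(8n+2), the effect of one further 1. -/
theorem indexLaw_eq (hn : Fintype.card ι ≤ 8 * n) (hC : ∀ i, ∃ d ∈ C, d i = 1) (hd0 : d ≠ 0)
    (hd : vanishing C (I j) = {0, d}) (τ₀ τ : Fin T) (i : ι) (e : ZMod 2) (x : ℕ) :
    indexLaw idx coinOf g c I (idx.symm (j, i, e, τ)) x =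
      curatorLaw C n coinOf g τ₀ j i (x + ((if (c j : ι → ZMod 2) i = e then 1 else 0) +
        (if (c j : ι → ZMod 2) i + d i = e then 1 else 0))) := by
  have hι : (Fintype.card ι : ℝ) ≠ 0 := by exact_mod_cast Fintype.card_ne_zero
  rw [indexLaw, curatorLaw, indexQuery]
  simp only [Equiv.apply_symm_apply]
  have hq := queryPrior_learnQuery (k := k) (m := m) (by norm_num) signal_nonneg (signal_le hn) hC j
    i e 0 (coinOf (i, e, τ)) (coinOf (i, 0, τ₀))
  rw [hq]
  congr 2
  · rw [bayesMean_codeModel (c j).2, hd, Finset.sum_pair hd0.symm, Finset.card_pair hd0.symm,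
      mean_bitInd, mean_bitInd, signal]
    simp only [Pi.add_apply, Pi.zero_apply, add_zero]
    push_cast
    split_ifs <;> field_simp <;> ring

theorem sum_range_add_two_sub (x : ℕ → ℝ) (B : ℕ) :
    ∑ N ∈ Finset.range (B + 1), x (N + 2) - ∑ N ∈ Finset.range (B + 1), x N =
      x (B + 1) + x (B + 2) - x 0 - x 1 := by
  induction B with
  | zero => simp; ring
  | succ B ih =>
    rw [Finset.sum_range_succ _ (B + 1), Finset.sum_range_succ _ (B + 1)]
    have : B + 1 + 2 = B + 3 := rfl
    linarith

/-- A curator who answers the queries with few ones by large numbers, or those with many ones by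
small numbers, is inaccurate. -/
theorem le_inaccuracy_of_misplaced (hn : Fintype.card ι ≤ 8 * n) (hn2 : 2 ≤ n)
    (hcoin : Function.Injective coinOf) (hC : ∀ i, ∃ d ∈ C, d i = 1) (hd0 : d ≠ 0)
    (hd : vanishing C (I j) = {0, d}) (τ₀ : Fin T)
    (hT : Real.exp (-(T / (8 * (8 * n + 1)))) ≤ 1 / 4) {i : ι} (hi : d i = 0)
    (h : 1 / 4 ≤ (curatorLaw C n coinOf g τ₀ j i 0).real (Set.Ioi (1 / 6)) +
        (curatorLaw C n coinOf g τ₀ j i 1).real (Set.Ioi (1 / 6)) ∨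
      1 / 4 ≤ (curatorLaw C n coinOf g τ₀ j i (8 * n + 1)).real (Set.Iic (1 / 6)) +
        (curatorLaw C n coinOf g τ₀ j i (8 * n + 2)).real (Set.Iic (1 / 6))) :
    ENNReal.ofReal (3 / 4) ≤ inaccuracy idx coinOf g c I (1 / 256) := by
  rcases h with h | h
  -- The wrong bit value gives the shift 0. The counts 0 and 1 then mean s ≤ 1/4 with posterior
  -- probability at least 1/2, and in that case the true answer is at most 1/12.
  · refine le_inaccuracy_of_group idx coinOf g c I hn hcoin j i ((c j : ι → ZMod 2) i + 1) hT
      fun τ => ?_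
    refine le_coinAverage_low hn2
      (φ := fun x => curatorLaw C n coinOf g τ₀ j i x (Set.Ioi (1 / 6))) ?_ ?_
    · rw [← ofReal_measureReal, ← ofReal_measureReal, ← ENNReal.ofReal_add (by positivity)
        (by positivity)]
      exact ENNReal.ofReal_le_ofReal h
    · intro s hs y _
      have hne : (c j : ι → ZMod 2) i ≠ (c j : ι → ZMod 2) i + 1 := by simp
      rw [indexLaw_eq idx coinOf g c I hn hC hd0 hd τ₀, hi, add_zero, if_neg hne]
      refine measure_mono fun a ha => ?_
      simp only [accurateSet, Equiv.apply_symm_apply, if_neg hne, Set.mem_compl_iff,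
        Set.mem_ofPred_eq, not_lt, Set.mem_Ioi] at ha ⊢
      rw [abs_sub_comm]
      refine le_trans ?_ (le_abs_self _)
      linarith
  -- The right bit value gives the shift 2, so the counts 8n+1 and 8n+2 come from 8n-1 and 8n ones.
  -- If s ≥ 3/4, the true answer is at least 1/4.
  · refine le_inaccuracy_of_group idx coinOf g c I hn hcoin j i ((c j : ι → ZMod 2) i) hT
      fun τ => ?_
    refine le_coinAverage_high hn2
      (φ := fun x => curatorLaw C n coinOf g τ₀ j i (x + 2) (Set.Iic (1 / 6))) ?_ ?_
    · rw [show 8 * n - 1 + 2 = 8 * n + 1 by omega, ← ofReal_measureReal, ← ofReal_measureReal,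
        ← ENNReal.ofReal_add (by positivity) (by positivity)]
      exact ENNReal.ofReal_le_ofReal h
    · intro s hs y _
      rw [indexLaw_eq idx coinOf g c I hn hC hd0 hd τ₀, hi, add_zero, if_pos rfl]
      refine measure_mono fun a ha => ?_
      simp only [accurateSet, Equiv.apply_symm_apply, if_true, Set.mem_compl_iff,
        Set.mem_ofPred_eq, not_lt, Set.mem_Iic] at ha ⊢
      refine le_trans ?_ (le_abs_self _)
      have : 0 ≤ signal ι n * (1 / (Fintype.card ι : ℝ)) := mul_nonneg signal_nonneg (by positivity)
      linarith

/-- Where `d` is 1, exactly one of the two codewords has the value `e`. The shift is then 1 for both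
values of `e`, and the score has mean 0. -/
theorem zmod_two_indicator_add :
    ∀ a e : ZMod 2, ((if a = e then 1 else 0) + (if a + 1 = e then 1 else 0) : ℕ) = 1 := by
  decide

/-- If the curator is not obviously inaccurate, then the analyst finds one of the two codewords that
are consistent with the samples. -/
theorem le_measure_pi_guess (hn : Fintype.card ι ≤ 8 * n) (hC : ∀ i, ∃ d ∈ C, d i = 1)
    (hd0 : d ≠ 0) (hd : vanishing C (I j) = {0, d}) (τ₀ : Fin T)
    (hT : Fintype.card ι * (2 * Real.exp (-(T / (4 * (8 * n + 1 : ℝ) ^ 2)))) ≤ 1 / 2)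
    (h : ∀ i, d i = 0 →
      (curatorLaw C n coinOf g τ₀ j i 0).real (Set.Ioi (1 / 6)) +
        (curatorLaw C n coinOf g τ₀ j i 1).real (Set.Ioi (1 / 6)) < 1 / 4 ∧
      (curatorLaw C n coinOf g τ₀ j i (8 * n + 1)).real (Set.Iic (1 / 6)) +
        (curatorLaw C n coinOf g τ₀ j i (8 * n + 2)).real (Set.Iic (1 / 6)) < 1 / 4) :
    ENNReal.ofReal (1 / 2) ≤ Measure.pi (fun q => mixedLaw n (indexLaw idx coinOf g c I q))
      {b | guess idx C (T / (8 * n + 1)) (bits b) j = c j ∨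
        guess idx C (T / (8 * n + 1)) (bits b) j = c j + d} := by
  set R : ℝ := 8 * n + 1 with hR
  have hRpos : 0 < R := by positivity
  have hTpos : (0 : ℝ) < T := by exact_mod_cast τ₀.pos
  -- The mean of a score has absolute value at least 3θ/2 where the two codewords agree, and is 0
  -- elsewhere. Deviations below θ/2 are therefore harmless for the threshold θ.
  set θ : ℝ := T / R with hθ
  have hθpos : 0 < θ := by positivity
  set x : ι → ℕ → ℝ := fun i N => (curatorLaw C n coinOf g τ₀ j i N).real (Set.Ioi (1 / 6)) with hx
  set κ : ι → ZMod 2 → ℕ := fun i e => (if (c j : ι → ZMod 2) i = e then 1 else 0) +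
        (if (c j : ι → ZMod 2) i + d i = e then 1 else 0) with hκ
  set p : ι → ZMod 2 → ℝ := fun i e => 1 / R * ∑ N ∈ Finset.range (8 * n + 1), x i (N + κ i e)
    with hp
  have hpe : ∀ i e τ, (mixedLaw n (indexLaw idx coinOf g c I (idx.symm (j, i, e, τ)))).real
      (Set.Ioi (1 / 6)) = p i e := by
    intro i e τ
    rw [measureReal_def, mixedLaw_apply, ENNReal.toReal_mul, ENNReal.toReal_ofReal (by positivity),
      ENNReal.toReal_sum fun _ _ => measure_ne_top _ _]
    simp only [hp, hx, hκ]
    congr 1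
    refine Finset.sum_congr rfl fun N _ => ?_
    rw [indexLaw_eq idx coinOf g c I hn hC hd0 hd τ₀]
    rfl
  have hdev := measure_pi_score_deviation_le idx
    (fun q => mixedLaw n (indexLaw idx coinOf g c I q)) j p hpe hRpos
  set D : Set (Fin N → ℝ) := {a | ∃ i, T / R / 2 ≤ |score idx (bits a) j i - T * (p i 1 - p i 0)|}
    with hD
  have hgap : ∀ i, d i = 0 → 3 / 2 * θ ≤
      T * (1 / R * (∑ N ∈ Finset.range (8 * n + 1), x i (N + 2) -
        ∑ N ∈ Finset.range (8 * n + 1), x i N)) := by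
    intro i hi
    have hcompl : ∀ N, (curatorLaw C n coinOf g τ₀ j i N).real (Set.Iic (1 / 6)) = 1 - x i N := by
      intro N
      rw [← Set.compl_Ioi, measureReal_compl measurableSet_Ioi, probReal_univ]
    have h' := h i hi
    rw [hcompl, hcompl] at h'
    rw [sum_range_add_two_sub]
    -- The lower boundary terms sum to less than 1/4, the upper ones to more than 2 - 1/4.
    have h3 : (3 / 2 : ℝ) ≤ x i (8 * n + 1) + x i (8 * n + 2) - x i 0 - x i 1 := by
      have := h'.1
      simp only [hx] at this h' ⊢
      linarith [h'.2]
    rw [hθ]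
    calc 3 / 2 * (T / R) = T * (1 / R * (3 / 2)) := by ring
      _ ≤ _ := by gcongr
  have hclear : ∀ a ∉ D, ∀ i,
      (d i = 0 → (c j : ι → ZMod 2) i = 1 → θ ≤ score idx (bits a) j i) ∧
      (d i = 0 → (c j : ι → ZMod 2) i = 0 → score idx (bits a) j i ≤ -θ) ∧
      (d i ≠ 0 → |score idx (bits a) j i| < θ) := by
    intro a ha i
    simp only [hD, Set.mem_ofPred_eq, not_exists, not_le] at ha
    have hai := ha i
    refine ⟨fun hi hc => ?_, fun hi hc => ?_, fun hi => ?_⟩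
    · have h1 : κ i 1 = 2 := by simp [hκ, hi, hc]
      have h0 : κ i 0 = 0 := by simp [hκ, hi, hc]
      have hg := hgap i hi
      simp only [hp, h1, h0, add_zero, ← mul_sub] at hai
      rw [abs_lt] at hai
      linarith [hai.1]
    · have h1 : κ i 1 = 0 := by simp [hκ, hi, hc]
      have h0 : κ i 0 = 2 := by simp [hκ, hi, hc]
      have hg := hgap i hi
      simp only [hp, h1, h0, add_zero, ← mul_sub] at hai
      rw [abs_lt] at hai
      have hneg : ∀ A B : ℝ, (T : ℝ) * (1 / R * (A - B)) = -(T * (1 / R * (B - A))) :=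
        fun A B => by ring
      rw [hneg] at hai
      linarith [hai.2]
    · have hd1 : d i = 1 := (zmod_two_eq (d i)).resolve_left hi
      have hk : ∀ e, κ i e = 1 := by
        intro e
        simp only [hκ, hd1]
        exact zmod_two_indicator_add _ _
      simp only [hp, hk, sub_self, mul_zero, sub_zero] at hai
      linarith
  have hsub : Dᶜ ⊆ {b | guess idx C θ (bits b) j = c j ∨ guess idx C θ (bits b) j = c j + d} := by
    intro a ha
    have hcl := hclear a ha
    have hcons : ∀ i, (θ ≤ score idx (bits a) j i → (c j : ι → ZMod 2) i = 1) ∧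
        (score idx (bits a) j i ≤ -θ → (c j : ι → ZMod 2) i = 0) := by
      intro i
      obtain ⟨h1, h2, h3⟩ := hcl i
      by_cases hi : d i = 0
      · rcases zmod_two_eq ((c j : ι → ZMod 2) i) with h' | h'
        · exact ⟨fun hs => absurd (h2 hi h') (by linarith), fun _ => h'⟩
        · exact ⟨fun _ => h', fun hs => absurd (h1 hi h') (by linarith)⟩
      · have := abs_lt.1 (h3 hi)
        exact ⟨fun hs => absurd this.2 (by linarith), fun hs => absurd this.1 (by linarith)⟩
    obtain ⟨hw, hspec⟩ := guess_spec idx ⟨(c j : ι → ZMod 2), (c j).2, hcons⟩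
    have hdv : d ∈ vanishing C (I j) := by rw [hd]; simp
    -- At a sampled coordinate the two codewords agree, so the score is clear there and the guess
    -- has the true bit.
    have hv : guess idx C θ (bits a) j - c j ∈ vanishing C (I j) := by
      refine mem_vanishing.2 ⟨C.sub_mem hw (c j).2, fun r => ?_⟩
      have hi : d (I j r) = 0 := (mem_vanishing.1 hdv).2 r
      obtain ⟨h1, h2, _⟩ := hcl (I j r)
      rw [Pi.sub_apply, sub_eq_zero]
      rcases zmod_two_eq ((c j : ι → ZMod 2) (I j r)) with h' | h'
      · rw [h', (hspec _).2 (h2 hi h')]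
      · rw [h', (hspec _).1 (h1 hi h')]
    rw [hd, Finset.mem_insert, Finset.mem_singleton, sub_eq_zero, sub_eq_iff_eq_add'] at hv
    exact hv
  have hreal : 1 / 2 ≤ (Measure.pi (fun q => mixedLaw n (indexLaw idx coinOf g c I q))).real
      {b | guess idx C θ (bits b) j = c j ∨ guess idx C θ (bits b) j = c j + d} := by
    have h1 : (1 : ℝ) ≤ (Measure.pi (fun q => mixedLaw n (indexLaw idx coinOf g c I q))).real D +
        (Measure.pi (fun q => mixedLaw n (indexLaw idx coinOf g c I q))).real Dᶜ := by
      rw [← probReal_univ (μ := Measure.pi (fun q => mixedLaw n (indexLaw idx coinOf g c I q))),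
        ← Set.union_compl_self D]
      exact measureReal_union_le _ _
    have h2 := measureReal_mono (μ := Measure.pi (fun q => mixedLaw n (indexLaw idx coinOf g c I q)))
      hsub
    linarith [hdev.trans hT]
  rw [← ofReal_measureReal (μ := Measure.pi (fun q => mixedLaw n (indexLaw idx coinOf g c I q)))]
  exact ENNReal.ofReal_le_ofReal hreal

/-- Two codewords that are far apart cannot both agree with the answer to the final query. -/
theorem mem_inaccurate_or (hdwt : Fintype.card ι ≤ 128 * wt d) {c c' : Fin m → C}
    (hc' : (c' j : ι → ZMod 2) = c j + d) (s : Fin m → Fin (k - 1) → unitInterval)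
    {a : Fin (N + m) → ℝ}
    (ha : guess idx C (T / (8 * n + 1))
        (bits fun q : Fin N => a (q.castLE (Nat.le_add_right N m))) j = c j ∨
      guess idx C (T / (8 * n + 1))
        (bits fun q : Fin N => a (q.castLE (Nat.le_add_right N m))) j = c j + d) :
    a ∈ inaccurate (analyst C n idx coinOf) (hypothesis (words c) s) (N + m) (1 / 256) ∪
      inaccurate (analyst C n idx coinOf) (hypothesis (words c') s) (N + m) (1 / 256) := by
  have hι : (0 : ℝ) < Fintype.card ι := by exact_mod_cast Fintype.card_pos
  have hfar : (1 / 128 : ℝ) ≤ wt d / (Fintype.card ι : ℝ) := by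
    rw [div_le_div_iff₀ (by norm_num) hι, one_mul]
    have : (Fintype.card ι : ℝ) ≤ 128 * wt d := by exact_mod_cast hdwt
    linarith
  set w := guess idx C (T / (8 * n + 1))
        (bits fun q : Fin N => a (q.castLE (Nat.le_add_right N m))) j with hw
  have hq : ∀ c : Fin m → C, expect (hypothesis (words c) s) ((analyst C n idx coinOf).query
      (Fin.natAdd N j : Fin (N + m)) fun l => a (l.castLE (Fin.natAdd N j).2.le)) =
      1 - wt ((c j : ι → ZMod 2) - w) / (Fintype.card ι : ℝ) := by
    intro c
    have h := analyst_query_add (C := C) (n := n) idx coinOf j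
      fun l => a (l.castLE (Fin.natAdd N j).2.le)
    exact (congrArg _ h).trans (expect_agreeQuery j w (words c) s)
  -- The two true answers are 1 and 1 - wt d / m, in some order; they are at least 1/128 apart,
  -- twice the tolerance.
  by_contra hcon
  rw [Set.mem_union, not_or] at hcon
  simp only [inaccurate, Set.mem_ofPred_eq, not_exists, not_not] at hcon
  have h1 := hcon.1 (Fin.natAdd N j)
  have h2 := hcon.2 (Fin.natAdd N j)
  rw [hq] at h1 h2
  rw [hc'] at h2
  rw [abs_lt] at h1 h2
  rcases ha with ha | ha <;> rw [ha] at h1 h2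
  · rw [sub_self, wt_zero] at h1
    rw [add_sub_cancel_left] at h2
    simp only [Nat.cast_zero, zero_div] at h1
    linarith [h1.1, h1.2, h2.1, h2.2]
  · rw [sub_self, wt_zero] at h2
    rw [sub_add_cancel_left, wt_neg] at h1
    simp only [Nat.cast_zero, zero_div] at h2
    linarith [h1.1, h1.2, h2.1, h2.2]

/-- Either the curator misplaces extreme counts and fails for `c` alone, or the guess is one of the
two codewords with probability at least 1/2. In the latter case the law of the transcript is the
same for `c` and `c'`, and every transcript with such a guess is inaccurate for at least one of
them. -/
theorem le_inaccuracy_add (hn : Fintype.card ι ≤ 8 * n) (hn2 : 2 ≤ n)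
    (hcoin : Function.Injective coinOf) (hC : ∀ i, ∃ d ∈ C, d i = 1) (hd0 : d ≠ 0)
    (hd : vanishing C (I j) = {0, d}) (hdwt : Fintype.card ι ≤ 128 * wt d) (hTpos : 0 < T)
    (hT : Real.exp (-(T / (8 * (8 * n + 1)))) ≤ 1 / 4)
    (hT' : Fintype.card ι * (2 * Real.exp (-(T / (4 * (8 * n + 1 : ℝ) ^ 2)))) ≤ 1 / 2)
    {c c' : Fin m → C} (hc' : (c' j : ι → ZMod 2) = c j + d)
    (hcI : ∀ j r, (c' j : ι → ZMod 2) (I j r) = (c j : ι → ZMod 2) (I j r)) :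
    ENNReal.ofReal (1 / 2) ≤
      inaccuracy idx coinOf g c I (1 / 256) + inaccuracy idx coinOf g c' I (1 / 256) := by
  set τ₀ : Fin T := ⟨0, hTpos⟩
  by_cases hA : ∃ i, d i = 0 ∧
      (1 / 4 ≤ (curatorLaw C n coinOf g τ₀ j i 0).real (Set.Ioi (1 / 6)) +
        (curatorLaw C n coinOf g τ₀ j i 1).real (Set.Ioi (1 / 6)) ∨
      1 / 4 ≤ (curatorLaw C n coinOf g τ₀ j i (8 * n + 1)).real (Set.Iic (1 / 6)) +
        (curatorLaw C n coinOf g τ₀ j i (8 * n + 2)).real (Set.Iic (1 / 6)))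
  · obtain ⟨i, hi, h⟩ := hA
    refine le_trans ?_ (le_add_right
      (le_inaccuracy_of_misplaced idx coinOf g c I hn hn2 hcoin hC hd0 hd τ₀ hT hi h))
    exact ENNReal.ofReal_le_ofReal (by norm_num)
  · push Not at hA
    have hB := le_measure_pi_guess idx coinOf g c I hn hC hd0 hd τ₀ hT' hA
    refine hB.trans ?_
    set H : Set (Fin N → ℝ) := {b | guess idx C (T / (8 * n + 1)) (bits b) j = c j ∨
        guess idx C (T / (8 * n + 1)) (bits b) j = c j + d} with hH
    have hHm : MeasurableSet H := measurable_bits (Set.toFinite {u |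
      guess idx C (T / (8 * n + 1)) u j = c j ∨
        guess idx C (T / (8 * n + 1)) u j = c j + d}).measurableSet
    have hmeas : Measurable fun s : Fin m → Fin (k - 1) → unitInterval =>
        ∑ y : Fin m → Fin (k - 1) → Fin n → Fin 8 → Fin 2, coinsWeight s y *
          transcript (challengeModel C k m) g (analyst C n idx coinOf) (sample (words c) I y) (N + m)
            (inaccurate (analyst C n idx coinOf) (hypothesis (words c) s) (N + m) (1 / 256)) :=
      Finset.measurable_sum _ fun y _ => (measurable_coinsWeight y).mul
        ((measurable_transcript_inaccurate _ g _ _ _ _).comp (measurable_hypothesis _))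
    rw [← lintegral_sum_coinsWeight_mul_pi (coinPos_injective idx coinOf hcoin), inaccuracy,
      inaccuracy, ← lintegral_add_left hmeas]
    refine lintegral_mono fun s => ?_
    rw [← Finset.sum_add_distrib]
    refine Finset.sum_le_sum fun y _ => ?_
    rw [← mul_add]
    gcongr
    have hs : sample (words c') I y = sample (words c) I y := by
      funext r j
      simp only [sample, words, hcI]
    rw [hs, ← transcript_learning idx coinOf g c I hn y,
      ← transcript_castLE (challengeModel C k m) g (analyst C n idx coinOf)
        (sample (words c) I y) (Nat.le_add_right N m) hHm]
    refine (measure_mono fun a ha => ?_).trans (measure_union_le _ _)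
    exact mem_inaccurate_or idx coinOf hdwt hc' s ha

end CriticalBlock

/-! ### Averages over the codewords and over the positions of the samples. -/

section Average

variable {ι : Type*} [Fintype ι] [Nonempty ι] {C : Submodule (ZMod 2) (ι → ZMod 2)}
  {k m n N T : ℕ} (idx : Fin N ≃ Fin m × ι × ZMod 2 × Fin T)
  (coinOf : ι × ZMod 2 × Fin T → Fin (k - 1)) (g : MeanCurator)

open Classical in
/-- If the samples leave two codewords possible in some block, then the curator fails for at least
a quarter of the codewords. -/
theorem le_sum_inaccuracy (hn : Fintype.card ι ≤ 8 * n) (hn2 : 2 ≤ n)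
    (hcoin : Function.Injective coinOf) (hC : ∀ i, ∃ d ∈ C, d i = 1)
    (hwt : ∀ d ∈ C, d ≠ 0 → Fintype.card ι ≤ 128 * wt d) (hTpos : 0 < T)
    (hT : Real.exp (-(T / (8 * (8 * n + 1)))) ≤ 1 / 4)
    (hT' : Fintype.card ι * (2 * Real.exp (-(T / (4 * (8 * n + 1 : ℝ) ^ 2)))) ≤ 1 / 2)
    {I : Fin m → Fin n → ι} {j : Fin m} (hI : I j ∈ critical C n) :
    (Nat.card C : ENNReal) ^ m * ENNReal.ofReal (1 / 4) ≤
      ∑ c : Fin m → C, inaccuracy idx coinOf g c I (1 / 256) := by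
  obtain ⟨d, hd0, hd⟩ : ∃ d, d ≠ 0 ∧ vanishing C (I j) = {0, d} := by
    obtain ⟨a, b, hab, h⟩ := Finset.card_eq_two.1 (Finset.mem_filter.1 hI).2
    have h0 : (0 : ι → ZMod 2) ∈ vanishing C (I j) := zero_mem_vanishing
    rw [h, Finset.mem_insert, Finset.mem_singleton] at h0
    rcases h0 with rfl | rfl
    · exact ⟨b, hab.symm, h⟩
    · exact ⟨a, hab, h.trans (Finset.pair_comm _ _)⟩
  obtain ⟨hdC, hdI⟩ := mem_vanishing.1 (show d ∈ vanishing C (I j) by simp [hd])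
  -- Translation by `v` permutes the tuples of codewords and exchanges the two possibilities in
  -- block `j`, so summing the bounds for pairs counts each tuple twice.
  set v : Fin m → C := Pi.single j ⟨d, hdC⟩ with hv
  have hsum : ∑ c : Fin m → C, inaccuracy idx coinOf g (c + v) I (1 / 256) =
      ∑ c : Fin m → C, inaccuracy idx coinOf g c I (1 / 256) :=
    Equiv.sum_comp (Equiv.addRight v) fun c => inaccuracy idx coinOf g c I (1 / 256)
  have hpair : ∀ c : Fin m → C, ENNReal.ofReal (1 / 2) ≤
      inaccuracy idx coinOf g c I (1 / 256) + inaccuracy idx coinOf g (c + v) I (1 / 256) := by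
    intro c
    refine le_inaccuracy_add idx coinOf g I hn hn2 hcoin hC hd0 hd (hwt d hdC hd0) hTpos hT hT'
      (by simp [hv]) fun i r => ?_
    by_cases hij : i = j
    · subst hij
      simp [hv, hdI]
    · simp [hv, hij]
  have hcard : ∑ _c : Fin m → C, ENNReal.ofReal (1 / 2) =
      2 * ((Nat.card C : ENNReal) ^ m * ENNReal.ofReal (1 / 4)) := by
    rw [Finset.sum_const, Finset.card_univ, Fintype.card_pi, Finset.prod_const, Finset.card_univ,
      Fintype.card_fin, nsmul_eq_mul, Nat.card_eq_fintype_card, mul_left_comm,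
      show (2 : ENNReal) = ENNReal.ofReal 2 by simp, ← ENNReal.ofReal_mul (by norm_num)]
    norm_num
  have h2 := Finset.sum_le_sum fun c (_ : c ∈ Finset.univ) => hpair c
  rw [hcard, Finset.sum_add_distrib, hsum, ← two_mul] at h2
  exact (ENNReal.mul_le_mul_iff_right (by norm_num) (by norm_num)).1 h2

open Classical in
theorem card_filter_exists_mem (A : Finset (Fin n → ι)) :
    (((Finset.univ : Finset (Fin m → Fin n → ι)).filter fun I => ∃ j, I j ∈ A).card : ℝ) =
      ((Fintype.card ι : ℝ) ^ n) ^ m - ((Fintype.card ι : ℝ) ^ n - A.card) ^ m := by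
  have hcompl : ((Finset.univ : Finset (Fin m → Fin n → ι)).filter fun I => ¬ ∃ j, I j ∈ A) =
      Fintype.piFinset fun _ => Aᶜ := by
    ext I
    simp
  have h := Finset.card_filter_add_card_filter_not (s := (Finset.univ : Finset (Fin m → Fin n → ι)))
    fun I => ∃ j, I j ∈ A
  rw [hcompl, Fintype.card_piFinset, Finset.prod_const, Finset.card_univ, Finset.card_univ,
    Fintype.card_fin] at h
  have hA := Finset.card_add_card_compl A
  simp only [Fintype.card_pi, Finset.prod_const, Finset.card_univ, Fintype.card_fin] at h hA
  have hA' : (Aᶜ.card : ℝ) = (Fintype.card ι : ℝ) ^ n - A.card := by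
    rw [eq_sub_iff_add_eq']
    exact_mod_cast hA
  rw [← hA', eq_sub_iff_add_eq]
  exact_mod_cast h

/-- Each block is critical with probability at least 1/(512m), so none of the m blocks is with
probability at most e^(-1/512). Hence the m-fold tensor power in the model. -/
theorem one_sub_exp_le (hm : m = Fintype.card ι) (A : Finset (Fin n → ι))
    (hA : (Fintype.card ι : ℝ) ^ n ≤ 512 * Fintype.card ι * A.card) :
    1 - Real.exp (-(1 / 512)) ≤ ((1 / (Fintype.card ι : ℝ)) ^ n) ^ m *
      (((Fintype.card ι : ℝ) ^ n) ^ m - ((Fintype.card ι : ℝ) ^ n - A.card) ^ m) := by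
  subst hm
  have hι : (0 : ℝ) < Fintype.card ι := by exact_mod_cast Fintype.card_pos
  set x : ℝ := A.card / (Fintype.card ι : ℝ) ^ n with hx
  have hx1 : x ≤ 1 := by
    rw [hx, div_le_one (by positivity)]
    have := Finset.card_le_univ A
    simp only [Fintype.card_pi, Finset.prod_const, Finset.card_univ, Fintype.card_fin] at this
    exact_mod_cast this
  have hx2 : 1 / 512 ≤ Fintype.card ι * x := by
    rw [hx, mul_div_assoc', div_le_div_iff₀ (by norm_num) (by positivity)]
    linarith
  have he : ((1 / (Fintype.card ι : ℝ)) ^ n) ^ Fintype.card ι *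
      (((Fintype.card ι : ℝ) ^ n) ^ Fintype.card ι -
        ((Fintype.card ι : ℝ) ^ n - A.card) ^ Fintype.card ι) = 1 - (1 - x) ^ Fintype.card ι := by
    rw [mul_sub, ← mul_pow, ← mul_pow, ← mul_pow, one_div_mul_cancel hι.ne', one_pow, one_pow, hx]
    congr 2
    rw [mul_sub, ← mul_pow, one_div_mul_cancel hι.ne', one_pow, one_div, inv_pow, inv_mul_eq_div]
  rw [he]
  have h1 : (1 - x) ^ Fintype.card ι ≤ Real.exp (-(1 / 512)) := by
    calc (1 - x) ^ Fintype.card ι ≤ Real.exp (-x) ^ Fintype.card ι :=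
          pow_le_pow_left₀ (by linarith) (Real.one_sub_le_exp_neg x) _
      _ = Real.exp (Fintype.card ι * -x) := (Real.exp_nat_mul _ _).symm
      _ ≤ _ := Real.exp_le_exp.2 (by linarith)
  linarith

/-- The failure probability of every curator, for a code in which a critical choice of the
coordinates is not too rare. -/
theorem le_failureProb_analyst (hm : m = Fintype.card ι) (hn : Fintype.card ι ≤ 8 * n) (hn2 : 2 ≤ n)
    (hcoin : Function.Injective coinOf) (hC : ∀ i, ∃ d ∈ C, d i = 1)
    (hwt : ∀ d ∈ C, d ≠ 0 → Fintype.card ι ≤ 128 * wt d) (hTpos : 0 < T)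
    (hT : Real.exp (-(T / (8 * (8 * n + 1)))) ≤ 1 / 4)
    (hT' : Fintype.card ι * (2 * Real.exp (-(T / (4 * (8 * n + 1 : ℝ) ^ 2)))) ≤ 1 / 2)
    (hcrit : (Fintype.card ι : ℝ) ^ n ≤ 512 * Fintype.card ι * (critical C n).card) :
    ENNReal.ofReal ((1 - Real.exp (-(1 / 512))) / 4) ≤
      failureProb (challengeModel C k m) n g (analyst C n idx coinOf) (N + m) (1 / 256) := by
  classical
  refine le_trans ?_ (le_failureProb g (analyst C n idx coinOf) (N + m) (1 / 256))
  -- Whether positions are critical does not depend on the codewords, so the positions are fixed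
  -- first.
  rw [Finset.sum_comm]
  set G := (Finset.univ : Finset (Fin m → Fin n → ι)).filter fun I => ∃ j, I j ∈ critical C n
    with hG
  have hc0 : (Nat.card C : ENNReal) ≠ 0 := by exact_mod_cast Nat.card_pos.ne'
  have hι : (0 : ℝ) < Fintype.card ι := by exact_mod_cast Fintype.card_pos
  have hpos : (0 : ℝ) ≤ ((1 / (Fintype.card ι : ℝ)) ^ n) ^ m := by positivity
  calc ENNReal.ofReal ((1 - Real.exp (-(1 / 512))) / 4)
      ≤ ENNReal.ofReal (((1 / (Fintype.card ι : ℝ)) ^ n) ^ m * G.card * (1 / 4)) := by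
        refine ENNReal.ofReal_le_ofReal ?_
        have h := one_sub_exp_le hm _ hcrit
        rw [← card_filter_exists_mem] at h
        linarith
    _ = ∑ I ∈ G, ENNReal.ofReal (((1 / (Fintype.card ι : ℝ)) ^ n) ^ m) * ENNReal.ofReal (1 / 4) := by
        rw [Finset.sum_const, nsmul_eq_mul, ENNReal.ofReal_mul (by positivity),
          ENNReal.ofReal_mul hpos, ENNReal.ofReal_natCast, ← mul_assoc, mul_comm (G.card : ENNReal)]
    _ ≤ ∑ I ∈ G, ∑ c : Fin m → C,
        ((Nat.card C : ENNReal)⁻¹) ^ m * ENNReal.ofReal (((1 / (Fintype.card ι : ℝ)) ^ n) ^ m) *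
          inaccuracy idx coinOf g c I (1 / 256) := by
        refine Finset.sum_le_sum fun I hI => ?_
        obtain ⟨j, hj⟩ := (Finset.mem_filter.1 hI).2
        rw [← Finset.mul_sum]
        refine le_trans (le_of_eq ?_) (mul_le_mul_right (le_sum_inaccuracy idx coinOf g hn hn2 hcoin
          hC hwt hTpos hT hT' hj) _)
        rw [mul_comm ((Nat.card C : ENNReal)⁻¹ ^ m), mul_assoc, ← mul_assoc (_ ^ m) (_ ^ m),
          ← mul_pow, ENNReal.inv_mul_cancel hc0 (ENNReal.natCast_ne_top _), one_pow, one_mul]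
    _ ≤ ∑ I, ∑ c : Fin m → C,
        ((Nat.card C : ENNReal)⁻¹) ^ m * ENNReal.ofReal (((1 / (Fintype.card ι : ℝ)) ^ n) ^ m) *
          inaccuracy idx coinOf g c I (1 / 256) :=
        Finset.sum_le_sum_of_subset (Finset.subset_univ _)
    _ ≤ _ := le_of_eq rfl

end Average

/-! ### Estimates for the number of repetitions. -/

section Repetitions

/-- The number of the repetitions of a query by which the analyst learns the bits, when there are
`n` samples. -/
def repetitions (n : ℕ) : ℕ := ⌈16 * (8 * (n : ℝ) + 1) ^ 2 * Real.log n⌉₊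

variable {n : ℕ}

theorem one_le_log (hn : 4 ≤ n) : 1 ≤ Real.log n := by
  have h4 : (4 : ℝ) ≤ n := by exact_mod_cast hn
  rw [Real.le_log_iff_exp_le (by linarith)]
  linarith [Real.exp_one_lt_d9]

theorem le_repetitions (n : ℕ) : 16 * (8 * (n : ℝ) + 1) ^ 2 * Real.log n ≤ repetitions n :=
  Nat.le_ceil _

theorem repetitions_pos (hn : 4 ≤ n) : 0 < repetitions n := by
  have := one_le_log hn
  exact Nat.ceil_pos.2 (by positivity)

theorem repetitions_le (hn : 4 ≤ n) : (repetitions n : ℝ) ≤ 1297 * (n ^ 2 * Real.log n) := by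
  have hlog := one_le_log hn
  have h4 : (4 : ℝ) ≤ n := by exact_mod_cast hn
  have h1 : (repetitions n : ℝ) < 16 * (8 * (n : ℝ) + 1) ^ 2 * Real.log n + 1 :=
    Nat.ceil_lt_add_one (by positivity)
  have h2 : (8 * (n : ℝ) + 1) ^ 2 ≤ 81 * n ^ 2 := by nlinarith
  have h3 : (8 * (n : ℝ) + 1) ^ 2 * Real.log n ≤ 81 * n ^ 2 * Real.log n := by gcongr
  have h5 : 1 ≤ (n : ℝ) ^ 2 * Real.log n := by nlinarith
  linarith

theorem exp_neg_repetitions_le_quarter (hn : 4 ≤ n) :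
    Real.exp (-(repetitions n / (8 * (8 * n + 1)))) ≤ 1 / 4 := by
  have hlog := one_le_log hn
  have h4 : (4 : ℝ) ≤ n := by exact_mod_cast hn
  have h : Real.log n ≤ repetitions n / (8 * (8 * n + 1)) := by
    rw [le_div_iff₀ (by positivity)]
    refine le_trans ?_ (le_repetitions n)
    have : (8 * (8 * n + 1) : ℝ) ≤ 16 * (8 * (n : ℝ) + 1) ^ 2 := by nlinarith
    nlinarith
  calc Real.exp (-(repetitions n / (8 * (8 * n + 1)))) ≤ Real.exp (-Real.log n) :=
        Real.exp_le_exp.2 (neg_le_neg h)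
    _ = (n : ℝ)⁻¹ := by rw [Real.exp_neg, Real.exp_log (by linarith)]
    _ ≤ 1 / 4 := by rw [one_div]; exact inv_anti₀ (by norm_num) h4

theorem mul_exp_neg_repetitions_le_half (hn : 4 ≤ n) {m : ℕ} (hm : m ≤ 8 * n) :
    m * (2 * Real.exp (-(repetitions n / (4 * (8 * n + 1 : ℝ) ^ 2)))) ≤ 1 / 2 := by
  have h4 : (4 : ℝ) ≤ n := by exact_mod_cast hn
  have hm' : (m : ℝ) ≤ 8 * n := by exact_mod_cast hm
  -- The factor 16 in `repetitions` makes the exponent 4 log n, enough for the union bound over at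
  -- most 8n coordinates.
  have h : (4 : ℕ) * Real.log n ≤ repetitions n / (4 * (8 * n + 1 : ℝ) ^ 2) := by
    rw [le_div_iff₀ (by positivity)]
    refine le_of_eq_of_le ?_ (le_repetitions n)
    push_cast
    ring
  have h1 : Real.exp (-(repetitions n / (4 * (8 * n + 1 : ℝ) ^ 2))) ≤ ((n : ℝ) ^ 4)⁻¹ := by
    calc _ ≤ Real.exp (-((4 : ℕ) * Real.log n)) := Real.exp_le_exp.2 (neg_le_neg h)
      _ = _ := by rw [Real.exp_neg, Real.exp_nat_mul, Real.exp_log (by linarith)]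
  calc (m : ℝ) * (2 * Real.exp (-(repetitions n / (4 * (8 * n + 1 : ℝ) ^ 2))))
      ≤ (8 * n) * (2 * ((n : ℝ) ^ 4)⁻¹) := by gcongr
    _ = 16 / (n : ℝ) ^ 3 := by field_simp; norm_num
    _ ≤ 16 / 4 ^ 3 := by gcongr
    _ ≤ 1 / 2 := by norm_num

end Repetitions

/-- The dimension t * 2^(t-1) of the code is at least m/4 and at most n + 1, so m ≤ 4(n + 1) ≤ 8n.
-/
theorem card_justesenIndex_le {t n : ℕ} [NeZero t] {F : Type} [Field F] [Fintype F] [DecidableEq F]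
    [Algebra (ZMod 2) F] (ht : 4 ≤ t) (b : Module.Basis (Fin t) (ZMod 2) F)
    (hn : Nat.card (justesenCode b) ≤ 2 ^ (n + 1)) :
    4 ≤ n ∧ Fintype.card (JustesenIndex F t) ≤ 8 * n := by
  rw [← card_justesenCode, Nat.pow_le_pow_iff_right (by norm_num)] at hn
  obtain ⟨s, rfl⟩ : ∃ s, t = s + 1 := ⟨t - 1, by omega⟩
  rw [card_justesenIndex b]
  have h8 : 2 ^ 3 ≤ 2 ^ s := Nat.pow_le_pow_right (by norm_num) (by omega)
  rw [Nat.add_sub_cancel] at hn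
  have h32 : 4 * 2 ^ 3 ≤ (s + 1) * 2 ^ s := Nat.mul_le_mul ht h8
  refine ⟨by omega, ?_⟩
  calc (2 ^ (s + 1) - 1) * (2 * (s + 1)) ≤ 2 ^ (s + 1) * (2 * (s + 1)) :=
        Nat.mul_le_mul_right _ (Nat.sub_le _ _)
    _ = 4 * ((s + 1) * 2 ^ s) := by ring
    _ ≤ 8 * n := by omega

end BayesianADA

end

/-! ### Choice of the parameters. -/

open BayesianADA

theorem mainTheorem1 :
    ∃ ε δ c₁ c₂ K : ℝ, 0 < ε ∧ 0 < δ ∧ 0 < c₁ ∧ 0 < c₂ ∧ 0 < K ∧ ∃ t₀ : ℕ,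
      ∀ (t : ℕ) [NeZero t], t₀ ≤ t →
      ∀ (F : Type) [Field F] [Fintype F] [DecidableEq F] [Algebra (ZMod 2) F]
        (b : Module.Basis (Fin t) (ZMod 2) F) (m : ℕ),
        m = Fintype.card (BayesianADA.JustesenIndex F t) →
        ∃ n : ℕ, c₁ * m ≤ n ∧ (n : ℝ) ≤ c₂ * m ∧
          ∃ q : ℕ, 1 ≤ q ∧ (m * q : ℝ) ≤ K * ((n : ℝ) ^ 4 * Real.log n) ∧
            ∀ k : ℕ, q ≤ k →
              ∃ S : BayesianADA.Strategy
                  (BayesianADA.ChallengeUniverse (BayesianADA.JustesenIndex F t) k m),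
                ∀ g : BayesianADA.MeanCurator,
                  ENNReal.ofReal δ ≤
                    BayesianADA.failureProb
                      (BayesianADA.challengeModel (BayesianADA.justesenCode b) k m)
                      n g S (m * q) ε := by
  -- Here ε is half the relative distance 1/128, and δ is a quarter of the probability bound for a
  -- critical block. The bounds 1/8 and 256 come from m ≤ 8n and n ≤ 256m, and 200000 exceeds 2 * 64
  -- * 1297 + 8.
  refine ⟨1 / 256, (1 - Real.exp (-(1 / 512))) / 4, 1 / 8, 256, 200000, by norm_num, ?_,
    by norm_num, by norm_num, by norm_num, 4, ?_⟩
  · have : Real.exp (-(1 / 512)) < 1 := Real.exp_lt_one_iff.2 (by norm_num)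
    linarith
  intro t _ ht F _ _ _ _ b m hm
  have hcard : 1 < Nat.card (justesenCode b) := by
    rw [← card_justesenCode]
    exact Nat.one_lt_two_pow (by positivity)
  have hwt : ∀ c ∈ justesenCode b, c ≠ 0 → Fintype.card (JustesenIndex F t) ≤ 128 * wt c :=
    fun c hc h0 => le_wt_justesen b ht hc h0
  obtain ⟨n, hn256, hn2, hcrit⟩ := exists_card_critical_ge hcard hwt
  obtain ⟨hn4, hm8⟩ := card_justesenIndex_le ht b hn2
  set T := repetitions n with hT
  have hmn : (m : ℝ) ≤ 8 * n := by rw [hm]; exact_mod_cast hm8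
  -- Each block gets 2mT learning queries, one for every coordinate, bit value and repetition, and
  -- one agreement query. The 2mT learning queries of a block need as many distinct coins, available
  -- because k - 1 ≥ 2mT.
  refine ⟨n, by linarith, by rw [hm]; exact_mod_cast hn256, m * (2 * T) + 1, by omega, ?_, ?_⟩
  · have hTle := repetitions_le hn4
    have hlog := one_le_log hn4
    have h4 : (4 : ℝ) ≤ n := by exact_mod_cast hn4
    have h1 : (m : ℝ) ^ 2 * T ≤ (8 * n) ^ 2 * (1297 * (n ^ 2 * Real.log n)) := by gcongr
    have h2 : (n : ℝ) * 1 ≤ n ^ 4 * Real.log n := by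
      refine mul_le_mul ?_ hlog (by norm_num) (by positivity)
      exact le_self_pow₀ (by linarith) (by norm_num)
    push_cast
    nlinarith
  · intro k hk
    have hidx : Fintype.card (Fin (m * (m * (2 * T)))) =
        Fintype.card (Fin m × JustesenIndex F t × ZMod 2 × Fin T) := by
      simp only [Fintype.card_prod (Fin m), Fintype.card_prod (JustesenIndex F t), ← hm,
        Fintype.card_prod (ZMod 2), Fintype.card_fin, ZMod.card]
    have hcoins : Fintype.card (JustesenIndex F t × ZMod 2 × Fin T) ≤
        Fintype.card (Fin (k - 1)) := by
      simp only [Fintype.card_prod (JustesenIndex F t), ← hm,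
        Fintype.card_prod (ZMod 2), Fintype.card_fin, ZMod.card]
      omega
    obtain ⟨coinOf⟩ := Function.Embedding.nonempty_of_card_le hcoins
    refine ⟨analyst (justesenCode b) n (Fintype.equivOfCardEq hidx) coinOf, fun g => ?_⟩
    rw [Nat.mul_succ]
    exact le_failureProb_analyst _ _ g hm hm8 (by omega) coinOf.injective
      (exists_mem_justesenCode_eq_one b) hwt (repetitions_pos hn4)
      (exp_neg_repetitions_le_quarter hn4) (mul_exp_neg_repetitions_le_half hn4 hm8) hcrit
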